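/- **Setting.** Let $W_i=(Y_i(0),Y_i(1),Z_i)$, $i\ge 1$, be i.i.d. random vectors in $\mathbb R^{2+k}$ with law $Q_0$ on a probability space $(\Omega,\mathcal F,\Pr)$. Here $Q_0$ belongs to a family $\mathbf Q$ of laws $Q$ that are dominated by a product $\mu_0\otimes\mu_1\otimes\mu_Z$ of $\sigma$-finite Borel measures and satisfy $E_Q[Y(a)^2]<\infty$ for $a\in\{0,1\}$. Let $\mathbb S:\mathbb R^k\to\{1,\dots,\mathcal S\}$ be measurable, $\pi(s)\in(0,1)$ for every $s$, and $S_i=\mathbb S(Z_i)$. For each $n$ let $\mathbf A_n=(A_{n1},\dots,A_{nn})\in\{0,1\}^n$ be the treatment assignments, with observed outcomes $Y_{ni}=Y_i(1)A_{ni}+Y_i(0)(1-A_{ni})$. Put $N_n(s)=\#\{i\le n:S_i=s\}$ and $N_n(a,s)=\#\{i\le n:A_{ni}=a,\,S_i=s\}$, with $0/0=0$. Assume that for every $n$, $(W_1,\dots,W_n)$ and $\mathbf A_n$ are conditionally independent given $\mathbf S_n=(S_1,\dots,S_n)$; that the conditional probabilities $\Pr(\mathbf A_n=\mathbf a\mid\mathbf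 S_n=\mathbf s)=\alpha_n(\mathbf a\mid\mathbf s)$ are given by a known mechanism $\alpha_n$ that does not depend on $Q_0$; and that $N_n(1,s)/N_n(s)\to\pi(s)$ in probability for every stratum $s$ with $Q_0(\mathbb S(Z)=s)>0$. For $Q\in\mathbf Q$ let $m(a,z;Q)=E_Q[Y(a)\mid Z=z]$. Let $m_*(a,z)=m(a,z;Q_0)$, $\beta_0=E_{Q_0}[Y(1)-Y(0)]$, $$\mathbb V_*=E_{Q_0}\Big[\tfrac{\mathrm{Var}[Y(1)\mid Z]}{\pi(\mathbb S(Z))}+\tfrac{\mathrm{Var}[Y(0)\mid Z]}{1-\pi(\mathbb S(Z))}+\{m_*(1,Z)-m_*(0,Z)-\beta_0\}^2\Big],$$ $$\varphi_0(y,a,z)=\tfrac{a}{\pi(\mathbb S(z))}[y-m_*(1,z)]-\tfrac{1-a}{1-\pi(\mathbb S(z))}[y-m_*(0,z)]+m_*(1,z)-m_*(0,z)-\beta_0 .$$ The infeasible AIPW estimator is $$\widetilde\beta_n^*=\frac1n\sum_{i=1}^n\Big\{\tfrac{A_{ni}[Y_{ni}-m_*(1,Z_i)]}{\pi(S_i)}-\tfrac{(1-A_{ni})[Y_{ni}-m_*(0,Z_i)]}{1-\pi(S_i)}+m_*(1,Z_i)-m_*(0,Z_i)\Big\}.$$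 **Theorem, part 1.** Under these assumptions $$\sqrt n(\widetilde\beta_n^*-\beta_0)=\frac1{\sqrt n}\sum_{i=1}^n\varphi_0(Y_{ni},A_{ni},Z_i)\ \xrightarrow{d}\ \mathcal N(0,\mathbb V_*).$$ **Theorem, part 2.** Suppose in addition the following. * *Regression estimator.* $\widehat m(n,a,z;y_1,z_1,\dots,y_n,z_n)$ is jointly measurable in $(z,y_1,z_1,\dots,y_n,z_n)$, and it is $L^2$ consistent at each $Q$ in a set $\mathbf Q(\widehat m)\subseteq\mathbf Q$. That is, for $a\in\{0,1\}$, $$E_{Q^{n+1}}\big[(\widehat m(n,a,Z;Y_1(a),Z_1,\dots,Y_n(a),Z_n)-m(a,Z;Q))^2\big]\to0,$$ where $(Y(0),Y(1),Z)$ and $(Y_i(0),Y_i(1),Z_i)$, $i\le n$, are i.i.d. with law $Q$. The set $\mathbf Q(\widehat m)$ contains $Q_0$ and every within-stratum law $Q_0(\cdot\mid\mathbb S(Z)=s)$ with $Q_0(\mathbb S(Z)=s)>0$. * *Cross-fitting.* $J\ge2$. For each $n$, the variables $U_n(a,s)$, $a\in\{0,1\}$, $s\le\mathcal S$, are independent uniform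 variables on $[0,1]$, jointly independent of $((W_1,\dots,W_n),\mathbf A_n)$. For each $(a,s)$ the sets $\mathcal G_{n1}(a,s),\dots,\mathcal G_{nJ}(a,s)$ are random, measurable with respect to $U_n(a,s)$ and the random set $\{i\le n:A_{ni}=a,S_i=s\}$, and they partition that set (empty folds are allowed). The first $J-1$ of them have $\lfloor N_n(a,s)/J\rfloor$ elements each, and the last has the remaining $N_n(a,s)-(J-1)\lfloor N_n(a,s)/J\rfloor$. Let $\mathcal G_{nj}(s)=\mathcal G_{nj}(1,s)\cup\mathcal G_{nj}(0,s)$, $\Gamma_n(a,i)=\bigcup\{\mathcal G_{nj}(a,S_i): i\notin\mathcal G_{nj}(S_i)\}$ and $\widehat m_{ni}(a,z)=\widehat m(|\Gamma_n(a,i)|,a,z;(Y_\iota(a),Z_\iota)_{\iota\in\Gamma_n(a,i)})$, with the data taken in increasing order of $\iota$. * *Proportions.* For each $s$, either $\widehat\pi_n(s)=\pi(s)$ for all $n$ or $\widehat\pi_n(s)=N_n(1,s)/N_n(s)$ for all $n$. In either case $\sqrt n\,|N_n(1,s)/N_n(s)-\pi(s)|=O_p(1)$ for every $s$ with $Q_0(\mathbb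 S(Z)=s)>0$. Let $$\widehat\beta_n^*=\frac1n\sum_{i=1}^n\tfrac{A_{ni}[Y_{ni}-\widehat m_{ni}(1,Z_i)]}{\widehat\pi_n(S_i)}-\frac1n\sum_{i=1}^n\tfrac{(1-A_{ni})[Y_{ni}-\widehat m_{ni}(0,Z_i)]}{1-\widehat\pi_n(S_i)}+\frac1n\sum_{i=1}^n[\widehat m_{ni}(1,Z_i)-\widehat m_{ni}(0,Z_i)].$$ Then $\sqrt n(\widehat\beta_n^*-\beta_0)=\sqrt n(\widetilde\beta_n^*-\beta_0)+o_p(1)$. Consequently $\sqrt n(\widehat\beta_n^*-\beta_0)\xrightarrow{d}\mathcal N(0,\mathbb V_*)$, so $\widehat\beta_n^*$ attains the bound $\mathbb V_*$. -/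

import Mathlib

open MeasureTheory ProbabilityTheory Filter Topology

namespace CAR

/-- The space `ℝ × ℝ × ℝᵏ` of values of `W = (Y(0), Y(1), Z)`. -/
abbrev PO (k : ℕ) : Type := ℝ × ℝ × (Fin k → ℝ)

/-- The potential outcome `Y(a)`; treatment is `a = true`, control is `a = false`. -/
def outcome {k : ℕ} (a : Bool) (w : PO k) : ℝ := if a then w.2.1 else w.1

/-- The baseline covariates `Z`. -/
def covariate {k : ℕ} (w : PO k) : Fin k → ℝ := w.2.2

/-- A treatment label as the real number 0 or 1. -/
def toReal (a : Bool) : ℝ := if a then 1 else 0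

section Population

variable {k : ℕ}

/-- A family of laws on `ℝ × ℝ × ℝᵏ`, each dominated by the product of the given measures and with
square integrable potential outcomes. -/
structure IsPopulationFamily (μ₀ μ₁ : Measure ℝ) (μZ : Measure (Fin k → ℝ))
    (Qfam : Set (ProbabilityMeasure (PO k))) : Prop where
  dominated : ∀ Q ∈ Qfam, (Q : Measure (PO k)) ≪ μ₀.prod (μ₁.prod μZ)
  memLp_two : ∀ Q ∈ Qfam, ∀ a, MemLp (outcome a) 2 (Q : Measure (PO k))

/-- The average treatment effect `E_Q[Y(1) - Y(0)]`. -/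
noncomputable def ate (Q : ProbabilityMeasure (PO k)) : ℝ :=
  ∫ w, (outcome true w - outcome false w) ∂(Q : Measure (PO k))

/-- The regression function `m(a, z; Q) = E_Q[Y(a) | Z = z]`, the mean of the regular conditional
law of `Y(a)` given `Z = z`. -/
noncomputable def condMean (Q : ProbabilityMeasure (PO k)) (a : Bool) (z : Fin k → ℝ) : ℝ :=
  ∫ y, y ∂(condDistrib (outcome a) covariate (Q : Measure (PO k)) z)

/-- The conditional variance `Var_Q[Y(a) | Z = z]`. -/
noncomputable def condVariance (Q : ProbabilityMeasure (PO k)) (a : Bool) (z : Fin k → ℝ) : ℝ :=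
  Var[fun y => y; condDistrib (outcome a) covariate (Q : Measure (PO k)) z]

variable {S : ℕ}

/-- The event `𝕊(Z) = s`. -/
def stratum (strat : (Fin k → ℝ) → Fin S) (s : Fin S) : Set (PO k) :=
  {w | strat (covariate w) = s}

/-- The within-stratum population law `Q(· | 𝕊(Z) = s)`. -/
noncomputable def stratumLaw (Q : ProbabilityMeasure (PO k)) (strat : (Fin k → ℝ) → Fin S)
    (s : Fin S) (hs : (Q : Measure (PO k)) (stratum strat s) ≠ 0) :
    ProbabilityMeasure (PO k) :=
  ⟨(Q : Measure (PO k))[|stratum strat s], cond_isProbabilityMeasure hs⟩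

/-- The bound `𝕍⋆`. -/
noncomputable def efficiencyBound (Q : ProbabilityMeasure (PO k)) (strat : (Fin k → ℝ) → Fin S)
    (π : Fin S → ℝ) : ℝ :=
  ∫ w, (condVariance Q true (covariate w) / π (strat (covariate w))
      + condVariance Q false (covariate w) / (1 - π (strat (covariate w)))
      + (condMean Q true (covariate w) - condMean Q false (covariate w) - ate Q) ^ 2)
    ∂(Q : Measure (PO k))

/-- The efficient influence function `φ₀(y, a, z)`. -/
noncomputable def influence (Q : ProbabilityMeasure (PO k)) (strat : (Fin k → ℝ) → Fin S)
    (π : Fin S → ℝ) (y : ℝ) (a : Bool) (z : Fin k → ℝ) : ℝ :=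
  toReal a / π (strat z) * (y - condMean Q true z)
    - (1 - toReal a) / (1 - π (strat z)) * (y - condMean Q false z)
    + (condMean Q true z - condMean Q false z - ate Q)

end Population

section Sample

variable {Ω : Type*} {k S : ℕ}

/-- The observed outcome `Y_{ni} = Y_i(1) A_{ni} + Y_i(0) (1 - A_{ni})`. Units are indexed from 0,
so that the sample of size `n` consists of the units `i < n`. -/
def obs (W : ℕ → Ω → PO k) (A : ℕ → ℕ → Ω → Bool) (n i : ℕ) (ω : Ω) : ℝ :=
  outcome true (W i ω) * toReal (A n i ω) + outcome false (W i ω) * (1 - toReal (A n i ω))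

/-- The stratum label `S_i = 𝕊(Z_i)`. -/
def label (strat : (Fin k → ℝ) → Fin S) (W : ℕ → Ω → PO k) (i : ℕ) (ω : Ω) : Fin S :=
  strat (covariate (W i ω))

/-- The units of stratum `s` in the sample of size `n`. -/
def stratumUnits (strat : (Fin k → ℝ) → Fin S) (W : ℕ → Ω → PO k) (n : ℕ) (s : Fin S) (ω : Ω) :
    Finset ℕ :=
  {i ∈ Finset.range n | label strat W i ω = s}

/-- The units of stratum `s` with treatment status `a` in the sample of size `n`. -/
def group (strat : (Fin k → ℝ) → Fin S) (W : ℕ → Ω → PO k) (A : ℕ → ℕ → Ω → Bool)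
    (n : ℕ) (a : Bool) (s : Fin S) (ω : Ω) : Finset ℕ :=
  {i ∈ Finset.range n | A n i ω = a ∧ label strat W i ω = s}

/-- The treated proportion `N_n(1, s) / N_n(s)`, with `0 / 0 = 0`. -/
noncomputable def treatedProportion (strat : (Fin k → ℝ) → Fin S) (W : ℕ → Ω → PO k)
    (A : ℕ → ℕ → Ω → Bool) (n : ℕ) (s : Fin S) (ω : Ω) : ℝ :=
  ((group strat W A n true s ω).card : ℝ) / ((stratumUnits strat W n s ω).card : ℝ)

variable [MeasurableSpace Ω]

/-- The `W_i` are i.i.d. with law `Q`. -/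
structure IsIIDSample (P : Measure Ω) (Q : ProbabilityMeasure (PO k)) (W : ℕ → Ω → PO k) :
    Prop where
  measurable : ∀ i, Measurable (W i)
  indep : iIndepFun W P
  law : ∀ i, P.map (W i) = (Q : Measure (PO k))

/-- The covariate adaptive assignment mechanism. Conditioning on the profile of strata, a discrete
random vector, is conditioning on each of its values of positive probability. The requirement on
the treated proportions concerns the strata of positive probability, as `N_n(s) = 0` almost surely
in the other ones. -/
structure IsCARAssignment (P : Measure Ω) (Q : ProbabilityMeasure (PO k)) (W : ℕ → Ω → PO k)
    (strat : (Fin k → ℝ) → Fin S) (π : Fin S → ℝ)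
    (α : (n : ℕ) → (Fin n → Bool) → (Fin n → Fin S) → ℝ) (A : ℕ → ℕ → Ω → Bool) : Prop where
  measurable : ∀ n i, Measurable (A n i)
  exogenous : ∀ (n : ℕ) (s : Fin n → Fin S),
    IndepFun (fun ω (i : Fin n) => W i ω) (fun ω (i : Fin n) => A n i ω)
      (P[|{ω | ∀ i : Fin n, label strat W i ω = s i}])
  mechanism : ∀ (n : ℕ) (a : Fin n → Bool) (s : Fin n → Fin S),
    P {ω | ∀ i : Fin n, label strat W i ω = s i} ≠ 0 →
      (P[|{ω | ∀ i : Fin n, label strat W i ω = s i}]).real {ω | ∀ i : Fin n, A n i ω = a i}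
        = α n a s
  proportion : ∀ s, (Q : Measure (PO k)) (stratum strat s) ≠ 0 →
    TendstoInMeasure P (fun n => treatedProportion strat W A n s) atTop (fun _ => π s)

/-- `X_n = O_p(1)`. -/
def BoundedInProbability (P : Measure Ω) (X : ℕ → Ω → ℝ) : Prop :=
  ∀ ε : ENNReal, 0 < ε → ∃ M : ℝ, ∀ᶠ n in atTop, P {ω | M < |X n ω|} ≤ ε

/-- `√n |N_n(1, s) / N_n(s) - π(s)| = O_p(1)` in every stratum of positive probability. -/
def WeakBalance (P : Measure Ω) (Q : ProbabilityMeasure (PO k)) (W : ℕ → Ω → PO k)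
    (strat : (Fin k → ℝ) → Fin S) (π : Fin S → ℝ) (A : ℕ → ℕ → Ω → Bool) : Prop :=
  ∀ s, (Q : Measure (PO k)) (stratum strat s) ≠ 0 →
    BoundedInProbability P
      (fun n ω => Real.sqrt n * |treatedProportion strat W A n s ω - π s|)

end Sample

section Estimators

variable {Ω : Type*} {k S : ℕ}

/-- The type of estimators of the two regression functions: `mhat n a z d` is the estimate of
`m(a, z)` from the data `d = ((y_1, z_1), …, (y_n, z_n))`. -/
abbrev RegressionEstimator (k : ℕ) : Type :=
  (n : ℕ) → Bool → (Fin k → ℝ) → (Fin n → ℝ × (Fin k → ℝ)) → ℝ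

/-- Joint measurability in the evaluation point and the data. -/
def RegressionEstimator.IsMeasurable (mhat : RegressionEstimator k) : Prop :=
  ∀ n a, Measurable (fun p : (Fin k → ℝ) × (Fin n → ℝ × (Fin k → ℝ)) => mhat n a p.1 p.2)

/-- `L²` consistency under i.i.d. sampling from `Q`: the mean squared error, with an evaluation
point independent of `n` observations, tends to 0. -/
def RegressionEstimator.IsConsistent (mhat : RegressionEstimator k)
    (Q : ProbabilityMeasure (PO k)) : Prop :=
  ∀ a, Tendsto (fun n : ℕ =>
    ∫⁻ p : PO k × (Fin n → PO k),
      ENNReal.ofReal ((mhat n a (covariate p.1) (fun i => (outcome a (p.2 i), covariate (p.2 i)))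
        - condMean Q a (covariate p.1)) ^ 2)
      ∂((Q : Measure (PO k)).prod (Measure.pi fun _ : Fin n => (Q : Measure (PO k)))))
    atTop (𝓝 0)

/-- Cross-fitting folds. `G n a s j` is the `j`-th fold of treatment group `a` in stratum `s`; it is
determined by the randomization device `U n a s` and by the group that is to be split. -/
structure IsSampleSplit [MeasurableSpace Ω] (P : Measure Ω) (W : ℕ → Ω → PO k)
    (strat : (Fin k → ℝ) → Fin S) (A : ℕ → ℕ → Ω → Bool) (U : ℕ → Bool → Fin S → Ω → ℝ)
    (J : ℕ) (G : ℕ → Bool → Fin S → Fin J → Ω → Finset ℕ) : Prop where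
  measurable_device : ∀ n a s, Measurable (U n a s)
  uniform : ∀ n a s, pdf.IsUniform (U n a s) (Set.Icc 0 1) P volume
  indep : ∀ n, iIndepFun (fun (p : Bool × Fin S) => U n p.1 p.2) P
  indep_sample : ∀ n, IndepFun (fun ω (p : Bool × Fin S) => U n p.1 p.2 ω)
    (fun ω => ((fun (i : Fin n) => W i ω), (fun (i : Fin n) => A n i ω))) P
  determined : ∀ n a s j, Measurable[
      MeasurableSpace.comap (U n a s) inferInstance
        ⊔ MeasurableSpace.comap (group strat W A n a s) ⊤, ⊤] (G n a s j)
  disjoint : ∀ n a s ω, Pairwise fun j j' => Disjoint (G n a s j ω) (G n a s j' ω)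
  union : ∀ n a s ω, Finset.univ.biUnion (fun j => G n a s j ω) = group strat W A n a s ω
  card_fold : ∀ n a s ω (j : Fin J), (j : ℕ) + 1 < J →
    (G n a s j ω).card = (group strat W A n a s ω).card / J
  card_last : ∀ n a s ω (j : Fin J), (j : ℕ) + 1 = J →
    (G n a s j ω).card
      = (group strat W A n a s ω).card - (J - 1) * ((group strat W A n a s ω).card / J)

/-- The estimation set `Γ_n(a, i)`: the units with treatment status `a` in the stratum of `i` that
lie in a fold `j` such that `i` is in neither of the two `j`-th folds of its stratum. -/
def estimationSet (W : ℕ → Ω → PO k) (strat : (Fin k → ℝ) → Fin S) {J : ℕ}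
    (G : ℕ → Bool → Fin S → Fin J → Ω → Finset ℕ) (n : ℕ) (a : Bool) (i : ℕ) (ω : Ω) :
    Finset ℕ :=
  (Finset.univ.filter fun j : Fin J =>
      i ∉ G n true (label strat W i ω) j ω ∪ G n false (label strat W i ω) j ω).biUnion
    fun j => G n a (label strat W i ω) j ω

/-- The cross-fitted estimate `m̂_{ni}(a, z)`, whose data are the units of `Γ_n(a, i)` in increasing
order. -/
noncomputable def crossFit (mhat : RegressionEstimator k) (W : ℕ → Ω → PO k)
    (strat : (Fin k → ℝ) → Fin S) {J : ℕ} (G : ℕ → Bool → Fin S → Fin J → Ω → Finset ℕ)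
    (n i : ℕ) (a : Bool) (z : Fin k → ℝ) (ω : Ω) : ℝ :=
  mhat (estimationSet W strat G n a i ω).card a z
    (fun l => (outcome a (W ((estimationSet W strat G n a i ω).orderEmbOfFin rfl l) ω),
      covariate (W ((estimationSet W strat G n a i ω).orderEmbOfFin rfl l) ω)))

/-- The infeasible AIPW estimator, built from the true regression functions and proportions. -/
noncomputable def infeasible (Q : ProbabilityMeasure (PO k)) (W : ℕ → Ω → PO k)
    (strat : (Fin k → ℝ) → Fin S) (π : Fin S → ℝ) (A : ℕ → ℕ → Ω → Bool) (n : ℕ) (ω : Ω) : ℝ :=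
  (1 / (n : ℝ)) * ∑ i ∈ Finset.range n,
    (toReal (A n i ω) * (obs W A n i ω - condMean Q true (covariate (W i ω)))
        / π (label strat W i ω)
      - (1 - toReal (A n i ω)) * (obs W A n i ω - condMean Q false (covariate (W i ω)))
        / (1 - π (label strat W i ω))
      + condMean Q true (covariate (W i ω)) - condMean Q false (covariate (W i ω)))

/-- The feasible cross-fitted AIPW estimator, with estimated proportions `pihat n s`. -/
noncomputable def feasible (mhat : RegressionEstimator k) (W : ℕ → Ω → PO k)
    (strat : (Fin k → ℝ) → Fin S) (A : ℕ → ℕ → Ω → Bool) {J : ℕ}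
    (G : ℕ → Bool → Fin S → Fin J → Ω → Finset ℕ) (pihat : ℕ → Fin S → Ω → ℝ)
    (n : ℕ) (ω : Ω) : ℝ :=
  (1 / (n : ℝ)) * ∑ i ∈ Finset.range n,
      toReal (A n i ω)
        * (obs W A n i ω - crossFit mhat W strat G n i true (covariate (W i ω)) ω)
        / pihat n (label strat W i ω) ω
    - (1 / (n : ℝ)) * ∑ i ∈ Finset.range n,
      (1 - toReal (A n i ω))
        * (obs W A n i ω - crossFit mhat W strat G n i false (covariate (W i ω)) ω)
        / (1 - pihat n (label strat W i ω) ω)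
    + (1 / (n : ℝ)) * ∑ i ∈ Finset.range n,
      (crossFit mhat W strat G n i true (covariate (W i ω)) ω
        - crossFit mhat W strat G n i false (covariate (W i ω)) ω)

end Estimators

end CAR

/-!
Everything rests on one conditional independence fact. Given the strata, the assignments and the
folds of the sample of size `n`, the units are independent draws from the within-stratum laws
(`hasSampleLaw_profile`, `hasSampleLaw_config`): assignments are independent of the units given
the strata, and the folds depend only on the assignments, the strata and an independent device.
All conditioning is on values of discrete variables.

*The infeasible estimator.* The characteristic function of the sum of the influence functions is,
by conditional independence, the expectation of a product over strata of
`ψ₁ ^ N(1, s) * ψ₀ ^ N(0, s)`, powers of the within-stratum characteristic functions of the two arms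
(`integral_exp_sum_armInfluence`). Residuals have mean zero in every stratum, so in each stratum
both arms have the same mean. Therefore the product may be replaced by the power `ψ ^ N(s)` of the
mixture of `ψ₁` and `ψ₀` with the target probabilities as weights, as soon as `N(1, s) / N(s)`
converges to its target, at whatever rate (`tendsto_pow_mul_pow_sub_mixture_pow`,
`tendsto_integral_mixError`). The resulting expectation is an `n`-th power
(`integral_prod_mixCharFun`), whose limit is given by the second-order expansion at the origin;
the coefficient is the variance bound (`efficiencyBound_eq_sum`).

*The feasible estimator.* The difference of the two estimators is a finite signed sum of two kinds
of terms (`IsSampleSplit.sqrt_mul_feasible_sub`). The first kind is a sum of residuals with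
weights that come from the error of the estimated proportion; they are centred given the
configuration, and the squares of the weights add up to `O(1 / n)`. The second kind is a sum over
a fold of the errors of the regression estimator, which was trained on other units of the stratum.
Given the configuration, the units of the fold are independent of the training units, so the
conditional second moment is at most `∑ c² + (∑ c)²` times the mean squared error of the estimator
under the within-stratum law, where `c` are the weights, normalized by `√n`. The sum of the
weights is bounded because the folds of both arms hold the same part of their group up to
rounding, and the treated proportion is within `O(1 / √n)` of its target
(`IsSampleSplit.abs_sum_foldWeight_le`); the mean squared error tends to 0 because the training
samples grow. The bounds hold for all configurations in an event of probability close to 1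
(`exists_measure_compl_balanceEvent_le`), which gives convergence in probability
(`measure_le_of_fibers`).
-/

namespace CAR

/-! ### The population: regression functions, residuals and the variance bound -/

section PopulationMoments

variable {k S : ℕ} {Q : ProbabilityMeasure (PO k)} {a : Bool} {strat : (Fin k → ℝ) → Fin S}
  {π : Fin S → ℝ}

@[fun_prop]
lemma measurable_outcome : Measurable (outcome a : PO k → ℝ) := by
  cases a
  · exact measurable_fst
  · exact measurable_snd.fst

@[fun_prop]
lemma measurable_covariate : Measurable (covariate : PO k → Fin k → ℝ) :=
  measurable_snd.snd

@[fun_prop]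
lemma measurable_condMean : Measurable (condMean Q a) :=
  (stronglyMeasurable_id.integral_kernel).measurable

lemma measurableSet_stratum (hstrat : Measurable strat) (s : Fin S) :
    MeasurableSet (stratum strat s) :=
  hstrat.comp measurable_covariate (measurableSet_singleton s)

lemma condMean_ae_eq_condExp (hY : Integrable (outcome a) (Q : Measure (PO k))) :
    (Q : Measure (PO k))[outcome a | MeasurableSpace.comap covariate inferInstance]
      =ᵐ[(Q : Measure (PO k))] fun w => condMean Q a (covariate w) :=
  condExp_ae_eq_integral_condDistrib' measurable_covariate hY

lemma memLp_condMean (hY : MemLp (outcome a) 2 (Q : Measure (PO k))) :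
    MemLp (fun w => condMean Q a (covariate w)) 2 (Q : Measure (PO k)) :=
  (memLp_congr_ae (condMean_ae_eq_condExp (hY.integrable (by norm_num)))).1
    (hY.condExp (by norm_num))

/-- The residual `Y(a) - m(a, Z)`. -/
noncomputable def residual (Q : ProbabilityMeasure (PO k)) (a : Bool) (w : PO k) : ℝ :=
  outcome a w - condMean Q a (covariate w)

@[fun_prop]
lemma measurable_residual : Measurable (residual Q a) := by
  unfold residual; fun_prop

lemma memLp_residual (hY : MemLp (outcome a) 2 (Q : Measure (PO k))) :
    MemLp (residual Q a) 2 (Q : Measure (PO k)) :=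
  hY.sub (memLp_condMean hY)

lemma comap_covariate_le :
    MeasurableSpace.comap (covariate : PO k → Fin k → ℝ) inferInstance
      ≤ (inferInstance : MeasurableSpace (PO k)) :=
  measurable_covariate.comap_le

/-- Residuals are orthogonal to functions of the covariates. -/
lemma integral_residual_mul (hY : MemLp (outcome a) 2 (Q : Measure (PO k)))
    {g : (Fin k → ℝ) → ℝ} (hg : Measurable g)
    (hg2 : MemLp (fun w : PO k => g (covariate w)) 2 (Q : Measure (PO k))) :
    ∫ w, residual Q a w * g (covariate w) ∂(Q : Measure (PO k)) = 0 := by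
  have hint : Integrable (residual Q a * fun w => g (covariate w)) (Q : Measure (PO k)) :=
    (memLp_residual hY).integrable_mul hg2
  have hY1 : Integrable (outcome a) (Q : Measure (PO k)) := hY.integrable (by norm_num)
  have hm1 : Integrable (fun w => condMean Q a (covariate w)) (Q : Measure (PO k)) :=
    (memLp_condMean hY).integrable (by norm_num)
  have hcov : Measurable[MeasurableSpace.comap (covariate : PO k → _) inferInstance]
      (covariate : PO k → _) := comap_measurable _
  have hres : (Q : Measure (PO k))[residual Q a |
      MeasurableSpace.comap covariate inferInstance] =ᵐ[(Q : Measure (PO k))] 0 := by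
    have h1 := condExp_sub hY1 hm1 (MeasurableSpace.comap (covariate : PO k → _) inferInstance)
    rw [condExp_of_stronglyMeasurable comap_covariate_le
      (f := fun w => condMean Q a (covariate w))
      ((measurable_condMean.comp hcov).stronglyMeasurable) hm1] at h1
    filter_upwards [h1, condMean_ae_eq_condExp hY1] with w h1 h2
    change ((Q : Measure (PO k))[outcome a - fun w => condMean Q a (covariate w) |
      MeasurableSpace.comap covariate inferInstance]) w = 0
    rw [h1, Pi.sub_apply, h2, sub_self]
  have hpull := condExp_mul_of_stronglyMeasurable_right
    (m := MeasurableSpace.comap (covariate : PO k → _) inferInstance)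
    (g := fun w => g (covariate w)) ((hg.comp hcov).stronglyMeasurable) hint
    ((memLp_residual hY).integrable (by norm_num))
  change ∫ w, (residual Q a * fun w => g (covariate w)) w ∂(Q : Measure (PO k)) = 0
  rw [← integral_condExp comap_covariate_le, integral_congr_ae (hpull.trans ?_)]
  · exact integral_zero _ _
  · filter_upwards [hres] with w hw
    simp [hw]

lemma condVariance_eq (z : Fin k → ℝ) :
    condVariance Q a z = ∫ y, (y - condMean Q a z) ^ 2
      ∂(condDistrib (outcome a) covariate (Q : Measure (PO k)) z) := by
  rw [condVariance, variance_eq_integral (by fun_prop)]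
  rfl

lemma condVariance_mul_ae_eq {g : (Fin k → ℝ) → ℝ} (hg : Measurable g)
    (hint : Integrable (fun w => residual Q a w ^ 2 * g (covariate w)) (Q : Measure (PO k))) :
    (Q : Measure (PO k))[fun w => residual Q a w ^ 2 * g (covariate w) |
        MeasurableSpace.comap covariate inferInstance]
      =ᵐ[(Q : Measure (PO k))] fun w => condVariance Q a (covariate w) * g (covariate w) := by
  have h := condExp_prod_ae_eq_integral_condDistrib (μ := (Q : Measure (PO k)))
    (X := covariate) (Y := outcome a)
    (f := fun p : (Fin k → ℝ) × ℝ => (p.2 - condMean Q a p.1) ^ 2 * g p.1)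
    measurable_covariate measurable_outcome.aemeasurable
    (Measurable.stronglyMeasurable (by fun_prop)) hint
  filter_upwards [h] with w hw
  rw [condVariance_eq, ← integral_mul_const]
  exact hw

lemma integrable_condVariance_mul {g : (Fin k → ℝ) → ℝ} (hg : Measurable g)
    (hint : Integrable (fun w => residual Q a w ^ 2 * g (covariate w)) (Q : Measure (PO k))) :
    Integrable (fun w => condVariance Q a (covariate w) * g (covariate w))
      (Q : Measure (PO k)) :=
  integrable_condExp.congr (condVariance_mul_ae_eq hg hint)

lemma integral_condVariance_mul {g : (Fin k → ℝ) → ℝ} (hg : Measurable g)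
    (hint : Integrable (fun w => residual Q a w ^ 2 * g (covariate w)) (Q : Measure (PO k))) :
    ∫ w, condVariance Q a (covariate w) * g (covariate w) ∂(Q : Measure (PO k))
      = ∫ w, residual Q a w ^ 2 * g (covariate w) ∂(Q : Measure (PO k)) := by
  rw [← integral_condExp (f := fun w => residual Q a w ^ 2 * g (covariate w)) comap_covariate_le]
  exact integral_congr_ae (condVariance_mul_ae_eq hg hint).symm

/-- The centred conditional treatment effect `m(1, z) - m(0, z) - β`. -/
noncomputable def effect (Q : ProbabilityMeasure (PO k)) (z : Fin k → ℝ) : ℝ :=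
  condMean Q true z - condMean Q false z - ate Q

@[fun_prop]
lemma measurable_effect : Measurable (effect Q) := by
  unfold effect; fun_prop

lemma memLp_effect (hY : ∀ a, MemLp (outcome a) 2 (Q : Measure (PO k))) :
    MemLp (fun w => effect Q (covariate w)) 2 (Q : Measure (PO k)) :=
  ((memLp_condMean (hY true)).sub (memLp_condMean (hY false))).sub (memLp_const _)

lemma integral_residual (hY : MemLp (outcome a) 2 (Q : Measure (PO k))) :
    ∫ w, residual Q a w ∂(Q : Measure (PO k)) = 0 := by
  simpa using integral_residual_mul hY (g := fun _ => 1) measurable_const (memLp_const 1)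

lemma integral_effect (hY : ∀ a, MemLp (outcome a) 2 (Q : Measure (PO k))) :
    ∫ w, effect Q (covariate w) ∂(Q : Measure (PO k)) = 0 := by
  have hY1 := fun a => (hY a).integrable (q := 2) (by norm_num)
  have hr := fun a => (memLp_residual (hY a)).integrable (q := 2) (by norm_num)
  have h : ∀ w, effect Q (covariate w)
      = (outcome true w - outcome false w - ate Q) - (residual Q true w - residual Q false w) := by
    intro w; simp only [effect, residual]; ring
  simp_rw [h]
  have hd : Integrable (fun w => outcome true w - outcome false w) (Q : Measure (PO k)) :=
    (hY1 true).sub (hY1 false)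
  have hdr : Integrable (fun w => residual Q true w - residual Q false w) (Q : Measure (PO k)) :=
    (hr true).sub (hr false)
  rw [integral_sub (hd.sub' (integrable_const _)) hdr, integral_sub hd (integrable_const _),
    integral_sub (hr true) (hr false), integral_residual (hY true), integral_residual (hY false)]
  simp [ate]

/-- The proportion of treatment status `a` in stratum `s`, where `π s` is the proportion of treated
units; it is used for target, actual and estimated proportions. -/
def share (π : Fin S → ℝ) (a : Bool) (s : Fin S) : ℝ := if a then π s else 1 - π s

/-- The sign with which the residuals of treatment status `a` enter the influence function. -/
def armSign (a : Bool) : ℝ := if a then 1 else -1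

lemma share_pos (hπ : ∀ s, π s ∈ Set.Ioo (0 : ℝ) 1) (a : Bool) (s : Fin S) : 0 < share π a s := by
  cases a
  · simpa [share] using (hπ s).2
  · simpa [share] using (hπ s).1

/-- The influence function of a unit with potential outcomes and covariates `w` that receives
treatment status `a`. -/
noncomputable def armInfluence (Q : ProbabilityMeasure (PO k)) (strat : (Fin k → ℝ) → Fin S)
    (π : Fin S → ℝ) (a : Bool) (w : PO k) : ℝ :=
  armSign a * residual Q a w / share π a (strat (covariate w)) + effect Q (covariate w)

lemma influence_eq_armInfluence (w : PO k) :
    influence Q strat π (outcome a w) a (covariate w) = armInfluence Q strat π a w := by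
  cases a <;> simp [influence, armInfluence, toReal, share, residual, effect, armSign] <;> ring

@[fun_prop]
lemma measurable_armInfluence (hstrat : Measurable strat) :
    Measurable (armInfluence Q strat π a) := by
  have h : Measurable fun w : PO k => share π a (strat (covariate w)) :=
    (measurable_of_finite (share π a)).comp (hstrat.comp measurable_covariate)
  unfold armInfluence
  fun_prop

/-- Multiplying by a function of the stratum preserves integrability properties. -/
lemma memLp_mul_strat (hstrat : Measurable strat) {p : ENNReal} {f : PO k → ℝ}
    (hf : MemLp f p (Q : Measure (PO k))) (c : Fin S → ℝ) :
    MemLp (fun w => f w * c (strat (covariate w))) p (Q : Measure (PO k)) := by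
  have hc : MemLp (fun w : PO k => c (strat (covariate w))) ⊤ (Q : Measure (PO k)) := by
    refine memLp_top_of_bound ((measurable_of_finite c).comp
      (hstrat.comp measurable_covariate)).aestronglyMeasurable (∑ s, ‖c s‖)
      (ae_of_all _ fun w => ?_)
    exact Finset.single_le_sum (f := fun s => ‖c s‖) (fun _ _ => norm_nonneg _)
      (Finset.mem_univ _)
  exact hc.mul hf

lemma memLp_armInfluence (hstrat : Measurable strat)
    (hY : ∀ a, MemLp (outcome a) 2 (Q : Measure (PO k))) :
    MemLp (armInfluence Q strat π a) 2 (Q : Measure (PO k)) := by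
  have h := memLp_mul_strat hstrat ((memLp_residual (hY a)).const_mul (armSign a))
    (fun s => (share π a s)⁻¹)
  exact h.add (memLp_effect hY)

/-- The cross terms of residuals and covariate effects drop out of the second moment of the
influence function. -/
lemma efficiencyBound_eq (hstrat : Measurable strat) (hπ : ∀ s, π s ∈ Set.Ioo (0 : ℝ) 1)
    (hY : ∀ a, MemLp (outcome a) 2 (Q : Measure (PO k))) :
    efficiencyBound Q strat π
      = ∫ w, (share π true (strat (covariate w)) * armInfluence Q strat π true w ^ 2
          + share π false (strat (covariate w)) * armInfluence Q strat π false w ^ 2)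
        ∂(Q : Measure (PO k)) := by
  have hg (a) : Measurable fun z : Fin k → ℝ => (share π a (strat z))⁻¹ :=
    (measurable_of_finite fun s => (share π a s)⁻¹).comp hstrat
  have hr2 (a) : Integrable (fun w => residual Q a w ^ 2 * (share π a (strat (covariate w)))⁻¹)
      (Q : Measure (PO k)) := by
    rw [← memLp_one_iff_integrable]
    exact memLp_mul_strat hstrat (memLp_one_iff_integrable.2 (memLp_residual (hY a)).integrable_sq)
      (fun s => (share π a s)⁻¹)
  have he2 : Integrable (fun w => effect Q (covariate w) ^ 2) (Q : Measure (PO k)) :=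
    (memLp_effect hY).integrable_sq
  have hre (a) : Integrable (fun w => 2 * armSign a * (residual Q a w * effect Q (covariate w)))
      (Q : Measure (PO k)) :=
    ((memLp_residual (hY a)).integrable_mul (memLp_effect hY)).const_mul _
  have h1 : ∀ w, share π true (strat (covariate w)) * armInfluence Q strat π true w ^ 2
        + share π false (strat (covariate w)) * armInfluence Q strat π false w ^ 2
      = residual Q true w ^ 2 * (share π true (strat (covariate w)))⁻¹
        + residual Q false w ^ 2 * (share π false (strat (covariate w)))⁻¹
        + effect Q (covariate w) ^ 2
        + (2 * armSign true * (residual Q true w * effect Q (covariate w))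
          + 2 * armSign false * (residual Q false w * effect Q (covariate w))) := by
    intro w
    have ht := (share_pos hπ true (strat (covariate w))).ne'
    have hf := (share_pos hπ false (strat (covariate w))).ne'
    have hsum : share π false (strat (covariate w)) = 1 - share π true (strat (covariate w)) := by
      simp [share]
    simp only [armInfluence, armSign]
    field_simp
    rw [hsum]
    simp
    ring
  simp_rw [h1]
  have hc (a) := integrable_condVariance_mul (hg a) (hr2 a)
  rw [integral_add ((hr2 true).fun_add (hr2 false) |>.fun_add he2) ((hre true).fun_add (hre false)),
    integral_add (hre true) (hre false), integral_const_mul, integral_const_mul,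
    integral_residual_mul (hY true) measurable_effect (memLp_effect hY),
    integral_residual_mul (hY false) measurable_effect (memLp_effect hY),
    integral_add ((hr2 true).fun_add (hr2 false)) he2, integral_add (hr2 true) (hr2 false),
    ← integral_condVariance_mul (hg true) (hr2 true),
    ← integral_condVariance_mul (hg false) (hr2 false),
    ← integral_add (hc true) (hc false), ← integral_add ((hc true).fun_add (hc false)) he2]
  simp [efficiencyBound, share, effect, div_eq_mul_inv]

/-- The within-stratum law as a measure; it is 0 for strata of probability 0. -/
noncomputable def withinLaw (Q : ProbabilityMeasure (PO k)) (strat : (Fin k → ℝ) → Fin S)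
    (s : Fin S) : Measure (PO k) :=
  (Q : Measure (PO k))[|stratum strat s]

instance (s : Fin S) : IsFiniteMeasure (withinLaw Q strat s) := by
  unfold withinLaw; infer_instance

lemma isProbabilityMeasure_withinLaw {s : Fin S}
    (hs : (Q : Measure (PO k)) (stratum strat s) ≠ 0) :
    IsProbabilityMeasure (withinLaw Q strat s) :=
  cond_isProbabilityMeasure hs

lemma memLp_withinLaw {s : Fin S} {p : ENNReal} {f : PO k → ℝ}
    (hf : MemLp f p (Q : Measure (PO k))) :
    MemLp f p (withinLaw Q strat s) := by
  by_cases hs : (Q : Measure (PO k)) (stratum strat s) = 0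
  · rw [withinLaw, cond_eq_zero_of_meas_eq_zero hs]; simp [MemLp]
  · exact (hf.restrict _).smul_measure (ENNReal.inv_ne_top.2 hs)

lemma measureReal_mul_integral_withinLaw {E : Type*} [NormedAddCommGroup E] [NormedSpace ℝ E]
    (s : Fin S) (f : PO k → E) :
    (Q : Measure (PO k)).real (stratum strat s) • ∫ w, f w ∂(withinLaw Q strat s)
      = ∫ w in stratum strat s, f w ∂(Q : Measure (PO k)) := by
  by_cases hs : (Q : Measure (PO k)) (stratum strat s) = 0
  · rw [setIntegral_measure_zero _ hs, Measure.real, hs]; simp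
  · rw [withinLaw, ProbabilityTheory.cond, integral_smul_measure, smul_smul,
      ENNReal.toReal_inv, Measure.real, mul_inv_cancel₀, one_smul]
    exact ENNReal.toReal_ne_zero.2 ⟨hs, measure_ne_top _ _⟩

/-- The law of total expectation over the strata. -/
lemma sum_measureReal_mul_integral_withinLaw {E : Type*} [NormedAddCommGroup E] [NormedSpace ℝ E]
    (hstrat : Measurable strat) {f : PO k → E} (hf : Integrable f (Q : Measure (PO k))) :
    ∑ s, (Q : Measure (PO k)).real (stratum strat s) • ∫ w, f w ∂(withinLaw Q strat s)
      = ∫ w, f w ∂(Q : Measure (PO k)) := by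
  simp_rw [measureReal_mul_integral_withinLaw]
  rw [← integral_iUnion_fintype (measurableSet_stratum hstrat) ?_ fun _ => hf.integrableOn]
  · have : ⋃ s, stratum strat s = (Set.univ : Set (PO k)) := by
      ext w; simp [stratum]
    rw [this, setIntegral_univ]
  · intro s t hst
    rw [Function.onFun, Set.disjoint_left]
    intro w hw hw'
    exact hst (hw.symm.trans hw')

lemma ae_withinLaw_strat (hstrat : Measurable strat) (s : Fin S) :
    ∀ᵐ w ∂(withinLaw Q strat s), strat (covariate w) = s :=
  ae_cond_mem (measurableSet_stratum hstrat s)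

/-- Residuals have mean zero within every stratum. -/
lemma integral_residual_withinLaw (hstrat : Measurable strat)
    (hY : MemLp (outcome a) 2 (Q : Measure (PO k))) (s : Fin S) :
    ∫ w, residual Q a w ∂(withinLaw Q strat s) = 0 := by
  by_cases hs : (Q : Measure (PO k)) (stratum strat s) = 0
  · rw [withinLaw, cond_eq_zero_of_meas_eq_zero hs, integral_zero_measure]
  have h := measureReal_mul_integral_withinLaw (Q := Q) (strat := strat) s (residual Q a)
  have h0 : ∫ w in stratum strat s, residual Q a w ∂(Q : Measure (PO k)) = 0 := by
    rw [← integral_indicator (measurableSet_stratum hstrat s),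
      ← integral_residual_mul hY (g := fun z => if strat z = s then 1 else 0)
        (Measurable.ite (hstrat (measurableSet_singleton s)) measurable_const measurable_const)]
    · congr with w
      by_cases hw : strat (covariate w) = s
      · rw [Set.indicator_of_mem (show w ∈ stratum strat s from hw)]; simp [hw]
      · rw [Set.indicator_of_notMem (show w ∉ stratum strat s from hw)]; simp [hw]
    · simpa using memLp_mul_strat hstrat (memLp_const (1 : ℝ)) fun t => if t = s then (1 : ℝ) else 0
  rw [h0, smul_eq_mul, mul_eq_zero] at h
  exact h.resolve_left (ENNReal.toReal_ne_zero.2 ⟨hs, measure_ne_top _ _⟩)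

/-- Within a stratum the influence function has the same mean for both treatment statuses. -/
lemma integral_armInfluence_withinLaw (hstrat : Measurable strat)
    (hY : ∀ a, MemLp (outcome a) 2 (Q : Measure (PO k))) (s : Fin S) :
    ∫ w, armInfluence Q strat π a w ∂(withinLaw Q strat s)
      = ∫ w, effect Q (covariate w) ∂(withinLaw Q strat s) := by
  have h : armInfluence Q strat π a =ᵐ[withinLaw Q strat s]
      fun w => armSign a / share π a s * residual Q a w + effect Q (covariate w) := by
    filter_upwards [ae_withinLaw_strat hstrat s] with w hw
    rw [armInfluence, hw]; ring
  rw [integral_congr_ae h, integral_add, integral_const_mul,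
    integral_residual_withinLaw hstrat (hY a), mul_zero, zero_add]
  · exact ((memLp_withinLaw (memLp_residual (hY a))).integrable (by norm_num)).const_mul _
  · exact (memLp_withinLaw (memLp_effect hY)).integrable (by norm_num)

lemma sum_measureReal_mul_integral_effect (hstrat : Measurable strat)
    (hY : ∀ a, MemLp (outcome a) 2 (Q : Measure (PO k))) :
    ∑ s, (Q : Measure (PO k)).real (stratum strat s)
      * ∫ w, effect Q (covariate w) ∂(withinLaw Q strat s) = 0 := by
  rw [← integral_effect hY]
  exact sum_measureReal_mul_integral_withinLaw hstrat ((memLp_effect hY).integrable (by norm_num))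

/-- The variance bound is the average over the strata of the second moment of the influence
function when treatment is assigned at random with the target probabilities. -/
lemma efficiencyBound_eq_sum (hstrat : Measurable strat) (hπ : ∀ s, π s ∈ Set.Ioo (0 : ℝ) 1)
    (hY : ∀ a, MemLp (outcome a) 2 (Q : Measure (PO k))) :
    efficiencyBound Q strat π = ∑ s, (Q : Measure (PO k)).real (stratum strat s)
      * (π s * ∫ w, armInfluence Q strat π true w ^ 2 ∂(withinLaw Q strat s)
        + (1 - π s) * ∫ w, armInfluence Q strat π false w ^ 2 ∂(withinLaw Q strat s)) := by
  have h2 (a) := (memLp_armInfluence (a := a) (π := π) hstrat hY).integrable_sq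
  have h3 (a) : Integrable (fun w => share π a (strat (covariate w))
      * armInfluence Q strat π a w ^ 2) (Q : Measure (PO k)) := by
    rw [← memLp_one_iff_integrable]
    simpa only [mul_comm] using
      memLp_mul_strat hstrat (memLp_one_iff_integrable.2 (h2 a)) (share π a)
  rw [efficiencyBound_eq hstrat hπ hY,
    ← sum_measureReal_mul_integral_withinLaw hstrat ((h3 true).fun_add (h3 false))]
  refine Finset.sum_congr rfl fun s _ => ?_
  have h : (fun w => share π true (strat (covariate w)) * armInfluence Q strat π true w ^ 2
        + share π false (strat (covariate w)) * armInfluence Q strat π false w ^ 2)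
      =ᵐ[withinLaw Q strat s] fun w => π s * armInfluence Q strat π true w ^ 2
        + (1 - π s) * armInfluence Q strat π false w ^ 2 := by
    filter_upwards [ae_withinLaw_strat hstrat s] with w hw
    simp [hw, share]
  have h4 (a) := (memLp_withinLaw (strat := strat) (s := s)
    (memLp_armInfluence (a := a) (π := π) hstrat hY)).integrable_sq
  rw [smul_eq_mul]
  congr 1
  exact (integral_congr_ae h).trans (by
    rw [integral_add ((h4 true).const_mul _) ((h4 false).const_mul _), integral_const_mul,
      integral_const_mul])

/-- Conditioning on a stratum, an event determined by the covariates, does not change the regression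
functions on it. -/
lemma condMean_stratumLaw_ae_eq (hstrat : Measurable strat)
    (hY : MemLp (outcome a) 2 (Q : Measure (PO k))) {s : Fin S}
    (hs : (Q : Measure (PO k)) (stratum strat s) ≠ 0) :
    (fun w => condMean (stratumLaw Q strat s hs) a (covariate w))
      =ᵐ[withinLaw Q strat s] fun w => condMean Q a (covariate w) := by
  have hY1 := hY.integrable (q := 2) (by norm_num)
  have hYs : Integrable (outcome a) (withinLaw Q strat s) :=
    (memLp_withinLaw hY).integrable (by norm_num)
  have hms : Integrable (fun w => condMean Q a (covariate w)) (withinLaw Q strat s) :=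
    (memLp_withinLaw (memLp_condMean hY)).integrable (by norm_num)
  have hcov : Measurable[MeasurableSpace.comap (covariate : PO k → _) inferInstance]
      (covariate : PO k → _) := comap_measurable _
  have hS : MeasurableSet[MeasurableSpace.comap (covariate : PO k → _) inferInstance]
      (stratum strat s) := hstrat.comp hcov (measurableSet_singleton s)
  refine (condMean_ae_eq_condExp (Q := stratumLaw Q strat s hs) hYs).symm.trans ?_
  change (withinLaw Q strat s)[outcome a | _] =ᵐ[withinLaw Q strat s] _
  refine (ae_eq_condExp_of_forall_setIntegral_eq comap_covariate_le hYs
    (fun _ _ _ => hms.integrableOn) (fun B hB _ => ?_)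
    (measurable_condMean.comp hcov).aestronglyMeasurable).symm
  rw [withinLaw, ProbabilityTheory.cond, Measure.restrict_smul, integral_smul_measure,
    integral_smul_measure,
    Measure.restrict_restrict (comap_covariate_le _ hB)]
  congr 1
  rw [← setIntegral_condExp comap_covariate_le hY1 (hB.inter hS)]
  exact setIntegral_congr_ae (comap_covariate_le _ (hB.inter hS))
    ((condMean_ae_eq_condExp hY1).mono fun w hw _ => hw.symm)

end PopulationMoments

/-! ### Powers of characteristic functions along a sequence of sample sizes -/

section CharFun

/-- The second order expansion at the origin of a characteristic function with mean parameter `m`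
and second moment parameter `v`. -/
def HasExpansion (ψ : ℝ → ℂ) (m v : ℝ) : Prop :=
  (fun u : ℝ => ψ u - (1 + m * u * Complex.I - v * u ^ 2 / 2)) =o[𝓝 0] fun u => u ^ 2

lemma hasExpansion_charFun {Ω : Type*} {mΩ : MeasurableSpace Ω} {P : Measure Ω}
    [IsProbabilityMeasure P] {X : Ω → ℝ} (hX : MemLp X 2 P) :
    HasExpansion (charFun (P.map X)) (∫ ω, X ω ∂P) (∫ ω, X ω ^ 2 ∂P) := by
  have hXm : AEMeasurable X P := hX.aestronglyMeasurable.aemeasurable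
  have : IsProbabilityMeasure (P.map X) := Measure.isProbabilityMeasure_map hXm
  have hid : MemLp id 2 (P.map X) :=
    (memLp_map_measure_iff aestronglyMeasurable_id hXm).2 hX
  have h := taylor_isLittleO_univ (n := 2) (x₀ := (0 : ℝ)) (f := charFun (P.map X))
    (contDiff_charFun (by exact_mod_cast hid))
  simp_rw [taylorWithinEval_charFun_two_zero hXm hid, sub_zero] at h
  exact h

/-- Mixtures of functions with second order expansions. -/
lemma HasExpansion.sum {ι : Type*} (s : Finset ι) {ψ : ι → ℝ → ℂ} {m v p : ι → ℝ}
    (hp : ∑ i ∈ s, p i = 1) (h : ∀ i ∈ s, p i ≠ 0 → HasExpansion (ψ i) (m i) (v i)) :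
    HasExpansion (fun u => ∑ i ∈ s, (p i : ℂ) * ψ i u) (∑ i ∈ s, p i * m i)
      (∑ i ∈ s, p i * v i) := by
  have h1 : (fun u : ℝ => ∑ i ∈ s, (p i : ℂ) *
      (ψ i u - (1 + m i * u * Complex.I - v i * u ^ 2 / 2))) =o[𝓝 0] fun u => u ^ 2 := by
    refine Asymptotics.IsLittleO.fun_sum fun i hi => ?_
    by_cases hpi : p i = 0
    · simp [hpi]
    · exact (h i hi hpi).const_mul_left _
  refine h1.congr_left fun u => ?_
  have hp' : ∑ i ∈ s, (p i : ℂ) = 1 := by exact_mod_cast hp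
  have h2 : ∀ i ∈ s, (p i : ℂ) * (ψ i u - (1 + m i * u * Complex.I - v i * u ^ 2 / 2))
      = (p i : ℂ) * ψ i u - (p i + (p i * m i) * (u * Complex.I) - (p i * v i) * (u ^ 2 / 2)) :=
    fun i _ => by ring
  rw [Finset.sum_congr rfl h2, Finset.sum_sub_distrib, Finset.sum_sub_distrib,
    Finset.sum_add_distrib, hp', ← Finset.sum_mul, ← Finset.sum_mul]
  push_cast
  ring

/-- An expansion with mean 0 and second moment `v` at the scale of the central limit theorem. -/
lemma HasExpansion.tendsto_mul_sub_one {ψ : ℝ → ℂ} {v : ℝ} (h : HasExpansion ψ 0 v) (t : ℝ) :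
    Tendsto (fun n : ℕ => (n : ℂ) * (ψ ((Real.sqrt n)⁻¹ * t) - 1)) atTop
      (𝓝 (-(v * t ^ 2 / 2 : ℝ) : ℂ)) := by
  have hu : Tendsto (fun n : ℕ => (Real.sqrt n)⁻¹ * t) atTop (𝓝 0) := by
    rw [← zero_mul t]
    exact .mul_const t (tendsto_inv_atTop_zero.comp
      (Real.tendsto_sqrt_atTop.comp tendsto_natCast_atTop_atTop))
  have h2 : (fun n : ℕ => ψ ((Real.sqrt n)⁻¹ * t) - (1 - v * ((Real.sqrt n)⁻¹ * t : ℝ) ^ 2 / 2))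
      =o[atTop] fun n : ℕ => ((n : ℝ)⁻¹) := by
    have h3 : (fun n : ℕ => ((Real.sqrt n)⁻¹ * t) ^ 2) =O[atTop] fun n : ℕ => ((n : ℝ)⁻¹) := by
      refine Asymptotics.IsBigO.of_bound (t ^ 2) (Eventually.of_forall fun n => ?_)
      rw [mul_pow, inv_pow, Real.sq_sqrt (Nat.cast_nonneg n), norm_mul, Real.norm_eq_abs (t ^ 2),
        abs_of_nonneg (sq_nonneg t), mul_comm]
    refine (h.comp_tendsto hu |>.trans_isBigO h3).congr_left fun n => ?_
    simp
  have h4 : Tendsto (fun n : ℕ => (n : ℂ) *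
      (ψ ((Real.sqrt n)⁻¹ * t) - (1 - v * ((Real.sqrt n)⁻¹ * t : ℝ) ^ 2 / 2))) atTop (𝓝 0) := by
    rw [tendsto_zero_iff_norm_tendsto_zero]
    have h5 := h2.norm_norm.tendsto_div_nhds_zero
    refine h5.congr fun n => ?_
    rw [norm_mul, norm_inv, div_inv_eq_mul, mul_comm]
    simp
  have h6 : Tendsto (fun n : ℕ => (n : ℂ) *
      (ψ ((Real.sqrt n)⁻¹ * t) - (1 - v * ((Real.sqrt n)⁻¹ * t : ℝ) ^ 2 / 2))
      + (-(v * t ^ 2 / 2 : ℝ) : ℂ)) atTop (𝓝 (-(v * t ^ 2 / 2 : ℝ) : ℂ)) := by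
    have h := h4.add_const (-(v * t ^ 2 / 2 : ℝ) : ℂ)
    rwa [zero_add] at h
  refine h6.congr' ?_
  filter_upwards [eventually_gt_atTop 0] with n hn
  have hn' : (n : ℂ) ≠ 0 := by exact_mod_cast hn.ne'
  have hs : (((Real.sqrt n)⁻¹ * t : ℝ) : ℂ) ^ 2 = (t : ℂ) ^ 2 / n := by
    rw [← Complex.ofReal_pow, mul_pow, inv_pow, Real.sq_sqrt (Nat.cast_nonneg n)]
    push_cast
    field_simp
  rw [hs]
  push_cast
  field_simp
  ring

/-- If `n (x - 1) → z` and `k / n → c` then `x ^ k → exp (c z)`. -/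
lemma tendsto_pow_of_tendsto_mul_sub_one {ι : Type*} {l : Filter ι} {x : ι → ℂ} {n k : ι → ℕ}
    {z : ℂ} {c : ℝ} (hn : Tendsto n l atTop)
    (hx : Tendsto (fun i => (n i : ℂ) * (x i - 1)) l (𝓝 z))
    (hk : Tendsto (fun i => (k i : ℝ) / n i) l (𝓝 c)) :
    Tendsto (fun i => x i ^ k i) l (𝓝 (Complex.exp (c * z))) := by
  have hn0 : ∀ᶠ i in l, (n i : ℂ) ≠ 0 := by
    filter_upwards [hn.eventually_gt_atTop 0] with i hi
    exact_mod_cast hi.ne'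
  have hninv : Tendsto (fun i => ((n i : ℂ))⁻¹) l (𝓝 0) :=
    (tendsto_inv_atTop_nhds_zero_nat (𝕜 := ℂ)).comp hn
  have hx0 : Tendsto (fun i => x i - 1) l (𝓝 0) := by
    have h := hninv.mul hx
    rw [zero_mul] at h
    refine h.congr' ?_
    filter_upwards [hn0] with i hi
    field_simp
  have hx1 : Tendsto x l (𝓝 1) := by simpa using hx0.add_const 1
  -- the logarithm has derivative 1 at 1, so `n log x` has the same limit as `n (x - 1)`
  have hlog : Tendsto (fun i => (n i : ℂ) * Complex.log (x i)) l (𝓝 z) := by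
    have hd : HasDerivAt Complex.log 1 1 := by
      simpa using Complex.hasDerivAt_log Complex.one_mem_slitPlane
    have ho := (hasDerivAt_iff_isLittleO.1 hd).comp_tendsto hx1
    have hO : (fun i => x i - 1) =O[l] fun i => ((n i : ℂ))⁻¹ := by
      have h := (hx.isBigO_one ℂ).mul (Asymptotics.isBigO_refl (fun i => ((n i : ℂ))⁻¹) l)
      refine (h.congr' ?_ ?_)
      · filter_upwards [hn0] with i hi
        field_simp
      · simp only [one_mul]; rfl
    have h := (ho.trans_isBigO hO).tendsto_div_nhds_zero
    have h' := h.add hx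
    rw [zero_add] at h'
    refine h'.congr fun i => ?_
    simp
    ring
  have hexp : Tendsto
      (fun i => Complex.exp (((k i : ℝ) / n i : ℝ) * ((n i : ℂ) * Complex.log (x i)))) l
      (𝓝 (Complex.exp (c * z))) :=
    (Complex.continuous_exp.tendsto _).comp
      (((Complex.continuous_ofReal.tendsto c).comp hk).mul hlog)
  refine hexp.congr' ?_
  have hxne : ∀ᶠ i in l, x i ≠ 0 := hx1.eventually_ne one_ne_zero
  filter_upwards [hxne, hn0] with i hi hni
  rw [← Complex.exp_log hi, ← Complex.exp_nat_mul, Complex.exp_log hi]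
  congr 1
  push_cast
  field_simp

/-- If two characteristic functions have the same mean parameter `m`, then in a sample in which the
shares of their factors converge to `p c` and `(1 - p) c`, the product can be replaced by a power of
their mixture with weights `p` and `1 - p`. -/
lemma tendsto_pow_mul_pow_sub_mixture_pow {ι : Type*} {l : Filter ι} {ψ₁ ψ₀ : ℝ → ℂ}
    {m v₁ v₀ p c t : ℝ} {n k₁ k₀ : ι → ℕ} (hn : Tendsto n l atTop)
    (h₁ : HasExpansion (fun u => Complex.exp (-(u * m : ℝ) * Complex.I) * ψ₁ u) 0 v₁)
    (h₀ : HasExpansion (fun u => Complex.exp (-(u * m : ℝ) * Complex.I) * ψ₀ u) 0 v₀)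
    (hk₁ : Tendsto (fun i => (k₁ i : ℝ) / n i) l (𝓝 (p * c)))
    (hk₀ : Tendsto (fun i => (k₀ i : ℝ) / n i) l (𝓝 ((1 - p) * c))) :
    Tendsto (fun i => ‖ψ₁ ((Real.sqrt (n i))⁻¹ * t) ^ k₁ i * ψ₀ ((Real.sqrt (n i))⁻¹ * t) ^ k₀ i
      - ((p : ℂ) * ψ₁ ((Real.sqrt (n i))⁻¹ * t) + (1 - p) * ψ₀ ((Real.sqrt (n i))⁻¹ * t))
        ^ (k₁ i + k₀ i)‖) l (𝓝 0) := by
  set e : ℝ → ℂ := fun u => Complex.exp (-(u * m : ℝ) * Complex.I) with he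
  have hmix : HasExpansion (fun u => e u * (p * ψ₁ u + (1 - p) * ψ₀ u)) 0
      (p * v₁ + (1 - p) * v₀) := by
    have h := HasExpansion.sum (Finset.univ : Finset Bool)
      (ψ := fun b => if b then (fun u => e u * ψ₁ u) else (fun u => e u * ψ₀ u))
      (m := fun _ => 0) (v := fun b => if b then v₁ else v₀) (p := fun b => if b then p else 1 - p)
      (by simp) (by rintro (_ | _) _ _; exacts [h₀, h₁])
    simp only [Fintype.sum_bool, mul_zero, add_zero, if_true, Bool.false_eq_true, if_false] at h
    refine h.congr_left fun u => ?_
    push_cast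
    ring
  have hk : Tendsto (fun i => ((k₁ i + k₀ i : ℕ) : ℝ) / n i) l (𝓝 c) := by
    have h := hk₁.add hk₀
    have hc : p * c + (1 - p) * c = c := by ring
    rw [hc] at h
    refine h.congr fun i => ?_
    push_cast
    ring
  have l₁ := tendsto_pow_of_tendsto_mul_sub_one hn ((h₁.tendsto_mul_sub_one t).comp hn) hk₁
  have l₀ := tendsto_pow_of_tendsto_mul_sub_one hn ((h₀.tendsto_mul_sub_one t).comp hn) hk₀
  have lm := tendsto_pow_of_tendsto_mul_sub_one hn ((hmix.tendsto_mul_sub_one t).comp hn) hk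
  have hlim := ((l₁.mul l₀).sub lm).norm
  have hz : Complex.exp ((p * c : ℝ) * (-(v₁ * t ^ 2 / 2 : ℝ) : ℂ))
      * Complex.exp (((1 - p) * c : ℝ) * (-(v₀ * t ^ 2 / 2 : ℝ) : ℂ))
      - Complex.exp (c * (-((p * v₁ + (1 - p) * v₀) * t ^ 2 / 2 : ℝ) : ℂ)) = 0 := by
    rw [← Complex.exp_add, sub_eq_zero]
    congr 1
    push_cast
    ring
  rw [hz, norm_zero] at hlim
  refine hlim.congr fun i => ?_
  have hnorm : ‖e ((Real.sqrt (n i))⁻¹ * t)‖ = 1 := by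
    rw [he]
    simp only
    rw [← Complex.ofReal_neg, Complex.norm_exp_ofReal_mul_I]
  change ‖(e _ * ψ₁ _) ^ k₁ i * (e _ * ψ₀ _) ^ k₀ i - (e _ * _) ^ (k₁ i + k₀ i)‖ = _
  rw [mul_pow, mul_pow, mul_pow, mul_mul_mul_comm, ← pow_add, ← mul_sub, norm_mul, norm_pow, hnorm,
    one_pow, one_mul]

/-- For factors in the unit disc, a difference of products is at most the sum of the differences of
the factors. -/
lemma norm_prod_sub_prod_le_sum {ι : Type*} (s : Finset ι) {x y : ι → ℂ} (hx : ∀ i ∈ s, ‖x i‖ ≤ 1)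
    (hy : ∀ i ∈ s, ‖y i‖ ≤ 1) :
    ‖∏ i ∈ s, x i - ∏ i ∈ s, y i‖ ≤ ∑ i ∈ s, ‖x i - y i‖ := by
  classical
  induction s using Finset.induction_on with
  | empty => simp
  | insert i s his ih =>
    rw [Finset.prod_insert his, Finset.prod_insert his, Finset.sum_insert his]
    have ih' := ih (fun j hj => hx j (Finset.mem_insert_of_mem hj))
      (fun j hj => hy j (Finset.mem_insert_of_mem hj))
    have hprod : ‖∏ j ∈ s, x j‖ ≤ 1 := by
      rw [norm_prod]
      exact Finset.prod_le_one (fun _ _ => norm_nonneg _)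
        fun j hj => hx j (Finset.mem_insert_of_mem hj)
    have hyi := hy i (Finset.mem_insert_self i s)
    calc ‖x i * ∏ j ∈ s, x j - y i * ∏ j ∈ s, y j‖
        = ‖(x i - y i) * ∏ j ∈ s, x j + y i * (∏ j ∈ s, x j - ∏ j ∈ s, y j)‖ := by ring_nf
      _ ≤ ‖x i - y i‖ * ‖∏ j ∈ s, x j‖ + ‖y i‖ * ‖∏ j ∈ s, x j - ∏ j ∈ s, y j‖ := by
          rw [← norm_mul, ← norm_mul]; exact norm_add_le _ _
      _ ≤ ‖x i - y i‖ * 1 + 1 * ∑ j ∈ s, ‖x j - y j‖ := by gcongr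
      _ = _ := by ring

end CharFun

/-! ### Second moments of weighted sums, and conditioning on a discrete variable -/

section WeightedSums

variable {E : Type*} [MeasurableSpace E] {ι : Type*} [Fintype ι]

lemma integral_sum_mul_sq_pi (ρ : Measure E) [IsProbabilityMeasure ρ] {g : E → ℝ}
    (hg2 : MemLp g 2 ρ) (c : ι → ℝ) :
    ∫ x, (∑ i, c i * g (x i)) ^ 2 ∂(Measure.pi fun _ : ι => ρ)
      = (∑ i, c i ^ 2) * Var[g; ρ] + ((∑ i, c i) * ∫ x, g x ∂ρ) ^ 2 := by
  have hmem (i : ι) : MemLp (fun x : ι → E => c i * g (x i)) 2 (Measure.pi fun _ : ι => ρ) :=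
    (hg2.comp_measurePreserving (measurePreserving_eval (fun _ : ι => ρ) i)).const_mul (c i)
  have hsum : MemLp (∑ i, fun x : ι → E => c i * g (x i)) 2 (Measure.pi fun _ : ι => ρ) :=
    memLp_finsetSum' _ fun i _ => hmem i
  have hvar : Var[∑ i, fun x : ι → E => c i * g (x i); Measure.pi fun _ : ι => ρ]
      = ∑ i, c i ^ 2 * Var[g; ρ] := by
    rw [variance_sum_pi (X := fun i x => c i * g x) fun i => hg2.const_mul (c i)]
    simp_rw [variance_const_mul]
  have hmean : ∫ x, (∑ i, fun x : ι → E => c i * g (x i)) x ∂(Measure.pi fun _ : ι => ρ)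
      = (∑ i, c i) * ∫ x, g x ∂ρ := by
    simp only [Finset.sum_apply]
    rw [integral_finsetSum _ fun i _ => (hmem i).integrable (by norm_num), Finset.sum_mul]
    refine Finset.sum_congr rfl fun i _ => ?_
    rw [integral_const_mul]
    congr 1
    exact integral_comp_eval (μ := fun _ : ι => ρ) (i := i) (f := g) hg2.aestronglyMeasurable
  have h := variance_eq_sub hsum
  have h2 : ∫ x, (∑ i, c i * g (x i)) ^ 2 ∂(Measure.pi fun _ : ι => ρ)
      = ∫ x, ((∑ i, fun x : ι → E => c i * g (x i)) ^ 2) x ∂(Measure.pi fun _ : ι => ρ) := by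
    simp [Finset.sum_apply]
  rw [hmean, hvar, ← Finset.sum_mul] at h
  rw [h2, h]
  ring

lemma integral_sum_mul_sq_pi_le (ρ : Measure E) [IsProbabilityMeasure ρ] {g : E → ℝ}
    (hg2 : MemLp g 2 ρ) (c : ι → ℝ) :
    ∫ x, (∑ i, c i * g (x i)) ^ 2 ∂(Measure.pi fun _ : ι => ρ)
      ≤ (∑ i, c i ^ 2 + (∑ i, c i) ^ 2) * ∫ x, g x ^ 2 ∂ρ := by
  have hg := variance_eq_sub hg2
  have hg0 := variance_nonneg g ρ
  have h3 : ∫ x, (g ^ 2) x ∂ρ = ∫ x, g x ^ 2 ∂ρ := rfl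
  rw [h3] at hg
  rw [integral_sum_mul_sq_pi ρ hg2, add_mul, mul_pow]
  have hc : 0 ≤ ∑ i, c i ^ 2 := Finset.sum_nonneg fun _ _ => sq_nonneg _
  gcongr
  · linarith [sq_nonneg (∫ x, g x ∂ρ)]
  · linarith

/-- The second moment of a weighted sum of centred i.i.d. variables involves only the sum of the
squared weights. -/
lemma lintegral_sum_mul_sq_pi_le_of_integral_eq_zero (ρ : Measure E) [IsProbabilityMeasure ρ]
    {g : E → ℝ} (hg2 : MemLp g 2 ρ) (hg0 : ∫ x, g x ∂ρ = 0) (c : ι → ℝ) :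
    ∫⁻ x, ENNReal.ofReal ((∑ i, c i * g (x i)) ^ 2) ∂(Measure.pi fun _ : ι => ρ)
      ≤ ENNReal.ofReal (∑ i, c i ^ 2) * ∫⁻ x, ENNReal.ofReal (g x ^ 2) ∂ρ := by
  have hmem (i : ι) : MemLp (fun x : ι → E => c i * g (x i)) 2 (Measure.pi fun _ : ι => ρ) :=
    (hg2.comp_measurePreserving (measurePreserving_eval (fun _ : ι => ρ) i)).const_mul (c i)
  have hsum : MemLp (fun x : ι → E => ∑ i, c i * g (x i)) 2 (Measure.pi fun _ : ι => ρ) :=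
    memLp_finsetSum _ fun i _ => hmem i
  rw [← ofReal_integral_eq_lintegral_ofReal hsum.integrable_sq (ae_of_all _ fun _ => sq_nonneg _),
    ← ofReal_integral_eq_lintegral_ofReal hg2.integrable_sq (ae_of_all _ fun _ => sq_nonneg _),
    ← ENNReal.ofReal_mul (Finset.sum_nonneg fun _ _ => sq_nonneg _), integral_sum_mul_sq_pi ρ hg2,
    variance_of_integral_eq_zero hg2.aestronglyMeasurable.aemeasurable hg0, hg0]
  simp

/-- For i.i.d. variables that need not be centred the sum of the weights enters as well. No
integrability is needed: if the right-hand side is finite, `g` is square integrable, unless all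
weights vanish. -/
lemma lintegral_sum_mul_sq_pi_le (ρ : Measure E) [IsProbabilityMeasure ρ] {g : E → ℝ}
    (hg : Measurable g) (c : ι → ℝ) :
    ∫⁻ x, ENNReal.ofReal ((∑ i, c i * g (x i)) ^ 2) ∂(Measure.pi fun _ : ι => ρ)
      ≤ ENNReal.ofReal (∑ i, c i ^ 2 + (∑ i, c i) ^ 2) * ∫⁻ x, ENNReal.ofReal (g x ^ 2) ∂ρ := by
  have hc : 0 ≤ ∑ i, c i ^ 2 := Finset.sum_nonneg fun _ _ => sq_nonneg _
  by_cases hfin : ∫⁻ x, ENNReal.ofReal (g x ^ 2) ∂ρ = ⊤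
  · by_cases hc0 : ∀ i, c i = 0
    · simp [hc0]
    · have hpos : 0 < ∑ i, c i ^ 2 + (∑ i, c i) ^ 2 := by
        push Not at hc0
        obtain ⟨i, hi⟩ := hc0
        have : 0 < ∑ i, c i ^ 2 := Finset.sum_pos' (fun _ _ => sq_nonneg _)
          ⟨i, Finset.mem_univ i, by positivity⟩
        positivity
      rw [hfin, ENNReal.mul_top (by simpa using hpos)]
      exact le_top
  · have hg2 : MemLp g 2 ρ := by
      rw [memLp_two_iff_integrable_sq hg.aestronglyMeasurable]
      exact (lintegral_ofReal_ne_top_iff_integrable (hg.pow_const 2).aestronglyMeasurable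
        (ae_of_all _ fun _ => sq_nonneg _)).1 hfin
    have hmem (i : ι) : MemLp (fun x : ι → E => c i * g (x i)) 2 (Measure.pi fun _ : ι => ρ) :=
      (hg2.comp_measurePreserving (measurePreserving_eval (fun _ : ι => ρ) i)).const_mul (c i)
    have hsum : MemLp (fun x : ι → E => ∑ i, c i * g (x i)) 2 (Measure.pi fun _ : ι => ρ) :=
      memLp_finsetSum _ fun i _ => hmem i
    rw [← ofReal_integral_eq_lintegral_ofReal hsum.integrable_sq
        (ae_of_all _ fun _ => sq_nonneg _),
      ← ofReal_integral_eq_lintegral_ofReal hg2.integrable_sq (ae_of_all _ fun _ => sq_nonneg _),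
      ← ENNReal.ofReal_mul (by positivity)]
    exact ENNReal.ofReal_le_ofReal (integral_sum_mul_sq_pi_le ρ hg2 c)

/-- A second moment bound for weighted sums of transforms of i.i.d. variables carries over to
transforms that depend on an independent training sample `V`. -/
lemma lintegral_sum_mul_sq_le {Ω D : Type*} {mΩ : MeasurableSpace Ω} [MeasurableSpace D]
    {μ : Measure Ω} [IsProbabilityMeasure μ] {ρ : Measure E} [IsProbabilityMeasure ρ]
    {X : ι → Ω → E} {V : Ω → D} (hX : ∀ i, Measurable (X i)) (hV : Measurable V)
    (hindep : iIndepFun X μ) (hlaw : ∀ i, μ.map (X i) = ρ)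
    (hVX : IndepFun V (fun ω i => X i ω) μ) {f : D → E → ℝ}
    (hf : Measurable (Function.uncurry f)) (c : ι → ℝ) {κ : ENNReal}
    (hκ : ∀ v, ∫⁻ x, ENNReal.ofReal ((∑ i, c i * f v (x i)) ^ 2) ∂(Measure.pi fun _ : ι => ρ)
      ≤ κ * ∫⁻ x, ENNReal.ofReal (f v x ^ 2) ∂ρ) :
    ∫⁻ ω, ENNReal.ofReal ((∑ i, c i * f (V ω) (X i ω)) ^ 2) ∂μ
      ≤ κ * ∫⁻ p : D × E, ENNReal.ofReal (f p.1 p.2 ^ 2) ∂((μ.map V).prod ρ) := by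
  have hXm : Measurable fun ω i => X i ω := measurable_pi_lambda _ hX
  have hpi : μ.map (fun ω i => X i ω) = Measure.pi fun _ : ι => ρ := by
    rw [hindep.map_fun_eq_pi_map fun i => (hX i).aemeasurable]
    simp_rw [hlaw]
  have hjoint := hVX.map_prod_eq_prod_map_map hV.aemeasurable hXm.aemeasurable
  rw [hpi] at hjoint
  have hF : Measurable fun p : D × (ι → E) =>
      ENNReal.ofReal ((∑ i, c i * f p.1 (p.2 i)) ^ 2) := by
    refine ENNReal.measurable_ofReal.comp (Measurable.pow_const ?_ 2)
    refine Finset.measurable_sum _ fun i _ => Measurable.const_mul ?_ (c i)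
    exact hf.comp (measurable_fst.prodMk ((measurable_pi_apply i).comp measurable_snd))
  have hF' : Measurable fun p : D × E => ENNReal.ofReal (f p.1 p.2 ^ 2) :=
    ENNReal.measurable_ofReal.comp (hf.pow_const 2)
  have : IsProbabilityMeasure (μ.map V) := Measure.isProbabilityMeasure_map hV.aemeasurable
  calc ∫⁻ ω, ENNReal.ofReal ((∑ i, c i * f (V ω) (X i ω)) ^ 2) ∂μ
      = ∫⁻ p, ENNReal.ofReal ((∑ i, c i * f p.1 (p.2 i)) ^ 2)
          ∂((μ.map V).prod (Measure.pi fun _ : ι => ρ)) := by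
        rw [← hjoint, lintegral_map hF (hV.prodMk hXm)]
    _ = ∫⁻ v, ∫⁻ x, ENNReal.ofReal ((∑ i, c i * f v (x i)) ^ 2)
          ∂(Measure.pi fun _ : ι => ρ) ∂(μ.map V) := lintegral_prod _ hF.aemeasurable
    _ ≤ ∫⁻ v, κ * ∫⁻ x, ENNReal.ofReal (f v x ^ 2) ∂ρ ∂(μ.map V) := lintegral_mono hκ
    _ = _ := by
        rw [lintegral_const_mul _ hF'.lintegral_prod_right', lintegral_prod _ hF'.aemeasurable]

end WeightedSums

section Conditioning

variable {Ω : Type*}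

/-- If an event has conditional probability at most `η` given each value of a discrete variable `X`
that is taken on a set `K`, then its probability is at most `η` plus that of the complement of
`K`. -/
lemma measure_le_of_fibers [MeasurableSpace Ω] {P : Measure Ω} [IsProbabilityMeasure P]
    {D : Type*} [Countable D] {X : Ω → D}
    (hX : ∀ d, MeasurableSet (X ⁻¹' {d})) {E K : Set Ω} {η : ENNReal}
    (h : ∀ ω ∈ K, P (E ∩ X ⁻¹' {X ω}) ≤ η * P (X ⁻¹' {X ω})) :
    P E ≤ P Kᶜ + η := by
  have hsub : E ⊆ Kᶜ ∪ ⋃ d ∈ X '' K, E ∩ X ⁻¹' {d} := by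
    intro ω hω
    by_cases hK : ω ∈ K
    · right
      simp only [Set.mem_iUnion]
      exact ⟨X ω, ⟨ω, hK, rfl⟩, hω, rfl⟩
    · exact Or.inl hK
  refine (measure_mono hsub).trans ((measure_union_le _ _).trans ?_)
  gcongr
  have hdisj : Pairwise (Function.onFun Disjoint fun d : X '' K => X ⁻¹' {(d : D)}) := by
    intro d e hde
    rw [Function.onFun, Set.disjoint_left]
    intro ω h1 h2
    exact hde (Subtype.ext (h1.symm.trans h2))
  calc P (⋃ d ∈ X '' K, E ∩ X ⁻¹' {d})
      ≤ ∑' d : X '' K, P (E ∩ X ⁻¹' {(d : D)}) := by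
        rw [Set.biUnion_eq_iUnion]; exact measure_iUnion_le _
    _ ≤ ∑' d : X '' K, η * P (X ⁻¹' {(d : D)}) := by
        refine ENNReal.tsum_le_tsum fun d => ?_
        obtain ⟨_, ω, hω, rfl⟩ := d
        exact h ω hω
    _ = η * P (⋃ d : X '' K, X ⁻¹' {(d : D)}) := by
        rw [ENNReal.tsum_mul_left, measure_iUnion hdisj fun d => hX d]
    _ ≤ η * 1 := by gcongr; exact prob_le_one
    _ = η := mul_one η

/-- An event in `σ(U) ∨ σ(X)` depends only on `U` once `X` is fixed. -/
lemma exists_measurableSet_inter_fiber_eq {D R : Type*} [MeasurableSpace R] {U : Ω → R}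
    {X : Ω → D} {E : Set Ω}
    (hE : MeasurableSet[MeasurableSpace.comap U inferInstance ⊔ MeasurableSpace.comap X ⊤] E)
    (d : D) : ∃ B : Set R, MeasurableSet B ∧ E ∩ X ⁻¹' {d} = U ⁻¹' B ∩ X ⁻¹' {d} := by
  let mD : MeasurableSpace D := ⊤
  have hE' : MeasurableSet[MeasurableSpace.comap (fun ω => (U ω, X ω))
      (MeasurableSpace.prod ‹MeasurableSpace R› mD)] E := by
    rwa [MeasurableSpace.comap_prodMk]
  obtain ⟨C, hC, rfl⟩ := hE'
  refine ⟨(fun r => (r, d)) ⁻¹' C, measurable_prodMk_right hC, ?_⟩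
  ext ω
  simp only [Set.mem_inter_iff, Set.mem_preimage, Set.mem_singleton_iff]
  constructor <;> rintro ⟨h1, rfl⟩ <;> exact ⟨h1, rfl⟩

end Conditioning

/-! ### The law of the sample given strata, assignments and folds -/

section Configuration

variable {Ω : Type*} {k S : ℕ}

/-- The units of the sample of size `n` as a random vector. -/
def sample (W : ℕ → Ω → PO k) (n : ℕ) (ω : Ω) (i : Fin n) : PO k := W i ω

/-- The assignments in the sample of size `n` as a random vector. -/
def assignment (A : ℕ → ℕ → Ω → Bool) (n : ℕ) (ω : Ω) (i : Fin n) : Bool := A n i ω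

/-- The strata of the units in the sample of size `n` as a random vector. -/
def labels (strat : (Fin k → ℝ) → Fin S) (W : ℕ → Ω → PO k) (n : ℕ) (ω : Ω) (i : Fin n) : Fin S :=
  label strat W i ω

/-- Strata, assignments and folds of the sample of size `n`. -/
def config {J : ℕ} (strat : (Fin k → ℝ) → Fin S) (W : ℕ → Ω → PO k) (A : ℕ → ℕ → Ω → Bool)
    (G : ℕ → Bool → Fin S → Fin J → Ω → Finset ℕ) (n : ℕ) (ω : Ω) :
    (Fin n → Fin S) × (Fin n → Bool) × (Bool → Fin S → Fin J → Finset ℕ) :=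
  (labels strat W n ω, assignment A n ω, fun a s j => G n a s j ω)

lemma group_eq_of_profile_eq {W : ℕ → Ω → PO k}
    {strat : (Fin k → ℝ) → Fin S} {A : ℕ → ℕ → Ω → Bool} {n : ℕ} {ω ω₀ : Ω}
    (hl : labels strat W n ω = labels strat W n ω₀)
    (ha : assignment A n ω = assignment A n ω₀) (a : Bool) (s : Fin S) :
    group strat W A n a s ω = group strat W A n a s ω₀ := by
  refine Finset.filter_congr fun i hi => ?_
  have h1 := congrFun hl ⟨i, Finset.mem_range.1 hi⟩
  have h2 := congrFun ha ⟨i, Finset.mem_range.1 hi⟩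
  simp only [labels, assignment] at h1 h2
  rw [h1, h2]

end Configuration

section SampleLaw

variable {Ω : Type*} [MeasurableSpace Ω] {P : Measure Ω} {k S : ℕ}
  {Q : ProbabilityMeasure (PO k)} {W : ℕ → Ω → PO k} {strat : (Fin k → ℝ) → Fin S}
  {A : ℕ → ℕ → Ω → Bool} {n : ℕ}

lemma measurable_sample (hW : ∀ i, Measurable (W i)) : Measurable (sample W n) :=
  measurable_pi_lambda _ fun i => hW i

lemma measurable_label (hstrat : Measurable strat) (hW : ∀ i, Measurable (W i)) (i : ℕ) :
    Measurable (label strat W i) :=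
  hstrat.comp (measurable_covariate.comp (hW i))

lemma measurable_labels (hstrat : Measurable strat) (hW : ∀ i, Measurable (W i)) :
    Measurable (labels strat W n) :=
  measurable_pi_lambda _ fun i => measurable_label hstrat hW i

lemma measurable_assignment (hA : ∀ n i, Measurable (A n i)) : Measurable (assignment A n) :=
  measurable_pi_lambda _ fun i => hA n i

lemma IsIIDSample.isProbabilityMeasure (hW : IsIIDSample P Q W) : IsProbabilityMeasure P := by
  have h := hW.law 0
  refine ⟨?_⟩
  rw [← Set.preimage_univ (f := W 0), ← Measure.map_apply (hW.measurable 0) MeasurableSet.univ, h]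
  exact measure_univ

lemma IsIIDSample.map_sample (hW : IsIIDSample P Q W) :
    P.map (sample W n) = Measure.pi fun _ : Fin n => (Q : Measure (PO k)) := by
  have := hW.isProbabilityMeasure
  have h := iIndepFun.map_fun_eq_pi_map (f := fun i : Fin n => W i)
    (fun i => (hW.measurable i).aemeasurable) (hW.indep.precomp Fin.val_injective)
  simp_rw [hW.law] at h
  exact h

lemma restrict_stratum_eq (s : Fin S) :
    (Q : Measure (PO k)).restrict (stratum strat s)
      = (Q : Measure (PO k)) (stratum strat s) • withinLaw Q strat s := by
  by_cases hs : (Q : Measure (PO k)) (stratum strat s) = 0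
  · rw [hs, zero_smul, Measure.restrict_eq_zero.2 hs]
  · rw [withinLaw, ProbabilityTheory.cond, smul_smul,
      ENNReal.mul_inv_cancel hs (measure_ne_top _ _), one_smul]

lemma pi_restrict_strata (s : Fin n → Fin S) :
    (Measure.pi fun _ : Fin n => (Q : Measure (PO k))).restrict
        (Set.univ.pi fun i => stratum strat (s i))
      = (∏ i, (Q : Measure (PO k)) (stratum strat (s i)))
        • Measure.pi fun i => withinLaw Q strat (s i) := by
  rw [Measure.restrict_pi_pi]
  refine Measure.pi_eq fun B _ => ?_
  simp_rw [restrict_stratum_eq]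
  simp [Finset.prod_mul_distrib]

/-- The event `F` has, given the sample strata `s`, no influence on the law of the units: on `F`
they are independent draws from the within-stratum laws. -/
def HasSampleLaw (P : Measure Ω) (Q : ProbabilityMeasure (PO k)) (strat : (Fin k → ℝ) → Fin S)
    (W : ℕ → Ω → PO k) (s : Fin n → Fin S) (F : Set Ω) : Prop :=
  ∀ B, MeasurableSet B →
    P (F ∩ sample W n ⁻¹' B) = P F * Measure.pi (fun i => withinLaw Q strat (s i)) B

lemma measure_labels_inter_sample (hW : IsIIDSample P Q W) (hstrat : Measurable strat)
    (s : Fin n → Fin S) {B : Set (Fin n → PO k)} (hB : MeasurableSet B) :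
    P (labels strat W n ⁻¹' {s} ∩ sample W n ⁻¹' B)
      = (∏ i, (Q : Measure (PO k)) (stratum strat (s i)))
        * Measure.pi (fun i => withinLaw Q strat (s i)) B := by
  have hset : labels strat W n ⁻¹' {s} ∩ sample W n ⁻¹' B
      = sample W n ⁻¹' (B ∩ Set.univ.pi fun i => stratum strat (s i)) := by
    ext ω
    simp only [Set.mem_inter_iff, Set.mem_preimage, Set.mem_singleton_iff, funext_iff, Set.mem_pi,
      Set.mem_univ, true_implies]
    exact and_comm
  rw [hset, ← Measure.map_apply (measurable_sample hW.measurable)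
      (hB.inter (MeasurableSet.univ_pi fun i => measurableSet_stratum hstrat (s i))),
    hW.map_sample, ← Measure.restrict_apply hB, pi_restrict_strata]
  simp

lemma hasSampleLaw_labels (hW : IsIIDSample P Q W) (hstrat : Measurable strat)
    (s : Fin n → Fin S) : HasSampleLaw P Q strat W s (labels strat W n ⁻¹' {s}) := by
  intro B hB
  have h1 := measure_labels_inter_sample hW hstrat s MeasurableSet.univ
  rw [Set.preimage_univ, Set.inter_univ] at h1
  rw [measure_labels_inter_sample hW hstrat s hB, h1]
  by_cases h0 : ∏ i, (Q : Measure (PO k)) (stratum strat (s i)) = 0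
  · simp [h0]
  · have (i : Fin n) : IsProbabilityMeasure (withinLaw Q strat (s i)) :=
      isProbabilityMeasure_withinLaw fun hi => h0 (Finset.prod_eq_zero (Finset.mem_univ i) hi)
    rw [measure_univ, mul_one]

/-- Assignments are exogenous: they do not influence the law of the units given the strata. -/
lemma hasSampleLaw_profile (hW : IsIIDSample P Q W) (hstrat : Measurable strat)
    {π : Fin S → ℝ} {α : (n : ℕ) → (Fin n → Bool) → (Fin n → Fin S) → ℝ}
    (hA : IsCARAssignment P Q W strat π α A) (s : Fin n → Fin S) (a : Fin n → Bool) :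
    HasSampleLaw P Q strat W s (labels strat W n ⁻¹' {s} ∩ assignment A n ⁻¹' {a}) := by
  have := hW.isProbabilityMeasure
  intro B hB
  set L := labels strat W n ⁻¹' {s} with hL
  have hLm : MeasurableSet L := measurable_labels hstrat hW.measurable (measurableSet_singleton s)
  have hLeq : {ω | ∀ i : Fin n, label strat W i ω = s i} = L := by
    ext ω; simp [hL, funext_iff, labels]
  by_cases h0 : P L = 0
  · rw [measure_mono_null (Set.inter_subset_left.trans Set.inter_subset_left) h0,
      measure_mono_null Set.inter_subset_left h0, zero_mul]
  have hex := (hA.exogenous n s).measure_inter_preimage_eq_mul B {a} hB (measurableSet_singleton a)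
  rw [hLeq] at hex
  change P[|L] (sample W n ⁻¹' B ∩ assignment A n ⁻¹' {a})
    = P[|L] (sample W n ⁻¹' B) * P[|L] (assignment A n ⁻¹' {a}) at hex
  rw [cond_apply hLm, cond_apply hLm, cond_apply hLm,
    hasSampleLaw_labels hW hstrat s B hB] at hex
  have hcancel : (P L)⁻¹ * P L = 1 := ENNReal.inv_mul_cancel h0 (measure_ne_top _ _)
  have hset : L ∩ assignment A n ⁻¹' {a} ∩ sample W n ⁻¹' B
      = L ∩ (sample W n ⁻¹' B ∩ assignment A n ⁻¹' {a}) := by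
    rw [Set.inter_assoc, Set.inter_comm (assignment A n ⁻¹' {a})]
  rw [← mul_assoc (P L)⁻¹ (P L), hcancel, one_mul] at hex
  rw [hset]
  calc P (L ∩ (sample W n ⁻¹' B ∩ assignment A n ⁻¹' {a}))
      = P L * ((P L)⁻¹ * P (L ∩ (sample W n ⁻¹' B ∩ assignment A n ⁻¹' {a}))) := by
        rw [← mul_assoc, mul_comm (P L), hcancel, one_mul]
    _ = ((P L)⁻¹ * P L) * (P (L ∩ assignment A n ⁻¹' {a})
          * Measure.pi (fun i => withinLaw Q strat (s i)) B) := by rw [hex]; ring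
    _ = _ := by rw [hcancel, one_mul]

/-- Given strata and assignments, the folds depend only on the randomization device. -/
lemma exists_config_fiber_eq {J : ℕ} {U : ℕ → Bool → Fin S → Ω → ℝ}
    {G : ℕ → Bool → Fin S → Fin J → Ω → Finset ℕ} (hG : IsSampleSplit P W strat A U J G)
    (ω₀ : Ω) : ∃ B : Set (Bool × Fin S → ℝ), MeasurableSet B ∧
      config strat W A G n ⁻¹' {config strat W A G n ω₀}
        = (fun ω (p : Bool × Fin S) => U n p.1 p.2 ω) ⁻¹' B
          ∩ (labels strat W n ⁻¹' {labels strat W n ω₀}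
            ∩ assignment A n ⁻¹' {assignment A n ω₀}) := by
  have h (a : Bool) (s : Fin S) (j : Fin J) :=
    exists_measurableSet_inter_fiber_eq (hG.determined n a s j
      (show @MeasurableSet _ ⊤ {G n a s j ω₀} from trivial)) (group strat W A n a s ω₀)
  choose B hB hBeq using h
  refine ⟨⋂ a, ⋂ s, ⋂ j, (fun u => u (a, s)) ⁻¹' B a s j, ?_, ?_⟩
  · exact MeasurableSet.iInter fun a => MeasurableSet.iInter fun s => MeasurableSet.iInter fun j =>
      measurable_pi_apply (a, s) (hB a s j)
  · ext ω
    simp only [Set.mem_preimage, Set.mem_singleton_iff, config, Prod.mk.injEq, Set.mem_inter_iff,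
      Set.mem_iInter]
    have hkey (hl : labels strat W n ω = labels strat W n ω₀)
        (ha : assignment A n ω = assignment A n ω₀) (a s j) :
        G n a s j ω = G n a s j ω₀ ↔ U n a s ω ∈ B a s j := by
      have h1 := Set.ext_iff.1 (hBeq a s j) ω
      simpa [group_eq_of_profile_eq hl ha a s] using h1
    constructor
    · rintro ⟨hl, ha, hg⟩
      exact ⟨fun a s j => (hkey hl ha a s j).1 (congrFun (congrFun (congrFun hg a) s) j), hl, ha⟩
    · rintro ⟨hg, hl, ha⟩
      exact ⟨hl, ha, funext fun a => funext fun s => funext fun j =>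
        (hkey hl ha a s j).2 (hg a s j)⟩

lemma measurable_device {J : ℕ} {U : ℕ → Bool → Fin S → Ω → ℝ}
    {G : ℕ → Bool → Fin S → Fin J → Ω → Finset ℕ} (hG : IsSampleSplit P W strat A U J G) :
    Measurable fun ω (p : Bool × Fin S) => U n p.1 p.2 ω :=
  measurable_pi_lambda _ fun p => hG.measurable_device n p.1 p.2

lemma measurableSet_config_fiber (hW : ∀ i, Measurable (W i)) (hstrat : Measurable strat)
    (hA : ∀ n i, Measurable (A n i)) {J : ℕ} {U : ℕ → Bool → Fin S → Ω → ℝ}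
    {G : ℕ → Bool → Fin S → Fin J → Ω → Finset ℕ} (hG : IsSampleSplit P W strat A U J G)
    (d : (Fin n → Fin S) × (Fin n → Bool) × (Bool → Fin S → Fin J → Finset ℕ)) :
    MeasurableSet (config strat W A G n ⁻¹' {d}) := by
  by_cases h : ∃ ω₀, config strat W A G n ω₀ = d
  · obtain ⟨ω₀, rfl⟩ := h
    obtain ⟨B, hB, hBeq⟩ := exists_config_fiber_eq (n := n) hG ω₀
    rw [hBeq]
    exact (measurable_device hG hB).inter
      ((measurable_labels hstrat hW (measurableSet_singleton _)).inter
        (measurable_assignment hA (measurableSet_singleton _)))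
  · convert MeasurableSet.empty
    ext ω
    simp only [Set.mem_preimage, Set.mem_singleton_iff, Set.mem_empty_iff_false, iff_false]
    exact fun hω => h ⟨ω, hω⟩

/-- Given strata, assignments and folds, the units are independent draws from the within-stratum
laws. -/
lemma hasSampleLaw_config (hW : IsIIDSample P Q W) (hstrat : Measurable strat)
    {π : Fin S → ℝ} {α : (n : ℕ) → (Fin n → Bool) → (Fin n → Fin S) → ℝ}
    (hA : IsCARAssignment P Q W strat π α A) {J : ℕ} {U : ℕ → Bool → Fin S → Ω → ℝ}
    {G : ℕ → Bool → Fin S → Fin J → Ω → Finset ℕ} (hG : IsSampleSplit P W strat A U J G)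
    (ω₀ : Ω) :
    HasSampleLaw P Q strat W (labels strat W n ω₀)
      (config strat W A G n ⁻¹' {config strat W A G n ω₀}) := by
  intro B hB
  obtain ⟨B', hB', hBeq⟩ := exists_config_fiber_eq (n := n) hG ω₀
  set s := labels strat W n ω₀
  set a := assignment A n ω₀
  set V := fun ω (p : Bool × Fin S) => U n p.1 p.2 ω
  have hind (C : Set (Fin n → PO k)) (hC : MeasurableSet C) :
      P (V ⁻¹' B' ∩ (labels strat W n ⁻¹' {s} ∩ assignment A n ⁻¹' {a} ∩ sample W n ⁻¹' C))
        = P (V ⁻¹' B')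
          * P (labels strat W n ⁻¹' {s} ∩ assignment A n ⁻¹' {a} ∩ sample W n ⁻¹' C) := by
    have hm : MeasurableSet {w : Fin n → PO k | ∀ i, strat (covariate (w i)) = s i} := by
      simp only [Set.ofPred_forall]
      exact MeasurableSet.iInter fun i =>
        (hstrat.comp (measurable_covariate.comp (measurable_pi_apply i)))
          (measurableSet_singleton (s i))
    have h := (hG.indep_sample n).measure_inter_preimage_eq_mul B'
      (({w : Fin n → PO k | ∀ i, strat (covariate (w i)) = s i} ∩ C) ×ˢ {a}) hB'
      ((hm.inter hC).prod (measurableSet_singleton a))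
    have hset : (fun ω => ((fun (i : Fin n) => W i ω), (fun (i : Fin n) => A n i ω))) ⁻¹'
        (({w : Fin n → PO k | ∀ i, strat (covariate (w i)) = s i} ∩ C) ×ˢ {a})
        = labels strat W n ⁻¹' {s} ∩ assignment A n ⁻¹' {a} ∩ sample W n ⁻¹' C := by
      ext ω
      simp only [Set.mem_preimage, Set.mem_prod, Set.mem_inter_iff, Set.mem_ofPred_eq,
        Set.mem_singleton_iff]
      constructor
      · rintro ⟨⟨h1, h2⟩, h3⟩
        exact ⟨⟨funext h1, h3⟩, h2⟩
      · rintro ⟨⟨h1, h3⟩, h2⟩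
        exact ⟨⟨congrFun h1, h2⟩, h3⟩
    rw [hset] at h
    exact h
  have hu := hind Set.univ MeasurableSet.univ
  rw [Set.preimage_univ, Set.inter_univ] at hu
  rw [hBeq, Set.inter_assoc, hind B hB, hu, hasSampleLaw_profile hW hstrat hA s a B hB, mul_assoc]

lemma HasSampleLaw.isProbabilityMeasure {s : Fin n → Fin S} {F : Set Ω}
    (h : HasSampleLaw P Q strat W s F) (hF : P F ≠ 0) (i : Fin n) :
    IsProbabilityMeasure (withinLaw Q strat (s i)) := by
  refine isProbabilityMeasure_withinLaw fun h0 => hF ?_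
  have h1 := h Set.univ MeasurableSet.univ
  rw [Set.preimage_univ, Set.inter_univ, Measure.pi_univ, Finset.prod_eq_zero (Finset.mem_univ i),
    mul_zero] at h1
  · exact h1
  · rw [withinLaw, cond_eq_zero_of_meas_eq_zero h0, Measure.coe_zero, Pi.zero_apply]

lemma HasSampleLaw.map_sample_cond [IsProbabilityMeasure P] {s : Fin n → Fin S} {F : Set Ω}
    (h : HasSampleLaw P Q strat W s F) (hW : ∀ i, Measurable (W i)) (hFm : MeasurableSet F)
    (hF : P F ≠ 0) :
    (P[|F]).map (sample W n) = Measure.pi fun i => withinLaw Q strat (s i) := by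
  ext B hB
  rw [Measure.map_apply (measurable_sample hW) hB, cond_apply hFm, h B hB, ← mul_assoc,
    ENNReal.inv_mul_cancel hF (measure_ne_top _ _), one_mul]

lemma HasSampleLaw.map_cond [IsProbabilityMeasure P] {s : Fin n → Fin S} {F : Set Ω}
    (h : HasSampleLaw P Q strat W s F) (hW : ∀ i, Measurable (W i)) (hFm : MeasurableSet F)
    (hF : P F ≠ 0) (i : Fin n) :
    (P[|F]).map (W i) = withinLaw Q strat (s i) := by
  have hp := h.isProbabilityMeasure hF
  have h1 : (P[|F]).map (W i) = ((P[|F]).map (sample W n)).map (fun w => w i) := by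
    rw [Measure.map_map (measurable_pi_apply i) (measurable_sample hW)]
    rfl
  rw [h1, h.map_sample_cond hW hFm hF]
  exact (measurePreserving_eval (fun i => withinLaw Q strat (s i)) i).map_eq

lemma HasSampleLaw.iIndepFun_cond [IsProbabilityMeasure P] {s : Fin n → Fin S} {F : Set Ω}
    (h : HasSampleLaw P Q strat W s F) (hW : ∀ i, Measurable (W i)) (hFm : MeasurableSet F)
    (hF : P F ≠ 0) :
    iIndepFun (fun i : Fin n => W i) (P[|F]) := by
  have : IsProbabilityMeasure (P[|F]) := cond_isProbabilityMeasure hF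
  rw [iIndepFun_iff_map_fun_eq_pi_map (f := fun i : Fin n => W i) fun i => (hW i).aemeasurable]
  simp_rw [h.map_cond hW hFm hF]
  exact h.map_sample_cond hW hFm hF

end SampleLaw

/-! ### Group sizes -/

section GroupSizes

/-- A function that agrees with a measurable one on each fiber of a discrete variable is
measurable. -/
lemma measurable_of_eqOn_fibers {Ω D E : Type*} [MeasurableSpace Ω] [MeasurableSpace E]
    [Countable D] {X : Ω → D} (hX : ∀ d, MeasurableSet (X ⁻¹' {d})) {g : Ω → E}
    (hg : ∀ ω₀, ∃ h : Ω → E, Measurable h ∧ ∀ ω, X ω = X ω₀ → g ω = h ω) : Measurable g := by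
  choose h hh hgh using hg
  intro B hB
  have heq : g ⁻¹' B = ⋃ d ∈ Set.range X, X ⁻¹' {d} ∩ g ⁻¹' B := by
    ext ω
    simp
  rw [heq]
  refine MeasurableSet.biUnion (Set.to_countable _) ?_
  rintro _ ⟨ω₀, rfl⟩
  have : X ⁻¹' {X ω₀} ∩ g ⁻¹' B = X ⁻¹' {X ω₀} ∩ h ω₀ ⁻¹' B := by
    ext ω
    simp only [Set.mem_inter_iff, Set.mem_preimage, Set.mem_singleton_iff, and_congr_right_iff]
    intro hω
    rw [hgh ω₀ ω hω]
  rw [this]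
  exact (hX _).inter (hh ω₀ hB)

/-- A function that depends only on a discrete variable is measurable. -/
lemma measurable_of_fibers {Ω D E : Type*} [MeasurableSpace Ω] [MeasurableSpace E] [Countable D]
    {X : Ω → D} (hX : ∀ d, MeasurableSet (X ⁻¹' {d})) {g : Ω → E}
    (hg : ∀ ω ω', X ω = X ω' → g ω = g ω') : Measurable g :=
  measurable_of_eqOn_fibers hX fun ω₀ => ⟨fun _ => g ω₀, measurable_const, fun ω h => hg ω ω₀ h⟩

variable {Ω : Type*} {k S : ℕ} {W : ℕ → Ω → PO k} {strat : (Fin k → ℝ) → Fin S}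
  {A : ℕ → ℕ → Ω → Bool} {n : ℕ}

lemma mem_group {a : Bool} {s : Fin S} {ω : Ω} {i : ℕ} :
    i ∈ group strat W A n a s ω ↔ i < n ∧ A n i ω = a ∧ label strat W i ω = s := by
  simp [group]

lemma group_true_union_group_false (s : Fin S) (ω : Ω) :
    group strat W A n true s ω ∪ group strat W A n false s ω = stratumUnits strat W n s ω := by
  ext i
  simp only [Finset.mem_union, mem_group, stratumUnits, Finset.mem_filter, Finset.mem_range]
  cases A n i ω <;> simp

lemma disjoint_group {a b : Bool} (hab : a ≠ b) (s t : Fin S) (ω : Ω) :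
    Disjoint (group strat W A n a s ω) (group strat W A n b t ω) := by
  rw [Finset.disjoint_left]
  intro i h1 h2
  exact hab ((mem_group.1 h1).2.1.symm.trans (mem_group.1 h2).2.1)

lemma card_group_add_card_group (s : Fin S) (ω : Ω) :
    (group strat W A n true s ω).card + (group strat W A n false s ω).card
      = (stratumUnits strat W n s ω).card := by
  rw [← group_true_union_group_false (A := A),
    Finset.card_union_of_disjoint (disjoint_group (by simp) s s ω)]

lemma card_stratumUnits_le (s : Fin S) (ω : Ω) : (stratumUnits strat W n s ω).card ≤ n := by
  exact (Finset.card_filter_le _ _).trans_eq (Finset.card_range n)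

/-- Products over the sample, sorted by stratum and treatment status. -/
lemma prod_range_eq_prod_strata (ψ : Fin S → Bool → ℂ) (ω : Ω) :
    ∏ i ∈ Finset.range n, ψ (label strat W i ω) (A n i ω)
      = ∏ s, ψ s true ^ (group strat W A n true s ω).card
          * ψ s false ^ (group strat W A n false s ω).card := by
  rw [← Finset.prod_fiberwise (Finset.range n) (fun i => label strat W i ω)]
  refine Finset.prod_congr rfl fun s _ => ?_
  change ∏ i ∈ stratumUnits strat W n s ω, _ = _
  rw [← group_true_union_group_false (A := A),
    Finset.prod_union (disjoint_group (by simp) s s ω)]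
  congr 1
  all_goals
    rw [← Finset.prod_const]
    refine Finset.prod_congr rfl fun i hi => ?_
    rw [(mem_group.1 hi).2.1, (mem_group.1 hi).2.2]

lemma treatedProportion_mul (s : Fin S) (ω : Ω) :
    treatedProportion strat W A n s ω * (stratumUnits strat W n s ω).card
      = (group strat W A n true s ω).card := by
  rw [treatedProportion]
  by_cases h : ((stratumUnits strat W n s ω).card : ℝ) = 0
  · have h1 := card_group_add_card_group (strat := strat) (W := W) (A := A) (n := n) s ω
    have h2 : (stratumUnits strat W n s ω).card = 0 := by exact_mod_cast h
    have h3 : (group strat W A n true s ω).card = 0 := by omega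
    rw [h, h3]; simp
  · exact div_mul_cancel₀ _ h

variable [MeasurableSpace Ω] {P : Measure Ω} {Q : ProbabilityMeasure (PO k)}

lemma measurableSet_profile_fiber (hW : ∀ i, Measurable (W i)) (hstrat : Measurable strat)
    (hA : ∀ n i, Measurable (A n i)) (d : (Fin n → Fin S) × (Fin n → Bool)) :
    MeasurableSet ((fun ω => (labels strat W n ω, assignment A n ω)) ⁻¹' {d}) :=
  ((measurable_labels hstrat hW).prodMk (measurable_assignment hA)) (measurableSet_singleton d)

/-- The stratum sizes satisfy the law of large numbers. -/
lemma ae_tendsto_card_stratumUnits (hW : IsIIDSample P Q W) (hstrat : Measurable strat)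
    (s : Fin S) :
    ∀ᵐ ω ∂P, Tendsto (fun n : ℕ => ((stratumUnits strat W n s ω).card : ℝ) / n) atTop
      (𝓝 ((Q : Measure (PO k)).real (stratum strat s))) := by
  have := hW.isProbabilityMeasure
  set g : PO k → ℝ := (stratum strat s).indicator 1 with hg
  have hgm : Measurable g := measurable_one.indicator (measurableSet_stratum hstrat s)
  have hident (i : ℕ) : IdentDistrib (W i) (W 0) P P :=
    ⟨(hW.measurable i).aemeasurable, (hW.measurable 0).aemeasurable, by rw [hW.law, hW.law]⟩
  have hint : Integrable (g ∘ W 0) P := by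
    refine Integrable.of_bound (hgm.comp (hW.measurable 0)).aestronglyMeasurable 1
      (ae_of_all _ fun ω => ?_)
    simp only [hg, Function.comp_apply, Set.indicator]
    split_ifs <;> simp
  have h := strong_law_ae_real (fun i => g ∘ W i) hint
    (fun i j hij => (hW.indep.indepFun hij).comp hgm hgm) fun i => (hident i).comp hgm
  have hmean : ∫ ω, (g ∘ W 0) ω ∂P = (Q : Measure (PO k)).real (stratum strat s) := by
    rw [← integral_indicator_one (measurableSet_stratum hstrat s), ← hW.law 0,
      integral_map (hW.measurable 0).aemeasurable hgm.aestronglyMeasurable]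
    rfl
  rw [hmean] at h
  filter_upwards [h] with ω hω
  refine hω.congr fun n => ?_
  congr 1
  rw [stratumUnits, Finset.card_filter]
  push_cast
  refine Finset.sum_congr rfl fun i _ => ?_
  simp only [hg, Set.indicator, stratum, label, Function.comp_apply]
  congr 1

/-- Strata of probability 0 are almost surely empty. -/
lemma ae_stratumUnits_eq_empty (hW : IsIIDSample P Q W) {s : Fin S}
    (hstrat : Measurable strat) (hs : (Q : Measure (PO k)) (stratum strat s) = 0) :
    ∀ᵐ ω ∂P, ∀ n, stratumUnits strat W n s ω = ∅ := by
  have h : ∀ᵐ ω ∂P, ∀ i, label strat W i ω ≠ s := by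
    rw [ae_all_iff]
    intro i
    rw [← hW.law i, Measure.map_apply (hW.measurable i) (measurableSet_stratum hstrat s)] at hs
    rw [ae_iff]
    simpa [label, stratum] using! hs
  filter_upwards [h] with ω hω n
  rw [stratumUnits, Finset.filter_eq_empty_iff]
  exact fun i _ => hω i

end GroupSizes

/-! ### The central limit theorem for the influence function -/

section CLT

variable {Ω : Type*} [MeasurableSpace Ω] {P : Measure Ω} {k S : ℕ}
  {Q : ProbabilityMeasure (PO k)} {W : ℕ → Ω → PO k} {strat : (Fin k → ℝ) → Fin S}
  {π : Fin S → ℝ} {α : (n : ℕ) → (Fin n → Bool) → (Fin n → Fin S) → ℝ}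
  {A : ℕ → ℕ → Ω → Bool} {n : ℕ}

lemma HasSampleLaw.setIntegral_comp_sample {s : Fin n → Fin S} {F : Set Ω}
    (h : HasSampleLaw P Q strat W s F) (hW : ∀ i, Measurable (W i))
    {g : (Fin n → PO k) → ℂ} (hg : Measurable g) :
    ∫ ω in F, g (sample W n ω) ∂P
      = P.real F * ∫ w, g w ∂(Measure.pi fun i => withinLaw Q strat (s i)) := by
  have hmap : (P.restrict F).map (sample W n)
      = P F • Measure.pi fun i => withinLaw Q strat (s i) := by
    ext B hB
    rw [Measure.map_apply (measurable_sample hW) hB,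
      Measure.restrict_apply (measurable_sample hW hB),
      Set.inter_comm, h B hB, Measure.smul_apply, smul_eq_mul]
  rw [← integral_map (measurable_sample hW).aemeasurable hg.aestronglyMeasurable, hmap,
    integral_smul_measure]
  rfl

/-- The characteristic function, within stratum `s`, of the influence function of treatment
status `a`. -/
noncomputable def armCharFun (Q : ProbabilityMeasure (PO k)) (strat : (Fin k → ℝ) → Fin S)
    (π : Fin S → ℝ) (s : Fin S) (a : Bool) (u : ℝ) : ℂ :=
  charFun ((withinLaw Q strat s).map (armInfluence Q strat π a)) u

lemma armCharFun_eq (hstrat : Measurable strat) (s : Fin S) (a : Bool) (u : ℝ) :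
    armCharFun Q strat π s a u
      = ∫ w, Complex.exp (u * armInfluence Q strat π a w * Complex.I) ∂(withinLaw Q strat s) := by
  rw [armCharFun, charFun_apply_real, integral_map (measurable_armInfluence hstrat).aemeasurable]
  exact Measurable.aestronglyMeasurable (by fun_prop)

lemma norm_armCharFun_le (hstrat : Measurable strat) (s : Fin S) (a : Bool) (u : ℝ) :
    ‖armCharFun Q strat π s a u‖ ≤ 1 := by
  by_cases hs : (Q : Measure (PO k)) (stratum strat s) = 0
  · rw [armCharFun_eq hstrat, withinLaw, cond_eq_zero_of_meas_eq_zero hs, integral_zero_measure]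
    simp
  · have := isProbabilityMeasure_withinLaw hs
    have : IsProbabilityMeasure ((withinLaw Q strat s).map (armInfluence Q strat π a)) :=
      Measure.isProbabilityMeasure_map (measurable_armInfluence hstrat).aemeasurable
    exact norm_charFun_le_one _

lemma measurable_armInfluence_assigned (hW : IsIIDSample P Q W) (hstrat : Measurable strat)
    (hA : IsCARAssignment P Q W strat π α A) (n i : ℕ) :
    Measurable fun ω => armInfluence Q strat π (A n i ω) (W i ω) := by
  have h : Measurable fun p : Bool × PO k => armInfluence Q strat π p.1 p.2 :=
    measurable_from_prod_countable_right fun a => measurable_armInfluence hstrat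
  exact h.comp ((hA.measurable n i).prodMk (hW.measurable i))

/-- Given strata and assignments the units are independent, so the characteristic function of the
sum of the influence functions is the mean of a product over the units. -/
lemma integral_exp_sum_armInfluence (hW : IsIIDSample P Q W) (hstrat : Measurable strat)
    (hA : IsCARAssignment P Q W strat π α A) (n : ℕ) (u : ℝ) :
    ∫ ω, Complex.exp (u * (∑ i ∈ Finset.range n, armInfluence Q strat π (A n i ω) (W i ω) : ℝ)
        * Complex.I) ∂P
      = ∫ ω, ∏ i ∈ Finset.range n, armCharFun Q strat π (label strat W i ω) (A n i ω) u ∂P := by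
  have := hW.isProbabilityMeasure
  set X : Ω → (Fin n → Fin S) × (Fin n → Bool) :=
    fun ω => (labels strat W n ω, assignment A n ω) with hX
  have hXm (d) : MeasurableSet (X ⁻¹' {d}) :=
    measurableSet_profile_fiber hW.measurable hstrat hA.measurable d
  have hdisj : Pairwise (Function.onFun Disjoint fun d => X ⁻¹' {d}) := by
    intro d e hde
    rw [Function.onFun, Set.disjoint_left]
    intro ω h1 h2
    exact hde (h1.symm.trans h2)
  have huniv : ⋃ d, X ⁻¹' {d} = Set.univ := by
    ext ω; simp
  have hsplit {f : Ω → ℂ} (hf : Integrable f P) : ∫ ω, f ω ∂P = ∑ d, ∫ ω in X ⁻¹' {d}, f ω ∂P := by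
    rw [← integral_iUnion_fintype hXm hdisj fun _ => hf.integrableOn, huniv, setIntegral_univ]
  have hint1 : Integrable (fun ω => Complex.exp
      (u * (∑ i ∈ Finset.range n, armInfluence Q strat π (A n i ω) (W i ω) : ℝ)
        * Complex.I)) P := by
    refine Integrable.of_bound (Measurable.aestronglyMeasurable ?_) 1 (ae_of_all _ fun ω => ?_)
    · have : Measurable fun ω =>
          ∑ i ∈ Finset.range n, armInfluence Q strat π (A n i ω) (W i ω) :=
        Finset.measurable_sum _ fun i _ => measurable_armInfluence_assigned hW hstrat hA n i
      fun_prop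
    · rw [← Complex.ofReal_mul, Complex.norm_exp_ofReal_mul_I]
  have hint2 : Integrable (fun ω =>
      ∏ i ∈ Finset.range n, armCharFun Q strat π (label strat W i ω) (A n i ω) u) P := by
    refine Integrable.of_bound (Measurable.aestronglyMeasurable ?_) 1 (ae_of_all _ fun ω => ?_)
    · refine measurable_of_fibers hXm fun ω ω' h => ?_
      rw [prod_range_eq_prod_strata (fun s a => armCharFun Q strat π s a u),
        prod_range_eq_prod_strata (fun s a => armCharFun Q strat π s a u)]
      simp_rw [group_eq_of_profile_eq (congrArg Prod.fst h) (congrArg Prod.snd h)]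
    · rw [norm_prod]
      exact Finset.prod_le_one (fun _ _ => norm_nonneg _) fun _ _ => norm_armCharFun_le hstrat _ _ _
  rw [hsplit hint1, hsplit hint2]
  refine Finset.sum_congr rfl fun d _ => ?_
  obtain ⟨s, a⟩ := d
  have hF : X ⁻¹' {(s, a)} = labels strat W n ⁻¹' {s} ∩ assignment A n ⁻¹' {a} := by
    ext ω; simp [hX]
  have hlaw : HasSampleLaw P Q strat W s (X ⁻¹' {(s, a)}) := by
    rw [hF]; exact hasSampleLaw_profile hW hstrat hA s a
  have hprofile : ∀ ω ∈ X ⁻¹' {(s, a)}, ∀ i : Fin n, label strat W i ω = s i ∧ A n i ω = a i := by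
    intro ω hω i
    have h1 : (labels strat W n ω, assignment A n ω) = (s, a) := hω
    rw [Prod.mk.injEq] at h1
    exact ⟨congrFun h1.1 i, congrFun h1.2 i⟩
  have hleft : ∫ ω in X ⁻¹' {(s, a)}, Complex.exp
      (u * (∑ i ∈ Finset.range n, armInfluence Q strat π (A n i ω) (W i ω) : ℝ) * Complex.I) ∂P
      = ∫ ω in X ⁻¹' {(s, a)}, (fun w : Fin n → PO k =>
        ∏ i, Complex.exp (u * armInfluence Q strat π (a i) (w i) * Complex.I))
          (sample W n ω) ∂P := by
    refine setIntegral_congr_fun (hXm _) fun ω hω => ?_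
    simp only [sample]
    rw [← Complex.exp_sum, Finset.sum_range, ← Finset.sum_mul, ← Finset.mul_sum]
    push_cast
    congr 3
    refine Finset.sum_congr rfl fun i _ => ?_
    rw [(hprofile ω hω i).2]
  have hright : ∫ ω in X ⁻¹' {(s, a)},
      ∏ i ∈ Finset.range n, armCharFun Q strat π (label strat W i ω) (A n i ω) u ∂P
      = ∫ ω in X ⁻¹' {(s, a)}, ∏ i : Fin n, armCharFun Q strat π (s i) (a i) u ∂P := by
    refine setIntegral_congr_fun (hXm _) fun ω hω => ?_
    rw [Finset.prod_range]
    refine Finset.prod_congr rfl fun i _ => ?_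
    rw [(hprofile ω hω i).1, (hprofile ω hω i).2]
  rw [hleft, hright, hlaw.setIntegral_comp_sample hW.measurable (g := fun w =>
      ∏ i, Complex.exp (u * armInfluence Q strat π (a i) (w i) * Complex.I)), setIntegral_const,
    integral_fintype_prod_eq_prod (fun (i : Fin n) (w : PO k) =>
      Complex.exp (u * armInfluence Q strat π (a i) w * Complex.I))]
  · simp_rw [armCharFun_eq hstrat]
    rfl
  · refine Finset.measurable_prod _ fun i _ => ?_
    have h := (measurable_armInfluence (Q := Q) (π := π) (a := a i) hstrat).comp
      (measurable_pi_apply (X := fun _ : Fin n => PO k) i)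
    simp only [Function.comp_def] at h
    fun_prop

/-- The mixture of the characteristic functions of both treatment statuses in a stratum, with the
target probabilities as weights. -/
noncomputable def mixCharFun (Q : ProbabilityMeasure (PO k)) (strat : (Fin k → ℝ) → Fin S)
    (π : Fin S → ℝ) (s : Fin S) (u : ℝ) : ℂ :=
  (π s : ℂ) * armCharFun Q strat π s true u + (1 - π s) * armCharFun Q strat π s false u

lemma norm_mixCharFun_le (hstrat : Measurable strat) (hπ : ∀ s, π s ∈ Set.Ioo (0 : ℝ) 1) (s : Fin S)
    (u : ℝ) : ‖mixCharFun Q strat π s u‖ ≤ 1 := by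
  have h0 : ‖(π s : ℂ)‖ = π s := by
    rw [Complex.norm_real, Real.norm_of_nonneg (hπ s).1.le]
  have h1 : ‖(1 - π s : ℂ)‖ = 1 - π s := by
    rw [← Complex.ofReal_one, ← Complex.ofReal_sub, Complex.norm_real,
      Real.norm_of_nonneg (sub_nonneg.2 (hπ s).2.le)]
  calc ‖mixCharFun Q strat π s u‖
      ≤ ‖(π s : ℂ) * armCharFun Q strat π s true u‖
        + ‖(1 - π s : ℂ) * armCharFun Q strat π s false u‖ := norm_add_le _ _
    _ ≤ π s * 1 + (1 - π s) * 1 := by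
        rw [norm_mul, norm_mul, h0, h1]
        have := (hπ s).1.le
        have := sub_nonneg.2 (hπ s).2.le
        gcongr <;> exact norm_armCharFun_le hstrat _ _ _
    _ = 1 := by ring

/-- With the mixtures in the place of the characteristic functions of the actual arms, the factors
are functions of the i.i.d. strata. -/
lemma integral_prod_mixCharFun (hW : IsIIDSample P Q W) (hstrat : Measurable strat) (n : ℕ)
    (u : ℝ) :
    ∫ ω, ∏ i ∈ Finset.range n, mixCharFun Q strat π (label strat W i ω) u ∂P
      = (∑ s, (Q : Measure (PO k)).real (stratum strat s) * mixCharFun Q strat π s u) ^ n := by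
  set h : PO k → ℂ := fun w => mixCharFun Q strat π (strat (covariate w)) u with hh
  have hm : Measurable h := (measurable_of_finite fun s => mixCharFun Q strat π s u).comp
    (hstrat.comp measurable_covariate)
  have hint : Integrable h (Q : Measure (PO k)) := by
    refine Integrable.of_bound hm.aestronglyMeasurable (∑ s, ‖mixCharFun Q strat π s u‖)
      (ae_of_all _ fun w => ?_)
    exact Finset.single_le_sum (f := fun s => ‖mixCharFun Q strat π s u‖)
      (fun _ _ => norm_nonneg _) (Finset.mem_univ _)
  have h1 : ∫ ω, ∏ i ∈ Finset.range n, mixCharFun Q strat π (label strat W i ω) u ∂P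
      = ∫ ω, (fun w : Fin n → PO k => ∏ i, h (w i)) (sample W n ω) ∂P := by
    congr with ω
    rw [Finset.prod_range]
    rfl
  have hprodm : Measurable fun w : Fin n → PO k => ∏ i, h (w i) :=
    Finset.measurable_prod _ fun i _ => hm.comp (measurable_pi_apply i)
  rw [h1, ← integral_map (measurable_sample hW.measurable).aemeasurable
      hprodm.aestronglyMeasurable, hW.map_sample, integral_fintype_prod_eq_pow h,
    Fintype.card_fin, ← sum_measureReal_mul_integral_withinLaw hstrat hint]
  congr 1
  refine Finset.sum_congr rfl fun s _ => ?_
  by_cases hs : (Q : Measure (PO k)) (stratum strat s) = 0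
  · simp [Measure.real, hs]
  · have := isProbabilityMeasure_withinLaw hs
    have h2 : h =ᵐ[withinLaw Q strat s] fun _ => mixCharFun Q strat π s u := by
      filter_upwards [ae_withinLaw_strat hstrat s] with w hw
      simp [hh, hw]
    rw [integral_congr_ae h2]
    simp

lemma hasExpansion_armCharFun (hstrat : Measurable strat)
    (hY : ∀ a, MemLp (outcome a) 2 (Q : Measure (PO k))) {s : Fin S}
    (hs : (Q : Measure (PO k)) (stratum strat s) ≠ 0) (a : Bool) :
    HasExpansion (armCharFun Q strat π s a) (∫ w, effect Q (covariate w) ∂(withinLaw Q strat s))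
      (∫ w, armInfluence Q strat π a w ^ 2 ∂(withinLaw Q strat s)) := by
  have := isProbabilityMeasure_withinLaw hs
  have h := hasExpansion_charFun (memLp_withinLaw (strat := strat) (s := s)
    (memLp_armInfluence (a := a) (π := π) hstrat hY))
  rwa [integral_armInfluence_withinLaw hstrat hY] at h

lemma hasExpansion_centered_armCharFun (hstrat : Measurable strat)
    (hY : ∀ a, MemLp (outcome a) 2 (Q : Measure (PO k))) {s : Fin S}
    (hs : (Q : Measure (PO k)) (stratum strat s) ≠ 0) (a : Bool) :
    ∃ v, HasExpansion (fun u => Complex.exp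
      (-(u * ∫ w, effect Q (covariate w) ∂(withinLaw Q strat s) : ℝ) * Complex.I)
        * armCharFun Q strat π s a u) 0 v := by
  have := isProbabilityMeasure_withinLaw hs
  set m := ∫ w, effect Q (covariate w) ∂(withinLaw Q strat s) with hm
  have hL := memLp_withinLaw (strat := strat) (s := s)
    (memLp_armInfluence (a := a) (π := π) hstrat hY)
  have h := hasExpansion_charFun (hL.sub (memLp_const m))
  have h0 : ∫ w, (armInfluence Q strat π a - fun _ => m : PO k → ℝ) w
      ∂(withinLaw Q strat s) = 0 := by
    simp only [Pi.sub_apply]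
    rw [integral_sub (hL.integrable (by norm_num)) (integrable_const _),
      integral_armInfluence_withinLaw hstrat hY]
    simp [hm]
  rw [h0] at h
  refine ⟨∫ w, (armInfluence Q strat π a - fun _ => m : PO k → ℝ) w ^ 2 ∂(withinLaw Q strat s), ?_⟩
  convert! h using 1
  ext u
  have hmeas := measurable_armInfluence (Q := Q) (π := π) (a := a) hstrat
  rw [charFun_apply_real, integral_map (hmeas.sub measurable_const).aemeasurable
    (Measurable.aestronglyMeasurable (by fun_prop)), armCharFun_eq hstrat, ← integral_const_mul]
  congr with w
  rw [← Complex.exp_add]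
  congr 1
  simp only [Pi.sub_apply]
  push_cast
  ring

end CLT

section Summands

variable {Ω : Type*} {k S : ℕ} {Q : ProbabilityMeasure (PO k)} {W : ℕ → Ω → PO k}
  {strat : (Fin k → ℝ) → Fin S} {π : Fin S → ℝ} {A : ℕ → ℕ → Ω → Bool} {n : ℕ}

/-- The error, in one stratum, of replacing the actual assignments by the target mixture. -/
noncomputable def mixError (Q : ProbabilityMeasure (PO k)) (strat : (Fin k → ℝ) → Fin S)
    (π : Fin S → ℝ) (W : ℕ → Ω → PO k) (A : ℕ → ℕ → Ω → Bool) (n : ℕ) (s : Fin S) (u : ℝ)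
    (ω : Ω) : ℝ :=
  ‖armCharFun Q strat π s true u ^ (group strat W A n true s ω).card
      * armCharFun Q strat π s false u ^ (group strat W A n false s ω).card
    - mixCharFun Q strat π s u
      ^ ((group strat W A n true s ω).card + (group strat W A n false s ω).card)‖

lemma norm_mixError_le_two (hstrat : Measurable strat) (hπ : ∀ s, π s ∈ Set.Ioo (0 : ℝ) 1)
    (s : Fin S) (u : ℝ) (ω : Ω) : ‖mixError Q strat π W A n s u ω‖ ≤ 2 := by
  rw [mixError, norm_norm]
  refine (norm_sub_le _ _).trans ?_
  rw [norm_mul, norm_pow, norm_pow, norm_pow]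
  have h1 := pow_le_one₀ (n := (group strat W A n true s ω).card) (norm_nonneg _)
    (norm_armCharFun_le (Q := Q) (π := π) hstrat s true u)
  have h2 := pow_le_one₀ (n := (group strat W A n false s ω).card) (norm_nonneg _)
    (norm_armCharFun_le (Q := Q) (π := π) hstrat s false u)
  have h3 := pow_le_one₀ (n := (group strat W A n true s ω).card
      + (group strat W A n false s ω).card) (norm_nonneg _)
    (norm_mixCharFun_le (Q := Q) hstrat hπ s u)
  have h4 := mul_le_one₀ h1 (by positivity) h2
  linarith

lemma influence_obs_eq (ω : Ω) (i : ℕ) :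
    influence Q strat π (obs W A n i ω) (A n i ω) (covariate (W i ω))
      = armInfluence Q strat π (A n i ω) (W i ω) := by
  rw [← influence_eq_armInfluence]
  congr 1
  cases h : A n i ω <;> simp [obs, toReal, h]

/-- The infeasible estimator is an average of influence functions. -/
lemma sqrt_mul_infeasible_sub (n : ℕ) (ω : Ω) :
    Real.sqrt n * (infeasible Q W strat π A n ω - ate Q)
      = (1 / Real.sqrt n) * ∑ i ∈ Finset.range n,
          influence Q strat π (obs W A n i ω) (A n i ω) (covariate (W i ω)) := by
  rcases Nat.eq_zero_or_pos n with rfl | hn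
  · simp
  have hn' : (n : ℝ) ≠ 0 := by exact_mod_cast hn.ne'
  have hsum : ∑ i ∈ Finset.range n,
      influence Q strat π (obs W A n i ω) (A n i ω) (covariate (W i ω))
      = n * (infeasible Q W strat π A n ω - ate Q) := by
    rw [infeasible, mul_sub, ← mul_assoc, mul_one_div_cancel hn', one_mul]
    have : (n : ℝ) * ate Q = ∑ i ∈ Finset.range n, ate Q := by simp
    rw [this, ← Finset.sum_sub_distrib]
    refine Finset.sum_congr rfl fun i _ => ?_
    simp only [influence, label]
    ring
  rw [hsum, ← mul_assoc]
  congr 1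
  rw [one_div_mul_eq_div, Real.div_sqrt]

end Summands

section CLT

variable {Ω : Type*} [MeasurableSpace Ω] {P : Measure Ω} {k S : ℕ}
  {Q : ProbabilityMeasure (PO k)} {W : ℕ → Ω → PO k} {strat : (Fin k → ℝ) → Fin S}
  {π : Fin S → ℝ} {α : (n : ℕ) → (Fin n → Bool) → (Fin n → Fin S) → ℝ}
  {A : ℕ → ℕ → Ω → Bool} {n : ℕ}

lemma measurable_mixError (hW : IsIIDSample P Q W) (hstrat : Measurable strat)
    (hA : IsCARAssignment P Q W strat π α A) (s : Fin S) (u : ℝ) :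
    Measurable (mixError Q strat π W A n s u) :=
  measurable_of_fibers (measurableSet_profile_fiber (n := n) hW.measurable hstrat hA.measurable)
    fun ω ω' h => by
      simp only [mixError]
      simp_rw [group_eq_of_profile_eq (congrArg Prod.fst h) (congrArg Prod.snd h)]

/-- The group shares converge along a further subsequence of every subsequence of sample sizes. -/
lemma exists_subseq_tendsto_card_group (hW : IsIIDSample P Q W) (hstrat : Measurable strat)
    (hA : IsCARAssignment P Q W strat π α A) {s : Fin S}
    (hs : (Q : Measure (PO k)) (stratum strat s) ≠ 0) {ns : ℕ → ℕ} (hns : Tendsto ns atTop atTop) :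
    ∃ ms : ℕ → ℕ, Tendsto (fun j => ns (ms j)) atTop atTop ∧ ∀ᵐ ω ∂P,
      Tendsto (fun j => ((group strat W A (ns (ms j)) true s ω).card : ℝ) / ns (ms j)) atTop
        (𝓝 (π s * (Q : Measure (PO k)).real (stratum strat s))) ∧
      Tendsto (fun j => ((group strat W A (ns (ms j)) false s ω).card : ℝ) / ns (ms j)) atTop
        (𝓝 ((1 - π s) * (Q : Measure (PO k)).real (stratum strat s))) := by
  obtain ⟨ms, hms, hae⟩ := ((hA.proportion s hs).comp hns).exists_seq_tendsto_ae
  refine ⟨ms, hns.comp hms.tendsto_atTop, ?_⟩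
  filter_upwards [hae, ae_tendsto_card_stratumUnits hW hstrat s] with ω h1 h2
  have h3 := h2.comp (hns.comp hms.tendsto_atTop)
  have h4 := h1.mul h3
  have h5 : Tendsto (fun j => ((group strat W A (ns (ms j)) true s ω).card : ℝ) / ns (ms j)) atTop
      (𝓝 (π s * (Q : Measure (PO k)).real (stratum strat s))) := by
    refine h4.congr fun j => ?_
    simp only [Function.comp_apply]
    rw [← mul_div_assoc, treatedProportion_mul]
  refine ⟨h5, ?_⟩
  have h6 := h3.sub h5
  rw [sub_mul, one_mul]
  refine h6.congr fun j => ?_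
  simp only [Function.comp_apply]
  rw [← card_group_add_card_group (A := A)]
  push_cast
  ring

/-- The arm characteristic functions have the same first-order term, so only the limiting group
shares matter for their products; convergence in probability of the shares suffices, along
subsequences on which it holds almost surely. -/
lemma tendsto_integral_mixError (hW : IsIIDSample P Q W) (hstrat : Measurable strat)
    (hπ : ∀ s, π s ∈ Set.Ioo (0 : ℝ) 1) (hA : IsCARAssignment P Q W strat π α A)
    (hY : ∀ a, MemLp (outcome a) 2 (Q : Measure (PO k))) (s : Fin S) (t : ℝ) :
    Tendsto (fun n : ℕ => ∫ ω, mixError Q strat π W A n s ((Real.sqrt n)⁻¹ * t) ω ∂P) atTop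
      (𝓝 0) := by
  have := hW.isProbabilityMeasure
  by_cases hs : (Q : Measure (PO k)) (stratum strat s) = 0
  · refine tendsto_const_nhds.congr fun n => ?_
    rw [← integral_zero Ω ℝ (μ := P)]
    refine integral_congr_ae ?_
    filter_upwards [ae_stratumUnits_eq_empty hW hstrat hs] with ω hω
    have h := card_group_add_card_group (strat := strat) (W := W) (A := A) (n := n) s ω
    rw [hω, Finset.card_empty] at h
    have h1 : (group strat W A n true s ω).card = 0 := by omega
    have h0 : (group strat W A n false s ω).card = 0 := by omega
    simp [mixError, h1, h0]
  · refine tendsto_of_subseq_tendsto fun ns hns => ?_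
    obtain ⟨ms, hms, hae⟩ := exists_subseq_tendsto_card_group hW hstrat hA hs hns
    refine ⟨ms, ?_⟩
    rw [← integral_zero Ω ℝ (μ := P)]
    refine tendsto_integral_of_dominated_convergence (fun _ => 2)
      (fun j => (measurable_mixError hW hstrat hA s _).aestronglyMeasurable)
      (integrable_const _) (fun j => ae_of_all _ fun ω => norm_mixError_le_two hstrat hπ s _ ω) ?_
    · obtain ⟨v₁, h₁⟩ := hasExpansion_centered_armCharFun (π := π) hstrat hY hs true
      obtain ⟨v₀, h₀⟩ := hasExpansion_centered_armCharFun (π := π) hstrat hY hs false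
      filter_upwards [hae] with ω hω
      exact tendsto_pow_mul_pow_sub_mixture_pow hms h₁ h₀ hω.1 hω.2

/-- The characteristic function under random assignment with the target probabilities, at the scale
of the central limit theorem. -/
lemma tendsto_sum_mixCharFun_pow (hstrat : Measurable strat)
    (hπ : ∀ s, π s ∈ Set.Ioo (0 : ℝ) 1)
    (hY : ∀ a, MemLp (outcome a) 2 (Q : Measure (PO k))) (t : ℝ) :
    Tendsto (fun n : ℕ => (∑ s, (Q : Measure (PO k)).real (stratum strat s)
        * mixCharFun Q strat π s ((Real.sqrt n)⁻¹ * t)) ^ n) atTop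
      (𝓝 (Complex.exp (-(efficiencyBound Q strat π * t ^ 2 / 2 : ℝ)))) := by
  set p : Fin S → ℝ := fun s => (Q : Measure (PO k)).real (stratum strat s) with hp
  set m : Fin S → ℝ := fun s => ∫ w, effect Q (covariate w) ∂(withinLaw Q strat s) with hm
  set v : Fin S → Bool → ℝ :=
    fun s a => ∫ w, armInfluence Q strat π a w ^ 2 ∂(withinLaw Q strat s) with hv
  have hp1 : ∑ s, p s = 1 := by
    have h := sum_measureReal_mul_integral_withinLaw hstrat (Q := Q) (f := fun _ => (1 : ℝ))
      (integrable_const _)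
    rw [integral_const, probReal_univ, one_smul] at h
    rw [← h]
    refine Finset.sum_congr rfl fun s _ => ?_
    by_cases hs : (Q : Measure (PO k)) (stratum strat s) = 0
    · simp [hp, Measure.real, hs]
    · have := isProbabilityMeasure_withinLaw hs
      simp [hp]
  have hexp := HasExpansion.sum (Finset.univ : Finset (Fin S × Bool))
    (ψ := fun x => armCharFun Q strat π x.1 x.2) (m := fun x => m x.1) (v := fun x => v x.1 x.2)
    (p := fun x => p x.1 * share π x.2 x.1) (by
      rw [← hp1, Fintype.sum_prod_type]
      refine Finset.sum_congr rfl fun s _ => ?_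
      simp [share]; ring) (fun x _ hx => hasExpansion_armCharFun hstrat hY (fun h0 => hx (by
        simp [hp, Measure.real, h0])) x.2)
  have hmean : ∑ x : Fin S × Bool, p x.1 * share π x.2 x.1 * m x.1 = 0 := by
    rw [← sum_measureReal_mul_integral_effect hstrat hY, Fintype.sum_prod_type]
    refine Finset.sum_congr rfl fun s _ => ?_
    simp [share, hp, hm]; ring
  have hvar : ∑ x : Fin S × Bool, p x.1 * share π x.2 x.1 * v x.1 x.2
      = efficiencyBound Q strat π := by
    rw [efficiencyBound_eq_sum hstrat hπ hY, Fintype.sum_prod_type]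
    refine Finset.sum_congr rfl fun s _ => ?_
    simp [share, hp, hv]; ring
  rw [hmean, hvar] at hexp
  have hlim := tendsto_pow_of_tendsto_mul_sub_one (n := fun n : ℕ => n) (k := fun n : ℕ => n)
    (c := 1) tendsto_id (hexp.tendsto_mul_sub_one t)
    (tendsto_const_nhds.congr' (by
      filter_upwards [eventually_gt_atTop 0] with n hn
      rw [div_self (by exact_mod_cast hn.ne')]))
  rw [Complex.ofReal_one, one_mul] at hlim
  refine hlim.congr fun n => ?_
  congr 1
  rw [Fintype.sum_prod_type]
  refine Finset.sum_congr rfl fun s _ => ?_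
  simp [share, mixCharFun, hp]; ring

lemma efficiencyBound_nonneg (hstrat : Measurable strat) (hπ : ∀ s, π s ∈ Set.Ioo (0 : ℝ) 1)
    (hY : ∀ a, MemLp (outcome a) 2 (Q : Measure (PO k))) : 0 ≤ efficiencyBound Q strat π := by
  rw [efficiencyBound_eq hstrat hπ hY]
  refine integral_nonneg fun w => ?_
  have h (a) := (share_pos hπ a (strat (covariate w))).le
  have h1 := h true
  have h0 := h false
  positivity

lemma tendsto_integral_exp_sum_armInfluence (hW : IsIIDSample P Q W) (hstrat : Measurable strat)
    (hπ : ∀ s, π s ∈ Set.Ioo (0 : ℝ) 1) (hA : IsCARAssignment P Q W strat π α A)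
    (hY : ∀ a, MemLp (outcome a) 2 (Q : Measure (PO k))) (t : ℝ) :
    Tendsto (fun n : ℕ => ∫ ω, Complex.exp (((Real.sqrt n)⁻¹ * t : ℝ)
        * (∑ i ∈ Finset.range n, armInfluence Q strat π (A n i ω) (W i ω) : ℝ) * Complex.I) ∂P)
      atTop (𝓝 (Complex.exp (-(efficiencyBound Q strat π * t ^ 2 / 2 : ℝ)))) := by
  have := hW.isProbabilityMeasure
  have hXm (n : ℕ) := measurableSet_profile_fiber (n := n) hW.measurable hstrat hA.measurable
  simp_rw [integral_exp_sum_armInfluence hW hstrat hA]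
  have hmain := tendsto_sum_mixCharFun_pow hstrat hπ hY t
  simp_rw [← integral_prod_mixCharFun hW hstrat] at hmain
  refine tendsto_of_tendsto_of_dist hmain ?_
  have hbound : Tendsto (fun n : ℕ => ∑ s,
      ∫ ω, mixError Q strat π W A n s ((Real.sqrt n)⁻¹ * t) ω ∂P) atTop (𝓝 0) := by
    have h := tendsto_finsetSum (Finset.univ : Finset (Fin S)) fun s _ =>
      tendsto_integral_mixError hW hstrat hπ hA hY s t
    simpa using h
  refine squeeze_zero (fun _ => dist_nonneg) (fun n => ?_) hbound
  set u := (Real.sqrt n)⁻¹ * t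
  have hmix (ω : Ω) : ∏ i ∈ Finset.range n, mixCharFun Q strat π (label strat W i ω) u
      = ∏ s, mixCharFun Q strat π s u
          ^ ((group strat W A n true s ω).card + (group strat W A n false s ω).card) := by
    rw [prod_range_eq_prod_strata (A := A) (fun s _ => mixCharFun Q strat π s u)]
    simp_rw [pow_add]
  have harm (ω : Ω) := prod_range_eq_prod_strata (strat := strat) (W := W) (A := A) (n := n)
    (fun s a => armCharFun Q strat π s a u) ω
  have hle1 (s : Fin S) (a : Bool) := norm_armCharFun_le (Q := Q) (π := π) hstrat s a u
  have hle2 (s : Fin S) := norm_mixCharFun_le (Q := Q) hstrat hπ s u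
  have hint1 : Integrable (fun ω => ∏ i ∈ Finset.range n,
      mixCharFun Q strat π (label strat W i ω) u) P := by
    refine Integrable.of_bound (Measurable.aestronglyMeasurable ?_) 1 (ae_of_all _ fun ω => ?_)
    · refine measurable_of_fibers (hXm n) fun ω ω' h => ?_
      rw [hmix, hmix]
      simp_rw [group_eq_of_profile_eq (congrArg Prod.fst h) (congrArg Prod.snd h)]
    · rw [norm_prod]
      exact Finset.prod_le_one (fun _ _ => norm_nonneg _) fun _ _ => hle2 _
  have hint2 : Integrable (fun ω => ∏ i ∈ Finset.range n,
      armCharFun Q strat π (label strat W i ω) (A n i ω) u) P := by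
    refine Integrable.of_bound (Measurable.aestronglyMeasurable ?_) 1 (ae_of_all _ fun ω => ?_)
    · refine measurable_of_fibers (hXm n) fun ω ω' h => ?_
      rw [harm, harm]
      simp_rw [group_eq_of_profile_eq (congrArg Prod.fst h) (congrArg Prod.snd h)]
    · rw [norm_prod]
      exact Finset.prod_le_one (fun _ _ => norm_nonneg _) fun _ _ => hle1 _ _
  have hint3 (s : Fin S) : Integrable (mixError Q strat π W A n s u) P :=
    Integrable.of_bound (measurable_mixError hW hstrat hA s u).aestronglyMeasurable 2
      (ae_of_all _ fun ω => norm_mixError_le_two hstrat hπ s u ω)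
  rw [dist_comm, dist_eq_norm, ← integral_sub hint2 hint1,
    ← integral_finsetSum _ fun s _ => hint3 s]
  refine (norm_integral_le_integral_norm _).trans (integral_mono (hint2.sub hint1).norm
    (integrable_finsetSum _ fun s _ => hint3 s) fun ω => ?_)
  simp only
  rw [hmix, harm]
  refine norm_prod_sub_prod_le_sum _ (fun s _ => ?_) (fun s _ => ?_)
  · rw [norm_mul, norm_pow, norm_pow]
    exact mul_le_one₀ (pow_le_one₀ (norm_nonneg _) (hle1 s true)) (by positivity)
      (pow_le_one₀ (norm_nonneg _) (hle1 s false))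
  · rw [norm_pow]
    exact pow_le_one₀ (norm_nonneg _) (hle2 s)

lemma tendstoInDistribution_infeasible [IsProbabilityMeasure P] (hW : IsIIDSample P Q W)
    (hstrat : Measurable strat)
    (hπ : ∀ s, π s ∈ Set.Ioo (0 : ℝ) 1) (hA : IsCARAssignment P Q W strat π α A)
    (hY : ∀ a, MemLp (outcome a) 2 (Q : Measure (PO k))) :
    TendstoInDistribution
      (fun (n : ℕ) ω => Real.sqrt n * (infeasible Q W strat π A n ω - ate Q))
      atTop (fun x : ℝ => x) (fun _ => P)
      (gaussianReal 0 (efficiencyBound Q strat π).toNNReal) := by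
  have heq (n : ℕ) (ω : Ω) : Real.sqrt n * (infeasible Q W strat π A n ω - ate Q)
      = (Real.sqrt n)⁻¹ * ∑ i ∈ Finset.range n, armInfluence Q strat π (A n i ω) (W i ω) := by
    rw [sqrt_mul_infeasible_sub, one_div]
    simp_rw [influence_obs_eq]
  simp_rw [heq]
  have hmeas (n : ℕ) : Measurable fun ω => (Real.sqrt n)⁻¹
      * ∑ i ∈ Finset.range n, armInfluence Q strat π (A n i ω) (W i ω) :=
    (Finset.measurable_sum _ fun i _ =>
      measurable_armInfluence_assigned hW hstrat hA n i).const_mul _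
  refine ⟨fun n => (hmeas n).aemeasurable, aemeasurable_id', ?_⟩
  refine ProbabilityMeasure.tendsto_iff_tendsto_charFun.2 fun t => ?_
  have hlim : charFun ((gaussianReal 0 (efficiencyBound Q strat π).toNNReal).map fun x : ℝ => x) t
      = Complex.exp (-(efficiencyBound Q strat π * t ^ 2 / 2 : ℝ)) := by
    rw [Measure.map_id', charFun_gaussianReal]
    congr 1
    simp [Real.coe_toNNReal _ (efficiencyBound_nonneg hstrat hπ hY)]
  simp only [ProbabilityMeasure.coe_mk]
  rw [hlim]
  refine (tendsto_integral_exp_sum_armInfluence hW hstrat hπ hA hY t).congr fun n => ?_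
  rw [charFun_apply_real, integral_map (hmeas n).aemeasurable
    (Measurable.aestronglyMeasurable (by fun_prop))]
  congr with ω
  congr 2
  push_cast
  ring

end CLT

/-! ### Conditional tail bounds for cross-fitted sums -/

section ConditionalTail

variable {Ω : Type*} [MeasurableSpace Ω] {P : Measure Ω} [IsProbabilityMeasure P] {k S : ℕ}
  {Q : ProbabilityMeasure (PO k)} {W : ℕ → Ω → PO k} {strat : (Fin k → ℝ) → Fin S} {n m : ℕ}
  {s : Fin n → Fin S} {F : Set Ω} {t : Fin S} {I : Finset ℕ} {e : Fin m → ℕ}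

lemma HasSampleLaw.map_precomp_cond (h : HasSampleLaw P Q strat W s F)
    (hW : ∀ i, Measurable (W i)) (hFm : MeasurableSet F) (hF : P F ≠ 0)
    (he : ∀ l, ∃ hl : e l < n, s ⟨e l, hl⟩ = t) (hinj : Function.Injective e) :
    (P[|F]).map (fun ω l => W (e l) ω) = Measure.pi fun _ : Fin m => withinLaw Q strat t := by
  have : IsProbabilityMeasure (P[|F]) := cond_isProbabilityMeasure hF
  choose hlt hs using he
  have hinj' : Function.Injective fun l => (⟨e l, hlt l⟩ : Fin n) := fun a b hab =>
    hinj (congrArg Fin.val hab)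
  have hind := (h.iIndepFun_cond hW hFm hF).precomp hinj'
  rw [iIndepFun.map_fun_eq_pi_map (f := fun l => W (e l)) (fun l => (hW (e l)).aemeasurable) hind]
  congr 1
  funext l
  rw [← hs l]
  exact h.map_cond hW hFm hF ⟨e l, hlt l⟩

/-- On an event that does not influence the law of the units given the strata, the second moment of
a weighted sum over units `I` of one stratum, of a transform that depends on other units `e l` of
the stratum, is bounded by the mean squared size of the transform at an independent unit. -/
lemma HasSampleLaw.lintegral_cond_sum_sq_le (h : HasSampleLaw P Q strat W s F)
    (hW : ∀ i, Measurable (W i)) (hFm : MeasurableSet F) (hF : P F ≠ 0)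
    (ht : (Q : Measure (PO k)) (stratum strat t) ≠ 0)
    (hI : ∀ i ∈ I, ∃ hi : i < n, s ⟨i, hi⟩ = t)
    (he : ∀ l, ∃ hl : e l < n, s ⟨e l, hl⟩ = t) (hinj : Function.Injective e)
    (heI : ∀ l, e l ∉ I) {f : (Fin m → PO k) → PO k → ℝ} (hf : Measurable (Function.uncurry f))
    (c : ℕ → ℝ) {κ : ENNReal}
    (hκ : ∀ v, ∫⁻ x, ENNReal.ofReal ((∑ i : I, c i * f v (x i)) ^ 2)
        ∂(Measure.pi fun _ : I => withinLaw Q strat t)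
      ≤ κ * ∫⁻ x, ENNReal.ofReal (f v x ^ 2) ∂(withinLaw Q strat t)) :
    ∫⁻ ω, ENNReal.ofReal ((∑ i ∈ I, c i * f (fun l => W (e l) ω) (W i ω)) ^ 2) ∂(P[|F])
      ≤ κ * ∫⁻ p : (Fin m → PO k) × PO k, ENNReal.ofReal (f p.1 p.2 ^ 2)
          ∂((Measure.pi fun _ : Fin m => withinLaw Q strat t).prod (withinLaw Q strat t)) := by
  have : IsProbabilityMeasure (P[|F]) := cond_isProbabilityMeasure hF
  have : IsProbabilityMeasure (withinLaw Q strat t) := isProbabilityMeasure_withinLaw ht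
  have hV := h.map_precomp_cond hW hFm hF he hinj
  choose hIlt hIs using hI
  choose hlt hs using he
  have hind := h.iIndepFun_cond hW hFm hF
  have hX : iIndepFun (fun i : I => W i) (P[|F]) :=
    hind.precomp (g := fun i : I => (⟨i, hIlt i i.2⟩ : Fin n)) fun a b hab =>
      Subtype.ext (congrArg Fin.val hab)
  have hlaw (i : I) : (P[|F]).map (W i) = withinLaw Q strat t := by
    rw [← hIs i i.2]
    exact h.map_cond hW hFm hF ⟨i, hIlt i i.2⟩
  have hVX : IndepFun (fun ω l => W (e l) ω) (fun ω (i : I) => W i ω) (P[|F]) := by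
    have hd : Disjoint ((Finset.univ : Finset (Fin n)).filter fun i : Fin n => (i : ℕ) ∉ I)
        ((Finset.univ : Finset (Fin n)).filter fun i : Fin n => (i : ℕ) ∈ I) := by
      rw [Finset.disjoint_filter]
      exact fun _ _ h1 h2 => h1 h2
    have h1 := iIndepFun.indepFun_finset _ _ hd hind fun i => hW i
    exact h1.comp
      (φ := fun x l => x ⟨⟨e l, hlt l⟩, Finset.mem_filter.2 ⟨Finset.mem_univ _, heI l⟩⟩)
      (ψ := fun x (i : I) => x ⟨⟨i, hIlt i i.2⟩, Finset.mem_filter.2 ⟨Finset.mem_univ _, i.2⟩⟩)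
      (by fun_prop) (by fun_prop)
  have hmain := lintegral_sum_mul_sq_le (X := fun i : I => W i) (fun i => hW i)
    (measurable_pi_lambda _ fun l => hW (e l)) hX hlaw hVX hf (fun i => c i) hκ
  rw [hV] at hmain
  refine le_trans (le_of_eq ?_) hmain
  refine lintegral_congr fun ω => ?_
  rw [← Finset.sum_coe_sort I]

/-- Markov's inequality for the conditional second moment given `F`; on null sets `F` the bound is
trivial. -/
lemma measure_abs_ge_inter_le {g : Ω → ℝ} (hg : Measurable g) (hFm : MeasurableSet F)
    {K : ENNReal} (h : P F ≠ 0 → ∫⁻ ω, ENNReal.ofReal (g ω ^ 2) ∂(P[|F]) ≤ K) {ε : ℝ}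
    (hε : 0 < ε) :
    P ({ω | ε ≤ |g ω|} ∩ F) ≤ K / ENNReal.ofReal (ε ^ 2) * P F := by
  by_cases hF : P F = 0
  · rw [measure_mono_null Set.inter_subset_right hF]; exact zero_le
  have hε2 : ENNReal.ofReal (ε ^ 2) ≠ 0 := by simp [hε.ne']
  have hsub : {ω | ε ≤ |g ω|} ⊆ {ω | ENNReal.ofReal (ε ^ 2) ≤ ENNReal.ofReal (g ω ^ 2)} := by
    intro ω hω
    refine ENNReal.ofReal_le_ofReal ?_
    rw [← sq_abs (g ω)]
    exact pow_le_pow_left₀ hε.le hω 2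
  have hmark := meas_ge_le_lintegral_div (μ := P[|F]) (f := fun ω => ENNReal.ofReal (g ω ^ 2))
    (by fun_prop) hε2 ENNReal.ofReal_ne_top
  have h1 : P[|F] {ω | ε ≤ |g ω|} ≤ K / ENNReal.ofReal (ε ^ 2) :=
    (measure_mono hsub).trans (hmark.trans (ENNReal.div_le_div_right (h hF) _))
  rw [cond_apply hFm, Set.inter_comm] at h1
  calc P ({ω | ε ≤ |g ω|} ∩ F)
      = (P F)⁻¹ * P ({ω | ε ≤ |g ω|} ∩ F) * P F := by
        rw [mul_comm, ← mul_assoc, ENNReal.mul_inv_cancel hF (measure_ne_top _ _), one_mul]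
    _ ≤ _ := by gcongr

end ConditionalTail

/-! ### Decomposition of the estimation error -/

section Decomposition

variable {Ω : Type*} {k S : ℕ} {Q : ProbabilityMeasure (PO k)} {W : ℕ → Ω → PO k}
  {strat : (Fin k → ℝ) → Fin S} {π : Fin S → ℝ} {A : ℕ → ℕ → Ω → Bool} {n J : ℕ}
  {G : ℕ → Bool → Fin S → Fin J → Ω → Finset ℕ} {pihat : ℕ → Fin S → Ω → ℝ}
  {mhat : RegressionEstimator k}

/-- The error of the regression estimator, trained on the units `v`, at the unit `w`. -/
noncomputable def fitError (Q : ProbabilityMeasure (PO k)) (mhat : RegressionEstimator k) (m : ℕ)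
    (a : Bool) (v : Fin m → PO k) (w : PO k) : ℝ :=
  mhat m a (covariate w) (fun l => (outcome a (v l), covariate (v l))) - condMean Q a (covariate w)

/-- The error of the regression estimator, trained on the units in `Γ`, at the unit `i`. -/
noncomputable def fitErrorOn (Q : ProbabilityMeasure (PO k)) (mhat : RegressionEstimator k)
    (W : ℕ → Ω → PO k) (Γ : Finset ℕ) (a : Bool) (i : ℕ) (ω : Ω) : ℝ :=
  fitError Q mhat Γ.card a (fun l => W (Γ.orderEmbOfFin rfl l) ω) (W i ω)

/-- The `j`-th folds of the two treatment groups of stratum `s`, taken together. -/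
def foldUnits (G : ℕ → Bool → Fin S → Fin J → Ω → Finset ℕ) (n : ℕ) (s : Fin S) (j : Fin J)
    (ω : Ω) : Finset ℕ :=
  G n true s j ω ∪ G n false s j ω

/-- The weight with which the regression error of unit `i` of stratum `s` enters the estimator. -/
noncomputable def foldWeight (A : ℕ → ℕ → Ω → Bool) (pihat : ℕ → Fin S → Ω → ℝ) (n : ℕ) (a : Bool)
    (s : Fin S) (i : ℕ) (ω : Ω) : ℝ :=
  1 - if A n i ω = a then (share (fun t => pihat n t ω) a s)⁻¹ else 0

/-- The effect of the estimated proportion in stratum `s` on the weighting of the residuals of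
treatment status `a`. -/
noncomputable def residualTerm (Q : ProbabilityMeasure (PO k)) (W : ℕ → Ω → PO k)
    (strat : (Fin k → ℝ) → Fin S) (π : Fin S → ℝ) (A : ℕ → ℕ → Ω → Bool)
    (pihat : ℕ → Fin S → Ω → ℝ) (n : ℕ) (a : Bool) (s : Fin S) (ω : Ω) : ℝ :=
  (Real.sqrt n)⁻¹ * ∑ i ∈ group strat W A n a s ω,
    ((share (fun t => pihat n t ω) a s)⁻¹ - (share π a s)⁻¹) * residual Q a (W i ω)

/-- The effect of the estimation of the regression function of treatment status `a` on the `j`-th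
folds of stratum `s`. -/
noncomputable def regressionTerm (Q : ProbabilityMeasure (PO k)) (mhat : RegressionEstimator k)
    (W : ℕ → Ω → PO k) (strat : (Fin k → ℝ) → Fin S) (A : ℕ → ℕ → Ω → Bool)
    (G : ℕ → Bool → Fin S → Fin J → Ω → Finset ℕ) (pihat : ℕ → Fin S → Ω → ℝ) (n : ℕ) (a : Bool)
    (s : Fin S) (j : Fin J) (ω : Ω) : ℝ :=
  (Real.sqrt n)⁻¹ * ∑ i ∈ foldUnits G n s j ω,
    foldWeight A pihat n a s i ω
      * fitErrorOn Q mhat W (group strat W A n a s ω \ G n a s j ω) a i ω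

lemma group_eq_filter (a : Bool) (s : Fin S) (ω : Ω) :
    group strat W A n a s ω = (stratumUnits strat W n s ω).filter fun i => A n i ω = a := by
  ext i
  simp only [mem_group, stratumUnits, Finset.mem_filter, Finset.mem_range]
  tauto

lemma group_subset_stratumUnits (a : Bool) (s : Fin S) (ω : Ω) :
    group strat W A n a s ω ⊆ stratumUnits strat W n s ω := by
  rw [group_eq_filter]
  exact Finset.filter_subset _ _

lemma crossFit_sub_condMean (a : Bool) (i : ℕ) (ω : Ω) :
    crossFit mhat W strat G n i a (covariate (W i ω)) ω - condMean Q a (covariate (W i ω))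
      = fitErrorOn Q mhat W (estimationSet W strat G n a i ω) a i ω := rfl

end Decomposition

section Folds

variable {Ω : Type*} [MeasurableSpace Ω] {P : Measure Ω} {k S : ℕ} {Q : ProbabilityMeasure (PO k)}
  {W : ℕ → Ω → PO k} {strat : (Fin k → ℝ) → Fin S} {π : Fin S → ℝ} {A : ℕ → ℕ → Ω → Bool}
  {n J : ℕ} {U : ℕ → Bool → Fin S → Ω → ℝ} {G : ℕ → Bool → Fin S → Fin J → Ω → Finset ℕ}
  {pihat : ℕ → Fin S → Ω → ℝ} {mhat : RegressionEstimator k}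

lemma IsSampleSplit.subset_group (hG : IsSampleSplit P W strat A U J G) (a : Bool) (s : Fin S)
    (j : Fin J) (ω : Ω) : G n a s j ω ⊆ group strat W A n a s ω := by
  rw [← hG.union]
  exact Finset.subset_biUnion_of_mem (fun j => G n a s j ω) (Finset.mem_univ j)

lemma IsSampleSplit.foldUnits_subset (hG : IsSampleSplit P W strat A U J G) (s : Fin S)
    (j : Fin J) (ω : Ω) : foldUnits G n s j ω ⊆ stratumUnits strat W n s ω :=
  Finset.union_subset
    ((hG.subset_group true s j ω).trans (group_subset_stratumUnits true s ω))
    ((hG.subset_group false s j ω).trans (group_subset_stratumUnits false s ω))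

lemma IsSampleSplit.biUnion_foldUnits (hG : IsSampleSplit P W strat A U J G) (s : Fin S) (ω : Ω) :
    Finset.univ.biUnion (fun j => foldUnits G n s j ω) = stratumUnits strat W n s ω := by
  rw [← group_true_union_group_false (A := A), ← hG.union, ← hG.union]
  ext i
  simp only [foldUnits, Finset.mem_biUnion, Finset.mem_union, Finset.mem_univ, true_and]
  exact exists_or

lemma IsSampleSplit.mem_fold_iff (hG : IsSampleSplit P W strat A U J G) {a : Bool} {s : Fin S}
    {j : Fin J} {ω : Ω} {i : ℕ} :
    i ∈ G n a s j ω ↔ i ∈ foldUnits G n s j ω ∧ A n i ω = a := by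
  have h (b : Bool) (hi : i ∈ G n b s j ω) : A n i ω = b :=
    (mem_group.1 (hG.subset_group b s j ω hi)).2.1
  simp only [foldUnits, Finset.mem_union]
  constructor
  · intro hi
    refine ⟨?_, h a hi⟩
    cases a
    · exact Or.inr hi
    · exact Or.inl hi
  · rintro ⟨hi | hi, rfl⟩
    · rwa [h true hi]
    · rwa [h false hi]

lemma IsSampleSplit.disjoint_foldUnits (hG : IsSampleSplit P W strat A U J G) (s : Fin S)
    {j j' : Fin J} (hj : j ≠ j') (ω : Ω) :
    Disjoint (foldUnits G n s j ω) (foldUnits G n s j' ω) := by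
  rw [Finset.disjoint_left]
  intro i h1 h2
  exact Finset.disjoint_left.1 (hG.disjoint n (A n i ω) s ω hj)
    (hG.mem_fold_iff.2 ⟨h1, rfl⟩) (hG.mem_fold_iff.2 ⟨h2, rfl⟩)

/-- The estimation set of a unit consists of the group without the fold of the unit. -/
lemma IsSampleSplit.estimationSet_eq (hG : IsSampleSplit P W strat A U J G) (a : Bool) {s : Fin S}
    {j : Fin J} {ω : Ω} {i : ℕ} (hi : i ∈ foldUnits G n s j ω) :
    estimationSet W strat G n a i ω = group strat W A n a s ω \ G n a s j ω := by
  have hl : label strat W i ω = s := (Finset.mem_filter.1 (hG.foldUnits_subset s j ω hi)).2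
  have hmem (j' : Fin J) : i ∉ G n true s j' ω ∪ G n false s j' ω ↔ j' ≠ j := by
    change i ∉ foldUnits G n s j' ω ↔ j' ≠ j
    constructor
    · rintro h rfl
      exact h hi
    · exact fun hj h => Finset.disjoint_left.1 (hG.disjoint_foldUnits s hj ω) h hi
  ext l
  simp only [estimationSet, hl, hmem, Finset.mem_biUnion, Finset.mem_filter, Finset.mem_univ,
    true_and, Finset.mem_sdiff, ← hG.union n a s ω]
  constructor
  · rintro ⟨j', hj', h⟩
    exact ⟨⟨j', h⟩, fun h' => Finset.disjoint_left.1 (hG.disjoint n a s ω hj') h h'⟩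
  · rintro ⟨⟨j', h⟩, h'⟩
    exact ⟨j', fun hj => h' (hj ▸ h), h⟩

/-- The difference of the summands of the feasible and the infeasible estimator. -/
lemma summand_sub_summand (a : Bool) (y₀ y₁ m₀ m₁ h₀ h₁ p r : ℝ) :
    toReal a * ((y₁ * toReal a + y₀ * (1 - toReal a)) - h₁) / r
        - (1 - toReal a) * ((y₁ * toReal a + y₀ * (1 - toReal a)) - h₀) / (1 - r) + (h₁ - h₀)
      - (toReal a * ((y₁ * toReal a + y₀ * (1 - toReal a)) - m₁) / p
        - (1 - toReal a) * ((y₁ * toReal a + y₀ * (1 - toReal a)) - m₀) / (1 - p) + m₁ - m₀)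
      = ((if a = true then (r⁻¹ - p⁻¹) * (y₁ - m₁) else 0)
          + (1 - if a = true then r⁻¹ else 0) * (h₁ - m₁))
        - ((if a = false then ((1 - r)⁻¹ - (1 - p)⁻¹) * (y₀ - m₀) else 0)
          + (1 - if a = false then (1 - r)⁻¹ else 0) * (h₀ - m₀)) := by
  cases a <;> simp [toReal, div_eq_mul_inv] <;> ring

/-- The difference of the feasible and the infeasible estimator, arm by arm, stratum by stratum and
fold by fold. -/
lemma IsSampleSplit.sqrt_mul_feasible_sub (hG : IsSampleSplit P W strat A U J G) (ω : Ω) :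
    Real.sqrt n * (feasible mhat W strat A G pihat n ω - ate Q)
        - Real.sqrt n * (infeasible Q W strat π A n ω - ate Q)
      = ∑ a, armSign a * ∑ s, (residualTerm Q W strat π A pihat n a s ω
          + ∑ j, regressionTerm Q mhat W strat A G pihat n a s j ω) := by
  -- the contribution of unit `i` to the difference in arm `a`
  set D : Bool → ℕ → ℝ := fun a i =>
    (if A n i ω = a then ((share (fun t => pihat n t ω) a (label strat W i ω))⁻¹
        - (share π a (label strat W i ω))⁻¹) * residual Q a (W i ω) else 0)
      + foldWeight A pihat n a (label strat W i ω) i ω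
        * fitErrorOn Q mhat W (estimationSet W strat G n a i ω) a i ω with hD
  have harm (a : Bool) : (Real.sqrt n)⁻¹ * ∑ i ∈ Finset.range n, D a i
      = ∑ s, (residualTerm Q W strat π A pihat n a s ω
          + ∑ j, regressionTerm Q mhat W strat A G pihat n a s j ω) := by
    rw [← Finset.sum_fiberwise (Finset.range n) (fun i => label strat W i ω), Finset.mul_sum]
    refine Finset.sum_congr rfl fun s _ => ?_
    change (Real.sqrt n)⁻¹ * ∑ i ∈ stratumUnits strat W n s ω, D a i = _
    have hlab (i : ℕ) (hi : i ∈ stratumUnits strat W n s ω) : label strat W i ω = s :=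
      (Finset.mem_filter.1 hi).2
    simp_rw [hD, residualTerm, regressionTerm]
    rw [Finset.sum_add_distrib, mul_add]
    congr 1
    · rw [group_eq_filter, Finset.sum_filter]
      congr 1
      refine Finset.sum_congr rfl fun i hi => ?_
      rw [hlab i hi]
    · rw [← Finset.mul_sum, ← hG.biUnion_foldUnits, Finset.sum_biUnion fun j _ j' _ hj =>
        hG.disjoint_foldUnits s hj ω]
      congr 1
      refine Finset.sum_congr rfl fun j _ => Finset.sum_congr rfl fun i hi => ?_
      rw [hlab i (hG.foldUnits_subset s j ω hi), hG.estimationSet_eq a hi]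
  have hsqrt : Real.sqrt n * (1 / n) = (Real.sqrt n)⁻¹ := by
    rw [mul_one_div, Real.sqrt_div_self', one_div]
  simp_rw [Fintype.sum_bool, ← harm]
  have hdiff : feasible mhat W strat A G pihat n ω - infeasible Q W strat π A n ω
      = (1 / n) * ∑ i ∈ Finset.range n, (D true i - D false i) := by
    rw [feasible, infeasible, ← mul_sub, ← mul_add, ← mul_sub, ← Finset.sum_sub_distrib,
      ← Finset.sum_add_distrib, ← Finset.sum_sub_distrib]
    congr 1
    refine Finset.sum_congr rfl fun i _ => ?_
    simp only [hD, obs, foldWeight, share, ← crossFit_sub_condMean, residual, if_true,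
      Bool.false_eq_true, if_false]
    exact summand_sub_summand _ _ _ _ _ _ _ _ _
  rw [← mul_sub, sub_sub_sub_cancel_right, hdiff, ← mul_assoc, hsqrt, Finset.sum_sub_distrib]
  simp [armSign]
  ring

end Folds

/-! ### Sample configurations with balanced strata -/

section Balance

variable {Ω : Type*} {k S : ℕ} {W : ℕ → Ω → PO k} {strat : (Fin k → ℝ) → Fin S} {π : Fin S → ℝ}
  {A : ℕ → ℕ → Ω → Bool} {n : ℕ} {pihat : ℕ → Fin S → Ω → ℝ}

lemma abs_share_sub_share (x y : Fin S → ℝ) (a : Bool) (s : Fin S) :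
    |share x a s - share y a s| = |x s - y s| := by
  cases a
  · simp only [share, Bool.false_eq_true, if_false, sub_sub_sub_cancel_left]
    exact abs_sub_comm _ _
  · simp [share]

lemma card_group_eq_share_mul (a : Bool) (s : Fin S) (ω : Ω) :
    ((group strat W A n a s ω).card : ℝ)
      = share (fun t => treatedProportion strat W A n t ω) a s
        * (stratumUnits strat W n s ω).card := by
  have h1 := treatedProportion_mul (strat := strat) (W := W) (A := A) (n := n) s ω
  have h2 := card_group_add_card_group (strat := strat) (W := W) (A := A) (n := n) s ω
  cases a
  · have h3 : ((group strat W A n true s ω).card : ℝ) + (group strat W A n false s ω).card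
        = (stratumUnits strat W n s ω).card := by exact_mod_cast h2
    simp only [share, Bool.false_eq_true, if_false]
    linarith
  · simp [share, h1]

/-- The event that the treated proportion of stratum `s` differs from its target by at most `M / √n`
and by at most half the distance of the target from 0 and 1, and that the stratum has at least half
its expected size. -/
def balanceEvent (Q : ProbabilityMeasure (PO k)) (W : ℕ → Ω → PO k) (strat : (Fin k → ℝ) → Fin S)
    (π : Fin S → ℝ) (A : ℕ → ℕ → Ω → Bool) (n : ℕ) (s : Fin S) (M : ℝ) : Set Ω :=
  {ω | |treatedProportion strat W A n s ω - π s| < min (π s) (1 - π s) / 2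
    ∧ Real.sqrt n * |treatedProportion strat W A n s ω - π s| ≤ M
    ∧ (Q : Measure (PO k)).real (stratum strat s) / 2 * n ≤ (stratumUnits strat W n s ω).card}

/-- The estimated proportions are the targets or the treated proportions, stratum by stratum. -/
def IsProportionChoice (W : ℕ → Ω → PO k) (strat : (Fin k → ℝ) → Fin S) (π : Fin S → ℝ)
    (A : ℕ → ℕ → Ω → Bool) (pihat : ℕ → Fin S → Ω → ℝ) : Prop :=
  ∀ s, (∀ n ω, pihat n s ω = π s) ∨ (∀ n ω, pihat n s ω = treatedProportion strat W A n s ω)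

variable {Q : ProbabilityMeasure (PO k)} {s : Fin S} {M : ℝ} {ω : Ω}

lemma share_treatedProportion_ge (h : ω ∈ balanceEvent Q W strat π A n s M) (a : Bool) :
    share π a s / 2 ≤ share (fun t => treatedProportion strat W A n t ω) a s := by
  have h1 := abs_lt.1 h.1
  have h2 := min_le_left (π s) (1 - π s)
  have h3 := min_le_right (π s) (1 - π s)
  cases a <;> simp only [share, Bool.false_eq_true, if_false, if_true] <;> linarith

lemma IsProportionChoice.share_ge (hp : IsProportionChoice W strat π A pihat)
    (hπ : ∀ s, π s ∈ Set.Ioo (0 : ℝ) 1) (h : ω ∈ balanceEvent Q W strat π A n s M) (a : Bool) :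
    share π a s / 2 ≤ share (fun t => pihat n t ω) a s := by
  have h0 := share_pos hπ a s
  rcases hp s with hp | hp
  · have : share (fun t => pihat n t ω) a s = share π a s := by simp only [share, hp]
    rw [this]; linarith
  · have : share (fun t => pihat n t ω) a s
        = share (fun t => treatedProportion strat W A n t ω) a s := by simp only [share, hp]
    rw [this]
    exact share_treatedProportion_ge h a

lemma IsProportionChoice.sqrt_mul_abs_sub_le (hp : IsProportionChoice W strat π A pihat)
    (h : ω ∈ balanceEvent Q W strat π A n s M) (a : Bool) :
    Real.sqrt n * |share (fun t => pihat n t ω) a s - share π a s| ≤ M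
    ∧ Real.sqrt n * |share (fun t => pihat n t ω) a s
        - share (fun t => treatedProportion strat W A n t ω) a s| ≤ M := by
  simp_rw [abs_share_sub_share]
  have h0 : 0 ≤ M := le_trans (by positivity) h.2.1
  -- whichever choice is made, one of the two differences vanishes
  rcases hp s with hp | hp
  · simp only [hp, sub_self, abs_zero, mul_zero]
    rw [abs_sub_comm]
    exact ⟨h0, h.2.1⟩
  · simp only [hp, sub_self, abs_zero, mul_zero]
    exact ⟨h.2.1, h0⟩

lemma IsProportionChoice.abs_foldWeight_le (hp : IsProportionChoice W strat π A pihat)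
    (hπ : ∀ s, π s ∈ Set.Ioo (0 : ℝ) 1) (h : ω ∈ balanceEvent Q W strat π A n s M) (a : Bool)
    (i : ℕ) : |foldWeight A pihat n a s i ω| ≤ 1 + 2 / share π a s := by
  have hρ := share_pos hπ a s
  have hr := hp.share_ge hπ h a
  have hr0 : 0 < share (fun t => pihat n t ω) a s := by linarith
  have hinv : (share (fun t => pihat n t ω) a s)⁻¹ ≤ 2 / share π a s := by
    rw [inv_le_comm₀ hr0 (by positivity), inv_div]; exact hr
  have hinv0 : 0 ≤ (share (fun t => pihat n t ω) a s)⁻¹ := by positivity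
  rw [foldWeight, abs_le]
  split_ifs <;> constructor <;> linarith

lemma IsProportionChoice.sum_sq_weight_le (hp : IsProportionChoice W strat π A pihat)
    (hπ : ∀ s, π s ∈ Set.Ioo (0 : ℝ) 1) (hn : 0 < n)
    (h : ω ∈ balanceEvent Q W strat π A n s M) (a : Bool) :
    ∑ _i ∈ group strat W A n a s ω, ((Real.sqrt n)⁻¹
        * ((share (fun t => pihat n t ω) a s)⁻¹ - (share π a s)⁻¹)) ^ 2
      ≤ (2 * M / share π a s ^ 2) ^ 2 / n := by
  have hn' : (0 : ℝ) < n := by exact_mod_cast hn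
  have hsn : 0 < Real.sqrt n := Real.sqrt_pos.2 hn'
  have hρ := share_pos hπ a s
  have hr := hp.share_ge hπ h a
  have hd := (hp.sqrt_mul_abs_sub_le h a).1
  set ρ := share π a s
  set r := share (fun t => pihat n t ω) a s
  have hr0 : 0 < r := by linarith
  have hw : |r⁻¹ - ρ⁻¹| ≤ 2 * M / ρ ^ 2 * (Real.sqrt n)⁻¹ := by
    have h1 : |r - ρ| ≤ M * (Real.sqrt n)⁻¹ := by
      rw [← div_eq_mul_inv, le_div_iff₀ hsn, mul_comm]; exact hd
    rw [inv_sub_inv hr0.ne' hρ.ne', abs_div, abs_sub_comm, abs_of_pos (mul_pos hr0 hρ)]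
    calc |r - ρ| / (r * ρ) ≤ (M * (Real.sqrt n)⁻¹) / (ρ / 2 * ρ) := by
          have hM : 0 ≤ M := le_trans (by positivity) h.2.1
          gcongr
      _ = _ := by field_simp
  have hsq : ((Real.sqrt n)⁻¹) ^ 2 = (n : ℝ)⁻¹ := by rw [inv_pow, Real.sq_sqrt hn'.le]
  have hcard : ((group strat W A n a s ω).card : ℝ) ≤ n := by
    exact_mod_cast (Finset.card_le_card (group_subset_stratumUnits a s ω)).trans
      (card_stratumUnits_le s ω)
  rw [Finset.sum_const, nsmul_eq_mul, mul_pow, hsq, ← sq_abs (r⁻¹ - ρ⁻¹)]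
  calc ((group strat W A n a s ω).card : ℝ) * ((n : ℝ)⁻¹ * |r⁻¹ - ρ⁻¹| ^ 2)
      ≤ n * ((n : ℝ)⁻¹ * (2 * M / ρ ^ 2 * (Real.sqrt n)⁻¹) ^ 2) := by gcongr
    _ = (2 * M / ρ ^ 2) ^ 2 / n := by
        rw [mul_pow, hsq]; field_simp

/-- Balanced configurations have probability close to 1. -/
lemma exists_measure_compl_balanceEvent_le [MeasurableSpace Ω] {P : Measure Ω}
    {α : (n : ℕ) → (Fin n → Bool) → (Fin n → Fin S) → ℝ}
    (hW : IsIIDSample P Q W) (hstrat : Measurable strat)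
    (hπ : ∀ s, π s ∈ Set.Ioo (0 : ℝ) 1) (hA : IsCARAssignment P Q W strat π α A)
    (hbal : WeakBalance P Q W strat π A)
    (hs : (Q : Measure (PO k)) (stratum strat s) ≠ 0) {δ : ENNReal} (hδ : 0 < δ) :
    ∃ M : ℝ, ∀ᶠ n in atTop, P (balanceEvent Q W strat π A n s M)ᶜ ≤ δ := by
  have := hW.isProbabilityMeasure
  have hδ3 : 0 < δ / 3 := ENNReal.div_pos hδ.ne' (by norm_num)
  obtain ⟨M, hM⟩ := hbal s hs (δ / 3) hδ3
  have hr : 0 < min (π s) (1 - π s) / 2 := by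
    have := (hπ s).1
    have := sub_pos.2 (hπ s).2
    positivity
  have hp : 0 < (Q : Measure (PO k)).real (stratum strat s) :=
    ENNReal.toReal_pos hs (measure_ne_top _ _)
  have h1 := ENNReal.tendsto_nhds_zero.1
    (tendstoInMeasure_iff_norm.1 (hA.proportion s hs) _ hr) (δ / 3) hδ3
  have hsize : TendstoInMeasure P
      (fun (n : ℕ) ω => ((stratumUnits strat W n s ω).card : ℝ) / n) atTop
      (fun _ => (Q : Measure (PO k)).real (stratum strat s)) := by
    refine tendstoInMeasure_of_tendsto_ae (fun n => ?_) (ae_tendsto_card_stratumUnits hW hstrat s)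
    refine Measurable.aestronglyMeasurable (Measurable.div_const ?_ _)
    exact measurable_of_fibers (fun d =>
      measurable_labels hstrat hW.measurable (measurableSet_singleton d)) fun ω ω' h => by
        have : stratumUnits strat W n s ω = stratumUnits strat W n s ω' :=
          Finset.filter_congr fun i hi => by
            have := congrFun h ⟨i, Finset.mem_range.1 hi⟩
            simp only [labels] at this
            rw [this]
        rw [this]
  have h2 := ENNReal.tendsto_nhds_zero.1
    (tendstoInMeasure_iff_norm.1 hsize _ (half_pos hp)) (δ / 3) hδ3
  refine ⟨M, ?_⟩
  filter_upwards [hM, h1, h2, eventually_gt_atTop 0] with n hn hn1 hn2 hn0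
  refine (measure_mono (?_ : _ ⊆ ({ω | min (π s) (1 - π s) / 2
        ≤ ‖treatedProportion strat W A n s ω - π s‖}
      ∪ {ω | M < |(Real.sqrt n * |treatedProportion strat W A n s ω - π s|)|})
      ∪ {ω | (Q : Measure (PO k)).real (stratum strat s) / 2
        ≤ ‖((stratumUnits strat W n s ω).card : ℝ) / n
          - (Q : Measure (PO k)).real (stratum strat s)‖})).trans ?_
  · intro ω hω
    by_contra hcon
    simp only [Set.mem_union, Set.mem_ofPred_eq, not_or, not_le, not_lt, Real.norm_eq_abs] at hcon
    obtain ⟨⟨g1, g2⟩, g3⟩ := hcon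
    refine hω ⟨g1, (le_abs_self _).trans g2, ?_⟩
    have hn' : (0 : ℝ) < n := by exact_mod_cast hn0
    have g4 := (abs_lt.1 g3).1
    rw [← le_div_iff₀ hn']
    linarith
  · refine (measure_union_le _ _).trans ((add_le_add_left (measure_union_le _ _) _).trans ?_)
    calc _ ≤ δ / 3 + δ / 3 + δ / 3 := by gcongr
      _ = δ := ENNReal.add_thirds δ

end Balance

section FoldSizes

variable {Ω : Type*} [MeasurableSpace Ω] {P : Measure Ω} {k S : ℕ} {Q : ProbabilityMeasure (PO k)}
  {W : ℕ → Ω → PO k} {strat : (Fin k → ℝ) → Fin S} {π : Fin S → ℝ} {A : ℕ → ℕ → Ω → Bool}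
  {n J : ℕ} {U : ℕ → Bool → Fin S → Ω → ℝ} {G : ℕ → Bool → Fin S → Fin J → Ω → Finset ℕ}
  {pihat : ℕ → Fin S → Ω → ℝ} {s : Fin S} {M : ℝ} {ω : Ω}

lemma IsSampleSplit.abs_card_fold_sub_le (hG : IsSampleSplit P W strat A U J G) (a : Bool)
    (s : Fin S) (j : Fin J) (ω : Ω) :
    |((G n a s j ω).card : ℝ) - (group strat W A n a s ω).card / J| ≤ J := by
  have hJ : 0 < J := j.pos
  have hJ1 : (1 : ℝ) ≤ J := by exact_mod_cast hJ
  obtain ⟨N, hN⟩ : ∃ N, (group strat W A n a s ω).card = N := ⟨_, rfl⟩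
  have hdiv : (N : ℝ) = J * (N / J : ℕ) + (N % J : ℕ) := by
    exact_mod_cast (Nat.div_add_mod N J).symm
  have hmod : ((N % J : ℕ) : ℝ) ≤ J := by exact_mod_cast (Nat.mod_lt N hJ).le
  have hmod0 : (0 : ℝ) ≤ (N % J : ℕ) := by positivity
  have hquot : (N : ℝ) / J = (N / J : ℕ) + (N % J : ℕ) / J := by
    rw [div_eq_iff (by positivity), hdiv]; field_simp
  have hfrac : ((N % J : ℕ) : ℝ) / J ≤ 1 := by rw [div_le_one (by positivity)]; exact hmod
  have hfrac0 : 0 ≤ ((N % J : ℕ) : ℝ) / J := by positivity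
  rcases Nat.lt_or_ge ((j : ℕ) + 1) J with hj | hj
  · have h := hG.card_fold n a s ω j hj
    rw [hN] at h ⊢
    rw [h, hquot, abs_le]
    constructor <;> linarith
  · have h := hG.card_last n a s ω j (le_antisymm j.isLt hj)
    have h' : N - (J - 1) * (N / J) = N / J + N % J := by
      have h1 := Nat.div_add_mod N J
      obtain ⟨J', rfl⟩ : ∃ J', J = J' + 1 := ⟨J - 1, by omega⟩
      rw [Nat.add_mul, one_mul] at h1
      rw [Nat.add_sub_cancel]
      exact Nat.sub_eq_of_eq_add (by linarith)
    rw [hN] at h ⊢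
    rw [h, h', hquot, abs_le]
    push_cast
    constructor <;> linarith

/-- At least half of a group, up to rounding, is available for training. -/
lemma IsSampleSplit.card_group_sdiff_fold_ge (hG : IsSampleSplit P W strat A U J G) (hJ : 2 ≤ J)
    (a : Bool) (s : Fin S) (j : Fin J) (ω : Ω) :
    ((group strat W A n a s ω).card : ℝ) / 2 - J
      ≤ (group strat W A n a s ω \ G n a s j ω).card := by
  have h1 := hG.abs_card_fold_sub_le (n := n) a s j ω
  have h2 := Finset.card_sdiff_add_card_eq_card (hG.subset_group (n := n) a s j ω)
  have h3 : ((group strat W A n a s ω \ G n a s j ω).card : ℝ) + (G n a s j ω).card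
      = (group strat W A n a s ω).card := by exact_mod_cast h2
  have h4 : ((group strat W A n a s ω).card : ℝ) / J ≤ (group strat W A n a s ω).card / 2 := by
    gcongr
    exact_mod_cast hJ
  have h5 := (abs_le.1 h1).2
  linarith

lemma IsSampleSplit.card_foldUnits (hG : IsSampleSplit P W strat A U J G) (s : Fin S) (j : Fin J)
    (ω : Ω) : (foldUnits G n s j ω).card = (G n true s j ω).card + (G n false s j ω).card :=
  Finset.card_union_of_disjoint (((disjoint_group (by simp) s s ω).mono_left
    (hG.subset_group true s j ω)).mono_right (hG.subset_group false s j ω))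

lemma IsSampleSplit.filter_foldUnits (hG : IsSampleSplit P W strat A U J G) (a : Bool) (s : Fin S)
    (j : Fin J) (ω : Ω) :
    (foldUnits G n s j ω).filter (fun i => A n i ω = a) = G n a s j ω := by
  ext i
  rw [Finset.mem_filter, hG.mem_fold_iff]

/-- The weights of the regression errors in a fold nearly cancel: with `N` units in the stratum, of
which the folds hold a `1 / J` part up to rounding, the sum of the weights is
`(N / J) (1 - q / ρ)`, up to bounded terms, where `q` is the actual and `ρ` the estimated share. -/
lemma IsSampleSplit.abs_sum_foldWeight_le (hG : IsSampleSplit P W strat A U J G)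
    (hp : IsProportionChoice W strat π A pihat) (hπ : ∀ s, π s ∈ Set.Ioo (0 : ℝ) 1)
    (hn : 0 < n) (h : ω ∈ balanceEvent Q W strat π A n s M) (a : Bool) (j : Fin J) :
    |∑ i ∈ foldUnits G n s j ω, foldWeight A pihat n a s i ω|
      ≤ (2 * M / share π a s + 2 * J + 2 * J / share π a s) * Real.sqrt n := by
  have hρ := share_pos hπ a s
  set ρ := share π a s
  have hr := hp.share_ge hπ h a
  have hd := (hp.sqrt_mul_abs_sub_le h a).2
  have hq := card_group_eq_share_mul (strat := strat) (W := W) (A := A) (n := n) a s ω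
  set r := share (fun t => pihat n t ω) a s with hr_def
  set q := share (fun t => treatedProportion strat W A n t ω) a s
  have hr0 : 0 < r := by linarith
  have hJ1 : (1 : ℝ) ≤ J := by exact_mod_cast j.pos
  have hn1 : (1 : ℝ) ≤ Real.sqrt n := by
    rw [Real.one_le_sqrt]; exact_mod_cast hn
  have hM : 0 ≤ M := le_trans (by positivity) h.2.1
  have hsum : ∑ i ∈ foldUnits G n s j ω, foldWeight A pihat n a s i ω
      = (G n true s j ω).card + (G n false s j ω).card - (G n a s j ω).card * r⁻¹ := by
    simp_rw [foldWeight, ← hr_def]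
    rw [Finset.sum_sub_distrib, ← Finset.sum_filter, hG.filter_foldUnits, Finset.sum_const,
      Finset.sum_const, hG.card_foldUnits]
    simp
  have hN : ((group strat W A n true s ω).card : ℝ) + (group strat W A n false s ω).card
      = (stratumUnits strat W n s ω).card := by exact_mod_cast card_group_add_card_group s ω
  have hNn : ((stratumUnits strat W n s ω).card : ℝ) ≤ n := by
    exact_mod_cast card_stratumUnits_le s ω
  have ht := hG.abs_card_fold_sub_le (n := n) true s j ω
  have hf := hG.abs_card_fold_sub_le (n := n) false s j ω
  have ha := hG.abs_card_fold_sub_le (n := n) a s j ω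
  set N : ℝ := ((stratumUnits strat W n s ω).card : ℝ) with hN_def
  have hN0 : 0 ≤ N := by positivity
  -- rounding errors apart, the sum is `(N / J) (r - q) / r`
  have hsplit : ((G n true s j ω).card : ℝ) + (G n false s j ω).card - (G n a s j ω).card * r⁻¹
      = N / J * ((r - q) * r⁻¹)
        + ((G n true s j ω).card - (group strat W A n true s ω).card / (J : ℝ))
        + ((G n false s j ω).card - (group strat W A n false s ω).card / (J : ℝ))
        - ((G n a s j ω).card - (group strat W A n a s ω).card / (J : ℝ)) * r⁻¹ := by
    rw [hq, ← hN]
    field_simp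
    ring
  have hinv : r⁻¹ ≤ 2 / ρ := by
    rw [inv_le_comm₀ hr0 (by positivity), inv_div]; exact hr
  have hmain : |N / J * ((r - q) * r⁻¹)| ≤ 2 * M / ρ * Real.sqrt n := by
    rw [abs_mul, abs_mul, abs_of_nonneg (by positivity : 0 ≤ N / J),
      abs_of_nonneg (by positivity : 0 ≤ r⁻¹)]
    have h1 : N / J ≤ Real.sqrt n * Real.sqrt n := by
      rw [Real.mul_self_sqrt (by positivity)]
      exact (div_le_self hN0 hJ1).trans hNn
    calc N / J * (|r - q| * r⁻¹)
        ≤ Real.sqrt n * Real.sqrt n * (|r - q| * (2 / ρ)) := by gcongr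
      _ = (Real.sqrt n * |r - q|) * (2 / ρ) * Real.sqrt n := by ring
      _ ≤ M * (2 / ρ) * Real.sqrt n := by gcongr
      _ = 2 * M / ρ * Real.sqrt n := by ring
  have hround : |((G n a s j ω).card - (group strat W A n a s ω).card / (J : ℝ)) * r⁻¹|
      ≤ 2 * J / ρ * Real.sqrt n := by
    rw [abs_mul, abs_of_nonneg (by positivity : 0 ≤ r⁻¹)]
    calc _ ≤ (J : ℝ) * (2 / ρ) := by gcongr
      _ = 2 * J / ρ * 1 := by ring
      _ ≤ _ := by gcongr
  have hJn : (J : ℝ) ≤ J * Real.sqrt n := le_mul_of_one_le_right (by positivity) hn1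
  rw [hsum, hsplit]
  rw [abs_le] at hmain hround ht hf ⊢
  constructor <;> linarith [hmain.1, hmain.2, hround.1, hround.2, ht.1, ht.2, hf.1, hf.2]

/-- The square of the weights that the regression errors of a fold have in the normalized
estimation error. -/
lemma IsSampleSplit.sum_sq_foldWeight_le (hG : IsSampleSplit P W strat A U J G)
    (hp : IsProportionChoice W strat π A pihat) (hπ : ∀ s, π s ∈ Set.Ioo (0 : ℝ) 1)
    (hn : 0 < n) (h : ω ∈ balanceEvent Q W strat π A n s M) (a : Bool) (j : Fin J) :
    ∑ i ∈ foldUnits G n s j ω, ((Real.sqrt n)⁻¹ * foldWeight A pihat n a s i ω) ^ 2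
        + (∑ i ∈ foldUnits G n s j ω, (Real.sqrt n)⁻¹ * foldWeight A pihat n a s i ω) ^ 2
      ≤ (1 + 2 / share π a s) ^ 2
        + (2 * M / share π a s + 2 * J + 2 * J / share π a s) ^ 2 := by
  have hn' : (0 : ℝ) < n := by exact_mod_cast hn
  have hsq : ((Real.sqrt n)⁻¹) ^ 2 = (n : ℝ)⁻¹ := by rw [inv_pow, Real.sq_sqrt hn'.le]
  have hsn : 0 < Real.sqrt n := Real.sqrt_pos.2 hn'
  gcongr ?_ + ?_
  · calc ∑ i ∈ foldUnits G n s j ω, ((Real.sqrt n)⁻¹ * foldWeight A pihat n a s i ω) ^ 2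
        ≤ ∑ i ∈ foldUnits G n s j ω, (n : ℝ)⁻¹ * (1 + 2 / share π a s) ^ 2 := by
          refine Finset.sum_le_sum fun i _ => ?_
          rw [mul_pow, hsq, ← sq_abs (foldWeight A pihat n a s i ω)]
          gcongr
          exact hp.abs_foldWeight_le hπ h a i
      _ = (foldUnits G n s j ω).card * (n : ℝ)⁻¹ * (1 + 2 / share π a s) ^ 2 := by
          rw [Finset.sum_const, nsmul_eq_mul, mul_assoc]
      _ ≤ 1 * (1 + 2 / share π a s) ^ 2 := by
          gcongr
          rw [← div_eq_mul_inv, div_le_one hn']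
          exact_mod_cast (Finset.card_le_card (hG.foldUnits_subset s j ω)).trans
            (card_stratumUnits_le s ω)
      _ = _ := one_mul _
  · rw [← Finset.mul_sum, ← sq_abs, abs_mul, abs_of_pos (inv_pos.2 hsn)]
    have hb := hG.abs_sum_foldWeight_le hp hπ hn h a j
    have h1 : (Real.sqrt n)⁻¹ * |∑ i ∈ foldUnits G n s j ω, foldWeight A pihat n a s i ω|
        ≤ 2 * M / share π a s + 2 * J + 2 * J / share π a s := by
      rw [inv_mul_le_iff₀ hsn, mul_comm]
      exact hb
    gcongr

end FoldSizes

/-! ### The estimation error is negligible -/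

section ConfigurationInvariance

variable {Ω : Type*} {k S : ℕ} {Q : ProbabilityMeasure (PO k)}
  {W : ℕ → Ω → PO k} {strat : (Fin k → ℝ) → Fin S} {π : Fin S → ℝ} {A : ℕ → ℕ → Ω → Bool}
  {n J : ℕ} {G : ℕ → Bool → Fin S → Fin J → Ω → Finset ℕ}
  {pihat : ℕ → Fin S → Ω → ℝ} {mhat : RegressionEstimator k} {ω ω₀ : Ω}

lemma treatedProportion_eq_of_profile_eq (hl : labels strat W n ω = labels strat W n ω₀)
    (ha : assignment A n ω = assignment A n ω₀) (s : Fin S) :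
    treatedProportion strat W A n s ω = treatedProportion strat W A n s ω₀ := by
  simp_rw [treatedProportion, ← group_true_union_group_false (A := A),
    group_eq_of_profile_eq hl ha]

lemma IsProportionChoice.eq_of_profile_eq (hp : IsProportionChoice W strat π A pihat)
    (hl : labels strat W n ω = labels strat W n ω₀)
    (ha : assignment A n ω = assignment A n ω₀) (s : Fin S) : pihat n s ω = pihat n s ω₀ := by
  rcases hp s with h | h
  · rw [h, h]
  · rw [h, h, treatedProportion_eq_of_profile_eq hl ha]

lemma residualTerm_eq_of_config_eq (hp : IsProportionChoice W strat π A pihat)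
    (h : config strat W A G n ω = config strat W A G n ω₀) (a : Bool) (s : Fin S) :
    residualTerm Q W strat π A pihat n a s ω
      = ∑ i ∈ group strat W A n a s ω₀, ((Real.sqrt n)⁻¹
          * ((share (fun t => pihat n t ω₀) a s)⁻¹ - (share π a s)⁻¹)) * residual Q a (W i ω) := by
  simp only [config, Prod.mk.injEq] at h
  simp_rw [residualTerm, group_eq_of_profile_eq h.1 h.2.1, Finset.mul_sum, mul_assoc, share,
    hp.eq_of_profile_eq h.1 h.2.1]

lemma regressionTerm_eq_of_config_eq (hp : IsProportionChoice W strat π A pihat)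
    (h : config strat W A G n ω = config strat W A G n ω₀) (a : Bool) (s : Fin S) (j : Fin J)
    (hsub : foldUnits G n s j ω₀ ⊆ Finset.range n) :
    regressionTerm Q mhat W strat A G pihat n a s j ω
      = ∑ i ∈ foldUnits G n s j ω₀, ((Real.sqrt n)⁻¹ * foldWeight A pihat n a s i ω₀)
          * fitErrorOn Q mhat W (group strat W A n a s ω₀ \ G n a s j ω₀) a i ω := by
  simp only [config, Prod.mk.injEq] at h
  have hfold (b : Bool) : G n b s j ω = G n b s j ω₀ :=
    congrFun (congrFun (congrFun h.2.2 b) s) j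
  simp_rw [regressionTerm, foldUnits, hfold, group_eq_of_profile_eq h.1 h.2.1, Finset.mul_sum,
    mul_assoc]
  refine Finset.sum_congr rfl fun i hi => ?_
  have hAi : A n i ω = A n i ω₀ := congrFun h.2.1 ⟨i, Finset.mem_range.1 (hsub hi)⟩
  simp_rw [foldWeight, hAi, share, hp.eq_of_profile_eq h.1 h.2.1]

end ConfigurationInvariance

section MeanSquaredError

variable {k S : ℕ} {Q : ProbabilityMeasure (PO k)} {strat : (Fin k → ℝ) → Fin S} {a : Bool}
  {s : Fin S} {mhat : RegressionEstimator k}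

/-- The mean squared error of the regression estimator trained on `m` units of stratum `s`, at
another unit of the stratum. -/
noncomputable def regressionMSE (Q : ProbabilityMeasure (PO k)) (strat : (Fin k → ℝ) → Fin S)
    (mhat : RegressionEstimator k) (a : Bool) (s : Fin S) (m : ℕ) : ENNReal :=
  ∫⁻ p : (Fin m → PO k) × PO k, ENNReal.ofReal (fitError Q mhat m a p.1 p.2 ^ 2)
    ∂((Measure.pi fun _ : Fin m => withinLaw Q strat s).prod (withinLaw Q strat s))

lemma measurable_fitError (hm : mhat.IsMeasurable) (m : ℕ) (a : Bool) :
    Measurable (Function.uncurry (fitError Q mhat m a)) := by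
  have h : Measurable fun p : (Fin m → PO k) × PO k =>
      (covariate p.2, fun l : Fin m => (outcome a (p.1 l), covariate (p.1 l))) := by
    refine (measurable_covariate.comp measurable_snd).prodMk (measurable_pi_lambda _ fun l => ?_)
    exact (measurable_outcome.prodMk measurable_covariate).comp
      ((measurable_pi_apply l).comp measurable_fst)
  exact ((hm m a).comp h).sub (measurable_condMean.comp (measurable_covariate.comp measurable_snd))

lemma measurable_fitErrorOn {Ω : Type*} [MeasurableSpace Ω] {W : ℕ → Ω → PO k}
    (hm : mhat.IsMeasurable) (hW : ∀ i, Measurable (W i)) (Γ : Finset ℕ) (a : Bool) (i : ℕ) :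
    Measurable (fitErrorOn Q mhat W Γ a i) :=
  (measurable_fitError hm Γ.card a).comp ((measurable_pi_lambda _ fun _ => hW _).prodMk (hW i))

/-- Consistency under the within-stratum law, whose regression function is the one of the
population. -/
lemma tendsto_regressionMSE (hstrat : Measurable strat)
    (hY : MemLp (outcome a) 2 (Q : Measure (PO k)))
    (hs : (Q : Measure (PO k)) (stratum strat s) ≠ 0)
    (hcons : mhat.IsConsistent (stratumLaw Q strat s hs)) :
    Tendsto (regressionMSE Q strat mhat a s) atTop (𝓝 0) := by
  have : IsProbabilityMeasure (withinLaw Q strat s) := isProbabilityMeasure_withinLaw hs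
  refine (hcons a).congr fun m => ?_
  change ∫⁻ p : PO k × (Fin m → PO k), _ ∂((withinLaw Q strat s).prod
    (Measure.pi fun _ : Fin m => withinLaw Q strat s)) = _
  refine Eq.trans ?_ (lintegral_prod_swap _)
  refine lintegral_congr_ae ?_
  filter_upwards [Measure.quasiMeasurePreserving_fst.ae (condMean_stratumLaw_ae_eq hstrat hY hs)]
    with p hp
  rw [hp]
  rfl

end MeanSquaredError

section Negligible

variable {Ω : Type*} [MeasurableSpace Ω] {P : Measure Ω} {k S : ℕ} {Q : ProbabilityMeasure (PO k)}
  {W : ℕ → Ω → PO k} {strat : (Fin k → ℝ) → Fin S} {π : Fin S → ℝ} {A : ℕ → ℕ → Ω → Bool}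
  {α : (n : ℕ) → (Fin n → Bool) → (Fin n → Fin S) → ℝ}
  {n J : ℕ} {U : ℕ → Bool → Fin S → Ω → ℝ} {G : ℕ → Bool → Fin S → Fin J → Ω → Finset ℕ}
  {pihat : ℕ → Fin S → Ω → ℝ} {mhat : RegressionEstimator k} {s : Fin S}

/-- A sequence is negligible if, for configurations in the balanced events, its conditional tail
probabilities given the configuration are uniformly small. -/
lemma tendstoInMeasure_zero_of_config (hW : IsIIDSample P Q W) (hstrat : Measurable strat)
    (hπ : ∀ s, π s ∈ Set.Ioo (0 : ℝ) 1) (hA : IsCARAssignment P Q W strat π α A)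
    (hG : IsSampleSplit P W strat A U J G) (hbal : WeakBalance P Q W strat π A)
    (hs : (Q : Measure (PO k)) (stratum strat s) ≠ 0) {T : ℕ → Ω → ℝ}
    (hT : ∀ M ε : ℝ, 0 < ε → ∀ η : ENNReal, 0 < η → ∀ᶠ n in atTop,
      ∀ ω₀ ∈ balanceEvent Q W strat π A n s M,
        P ({ω | ε ≤ |T n ω|} ∩ config strat W A G n ⁻¹' {config strat W A G n ω₀})
          ≤ η * P (config strat W A G n ⁻¹' {config strat W A G n ω₀})) :
    TendstoInMeasure P T atTop (fun _ => (0 : ℝ)) := by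
  have := hW.isProbabilityMeasure
  rw [tendstoInMeasure_iff_norm]
  intro ε hε
  simp only [sub_zero, Real.norm_eq_abs]
  rw [ENNReal.tendsto_nhds_zero]
  intro δ hδ
  have hδ2 : 0 < δ / 2 := ENNReal.half_pos hδ.ne'
  obtain ⟨M, hM⟩ := exists_measure_compl_balanceEvent_le hW hstrat hπ hA hbal hs hδ2
  filter_upwards [hM, hT M ε hε (δ / 2) hδ2] with n h1 h2
  calc P {ω | ε ≤ |T n ω|}
      ≤ P (balanceEvent Q W strat π A n s M)ᶜ + δ / 2 :=
        measure_le_of_fibers (measurableSet_config_fiber hW.measurable hstrat hA.measurable hG) h2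
    _ ≤ δ / 2 + δ / 2 := by gcongr
    _ = δ := ENNReal.add_halves δ

/-- Residuals are centred given the configuration, and their weights are `O(1 / n)` on balanced
events. -/
lemma tendstoInMeasure_residualTerm (hW : IsIIDSample P Q W) (hstrat : Measurable strat)
    (hπ : ∀ s, π s ∈ Set.Ioo (0 : ℝ) 1) (hA : IsCARAssignment P Q W strat π α A)
    (hG : IsSampleSplit P W strat A U J G) (hbal : WeakBalance P Q W strat π A)
    (hp : IsProportionChoice W strat π A pihat) {a : Bool}
    (hY : MemLp (outcome a) 2 (Q : Measure (PO k)))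
    (hs : (Q : Measure (PO k)) (stratum strat s) ≠ 0) :
    TendstoInMeasure P (fun n => residualTerm Q W strat π A pihat n a s) atTop
      (fun _ => (0 : ℝ)) := by
  have := hW.isProbabilityMeasure
  have : IsProbabilityMeasure (withinLaw Q strat s) := isProbabilityMeasure_withinLaw hs
  refine tendstoInMeasure_zero_of_config hW hstrat hπ hA hG hbal hs fun M ε hε η hη => ?_
  have hres : MemLp (residual Q a) 2 (withinLaw Q strat s) := memLp_withinLaw (memLp_residual hY)
  set R : ENNReal := ∫⁻ p : (Fin 0 → PO k) × PO k, ENNReal.ofReal (residual Q a p.2 ^ 2)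
    ∂((Measure.pi fun _ : Fin 0 => withinLaw Q strat s).prod (withinLaw Q strat s)) with hR
  have hRfin : R ≠ ⊤ :=
    (hres.comp_measurePreserving measurePreserving_snd).integrable_sq.lintegral_lt_top.ne
  have hlim : Tendsto (fun n : ℕ => ENNReal.ofReal ((2 * M / share π a s ^ 2) ^ 2 / n) * R
      / ENNReal.ofReal (ε ^ 2)) atTop (𝓝 0) := by
    have h1 := ENNReal.tendsto_ofReal
      (tendsto_const_div_atTop_nhds_zero_nat ((2 * M / share π a s ^ 2) ^ 2))
    have h2 := ENNReal.Tendsto.div_const (ENNReal.Tendsto.mul_const h1 (Or.inr hRfin))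
      (b := ENNReal.ofReal (ε ^ 2)) (Or.inr (by simp [hε.ne']))
    simpa using h2
  filter_upwards [ENNReal.tendsto_nhds_zero.1 hlim η hη, eventually_gt_atTop 0] with n hn hn0 ω₀ hω₀
  set F := config strat W A G n ⁻¹' {config strat W A G n ω₀}
  have hFm : MeasurableSet F :=
    measurableSet_config_fiber hW.measurable hstrat hA.measurable hG _
  set c : ℝ := (Real.sqrt n)⁻¹ * ((share (fun t => pihat n t ω₀) a s)⁻¹ - (share π a s)⁻¹) with hc
  have hset : {ω | ε ≤ |residualTerm Q W strat π A pihat n a s ω|} ∩ F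
      = {ω | ε ≤ |∑ i ∈ group strat W A n a s ω₀, c * residual Q a (W i ω)|} ∩ F := by
    ext ω
    simp only [Set.mem_inter_iff, Set.mem_ofPred_eq, and_congr_left_iff]
    intro hω
    rw [residualTerm_eq_of_config_eq hp hω]
  rw [hset]
  have hmeas : Measurable fun ω => ∑ i ∈ group strat W A n a s ω₀, c * residual Q a (W i ω) :=
    Finset.measurable_sum _ fun i _ => (measurable_residual.comp (hW.measurable i)).const_mul c
  refine (measure_abs_ge_inter_le hmeas hFm (fun hF => ?_) hε).trans (mul_le_mul_left hn _)
  -- residuals involve no training units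
  refine (hasSampleLaw_config hW hstrat hA hG ω₀).lintegral_cond_sum_sq_le (t := s)
    (e := fun l : Fin 0 => l.elim0) (f := fun _ w => residual Q a w) hW.measurable hFm hF hs
    (fun i hi => ⟨(mem_group.1 hi).1, (mem_group.1 hi).2.2⟩) (fun l => l.elim0) (fun l => l.elim0)
    (fun l => l.elim0) (measurable_residual.comp measurable_snd) (fun _ => c) fun _ => ?_
  refine (lintegral_sum_mul_sq_pi_le_of_integral_eq_zero _ hres
    (integral_residual_withinLaw hstrat hY s) _).trans (mul_le_mul_left ?_ _)
  refine ENNReal.ofReal_le_ofReal ?_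
  rw [Finset.sum_coe_sort (group strat W A n a s ω₀) fun _ => c ^ 2]
  exact hp.sum_sq_weight_le hπ hn0 hω₀ a

/-- Given the configuration, a fold is independent of its training units. The regression errors in
the fold need not be centred, but their weights nearly sum to 0, so that the conditional second
moment is bounded by a multiple of the mean squared error at the training sample size. -/
lemma tendstoInMeasure_regressionTerm (hW : IsIIDSample P Q W) (hstrat : Measurable strat)
    (hπ : ∀ s, π s ∈ Set.Ioo (0 : ℝ) 1) (hA : IsCARAssignment P Q W strat π α A)
    (hJ : 2 ≤ J) (hG : IsSampleSplit P W strat A U J G) (hbal : WeakBalance P Q W strat π A)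
    (hp : IsProportionChoice W strat π A pihat) (hm : mhat.IsMeasurable) {a : Bool}
    (hY : MemLp (outcome a) 2 (Q : Measure (PO k)))
    (hs : (Q : Measure (PO k)) (stratum strat s) ≠ 0)
    (hcons : mhat.IsConsistent (stratumLaw Q strat s hs)) (j : Fin J) :
    TendstoInMeasure P (fun n => regressionTerm Q mhat W strat A G pihat n a s j) atTop
      (fun _ => (0 : ℝ)) := by
  have := hW.isProbabilityMeasure
  have : IsProbabilityMeasure (withinLaw Q strat s) := isProbabilityMeasure_withinLaw hs
  refine tendstoInMeasure_zero_of_config hW hstrat hπ hA hG hbal hs fun M ε hε η hη => ?_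
  set C : ℝ := (1 + 2 / share π a s) ^ 2
    + (2 * M / share π a s + 2 * J + 2 * J / share π a s) ^ 2 with hC
  have hlim : Tendsto (fun m : ℕ => ENNReal.ofReal C * regressionMSE Q strat mhat a s m
      / ENNReal.ofReal (ε ^ 2)) atTop (𝓝 0) := by
    have h1 := tendsto_regressionMSE hstrat hY hs hcons
    have h2 := ENNReal.Tendsto.div_const (ENNReal.Tendsto.const_mul (a := ENNReal.ofReal C) h1
      (Or.inr ENNReal.ofReal_ne_top)) (b := ENNReal.ofReal (ε ^ 2)) (Or.inr (by simp [hε.ne']))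
    simpa using h2
  obtain ⟨m₀, hm₀⟩ := eventually_atTop.1 (ENNReal.tendsto_nhds_zero.1 hlim η hη)
  have hps : 0 < (Q : Measure (PO k)).real (stratum strat s) :=
    ENNReal.toReal_pos hs (measure_ne_top _ _)
  -- in balanced configurations the number of training units grows linearly
  have hsize : ∀ᶠ n : ℕ in atTop, (m₀ : ℝ)
      ≤ share π a s / 2 * ((Q : Measure (PO k)).real (stratum strat s) / 2) / 2 * n - J := by
    have hpos : 0 < share π a s / 2 * ((Q : Measure (PO k)).real (stratum strat s) / 2) / 2 := by
      have := share_pos hπ a s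
      positivity
    filter_upwards [(tendsto_natCast_atTop_atTop (R := ℝ)).eventually_ge_atTop
      ((m₀ + J) / (share π a s / 2 * ((Q : Measure (PO k)).real (stratum strat s) / 2) / 2))]
      with n hn
    rw [div_le_iff₀ hpos] at hn
    linarith
  filter_upwards [hsize, eventually_gt_atTop 0] with n hn hn0 ω₀ hω₀
  set F := config strat W A G n ⁻¹' {config strat W A G n ω₀}
  have hFm : MeasurableSet F :=
    measurableSet_config_fiber hW.measurable hstrat hA.measurable hG _
  set Γ := group strat W A n a s ω₀ \ G n a s j ω₀ with hΓ
  have hΓcard : m₀ ≤ Γ.card := by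
    have h1 := hG.card_group_sdiff_fold_ge (n := n) hJ a s j ω₀
    rw [card_group_eq_share_mul] at h1
    have h2 := share_treatedProportion_ge hω₀ a
    have h3 := hω₀.2.2
    have h4 : share π a s / 2 * ((Q : Measure (PO k)).real (stratum strat s) / 2 * n)
        ≤ share (fun t => treatedProportion strat W A n t ω₀) a s
          * (stratumUnits strat W n s ω₀).card := by
      have := share_pos hπ a s
      have : 0 ≤ share (fun t => treatedProportion strat W A n t ω₀) a s := by linarith
      gcongr
    have h5 : (m₀ : ℝ) ≤ Γ.card := by linarith
    exact_mod_cast h5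
  have hunits (i : ℕ) (hi : i ∈ stratumUnits strat W n s ω₀) :
      ∃ hi : i < n, labels strat W n ω₀ ⟨i, hi⟩ = s := by
    rw [stratumUnits, Finset.mem_filter, Finset.mem_range] at hi
    exact ⟨hi.1, hi.2⟩
  have hsub := hG.foldUnits_subset (n := n) s j ω₀
  set I := foldUnits G n s j ω₀ with hI
  set c : ℕ → ℝ := fun i => (Real.sqrt n)⁻¹ * foldWeight A pihat n a s i ω₀ with hc
  have hset : {ω | ε ≤ |regressionTerm Q mhat W strat A G pihat n a s j ω|} ∩ F
      = {ω | ε ≤ |∑ i ∈ I, c i * fitErrorOn Q mhat W Γ a i ω|} ∩ F := by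
    ext ω
    simp only [Set.mem_inter_iff, Set.mem_ofPred_eq, and_congr_left_iff]
    intro hω
    rw [regressionTerm_eq_of_config_eq hp hω a s j
      (hsub.trans (Finset.filter_subset _ _))]
  rw [hset]
  have hmeas : Measurable fun ω => ∑ i ∈ I, c i * fitErrorOn Q mhat W Γ a i ω :=
    Finset.measurable_sum _ fun i _ => (measurable_fitErrorOn hm hW.measurable Γ a i).const_mul _
  refine (measure_abs_ge_inter_le hmeas hFm (fun hF => ?_) hε).trans
    (mul_le_mul_left (hm₀ Γ.card hΓcard) _)
  have hmemΓ (l : Fin Γ.card) : Γ.orderEmbOfFin rfl l ∈ Γ := Finset.orderEmbOfFin_mem _ _ _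
  refine (hasSampleLaw_config hW hstrat hA hG ω₀).lintegral_cond_sum_sq_le (t := s)
    (e := fun l : Fin Γ.card => Γ.orderEmbOfFin rfl l) (f := fitError Q mhat Γ.card a)
    hW.measurable hFm hF hs
    (fun i hi => hunits i (hsub hi))
    (fun l => hunits _ (group_subset_stratumUnits a s ω₀ (Finset.mem_sdiff.1 (hmemΓ l)).1))
    (Γ.orderEmbOfFin rfl).injective
    (fun l hl => ?_) (measurable_fitError hm Γ.card a) c fun v => ?_
  · have h1 := Finset.mem_sdiff.1 (hmemΓ l)
    exact h1.2 (hG.mem_fold_iff.2 ⟨hl, (mem_group.1 h1.1).2.1⟩)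
  · refine (lintegral_sum_mul_sq_pi_le _
      ((measurable_fitError hm Γ.card a).comp measurable_prodMk_left) _).trans
      (mul_le_mul_left ?_ _)
    refine ENNReal.ofReal_le_ofReal ?_
    rw [Finset.sum_coe_sort I fun i => c i ^ 2, Finset.sum_coe_sort I c]
    exact hG.sum_sq_foldWeight_le hp hπ hn0 hω₀ a j

end Negligible

/-! ### Asymptotic equivalence of the feasible and the infeasible estimator -/

section ConvergenceInMeasure

variable {Ω : Type*} [MeasurableSpace Ω] {P : Measure Ω}

lemma tendstoInMeasure_zero_of_ae_eq_zero {T : ℕ → Ω → ℝ} (h : ∀ n, T n =ᵐ[P] 0) :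
    TendstoInMeasure P T atTop (fun _ => (0 : ℝ)) := by
  refine TendstoInMeasure.congr_left (f := fun _ _ => (0 : ℝ)) (fun n => (h n).symm) ?_
  rw [tendstoInMeasure_iff_norm]
  intro ε hε
  simp [hε.not_ge]

lemma tendstoInMeasure_zero_add {X Y : ℕ → Ω → ℝ}
    (hX : TendstoInMeasure P X atTop (fun _ => (0 : ℝ)))
    (hY : TendstoInMeasure P Y atTop (fun _ => (0 : ℝ))) :
    TendstoInMeasure P (fun n ω => X n ω + Y n ω) atTop (fun _ => (0 : ℝ)) := by
  rw [tendstoInMeasure_iff_norm] at *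
  intro ε hε
  have h := (hX (ε / 2) (half_pos hε)).add (hY (ε / 2) (half_pos hε))
  rw [add_zero] at h
  refine tendsto_of_tendsto_of_tendsto_of_le_of_le tendsto_const_nhds h (fun _ => zero_le)
    fun n => (measure_mono fun ω hω => ?_).trans (measure_union_le _ _)
  simp only [sub_zero, Set.mem_union, Set.mem_ofPred_eq] at hω ⊢
  by_contra! hcon
  linarith [norm_add_le (X n ω) (Y n ω), hcon.1, hcon.2]

lemma tendstoInMeasure_zero_sum {ι : Type*} (I : Finset ι) {X : ι → ℕ → Ω → ℝ}
    (hX : ∀ i ∈ I, TendstoInMeasure P (X i) atTop (fun _ => (0 : ℝ))) :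
    TendstoInMeasure P (fun n ω => ∑ i ∈ I, X i n ω) atTop (fun _ => (0 : ℝ)) := by
  classical
  induction I using Finset.induction_on with
  | empty => exact tendstoInMeasure_zero_of_ae_eq_zero fun n => by simp; rfl
  | insert i I hi ih =>
    simp_rw [Finset.sum_insert hi]
    exact tendstoInMeasure_zero_add (hX i (Finset.mem_insert_self i I))
      (ih fun j hj => hX j (Finset.mem_insert_of_mem hj))

lemma tendstoInMeasure_zero_armSign_mul (a : Bool) {X : ℕ → Ω → ℝ}
    (hX : TendstoInMeasure P X atTop (fun _ => (0 : ℝ))) :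
    TendstoInMeasure P (fun n ω => armSign a * X n ω) atTop (fun _ => (0 : ℝ)) := by
  rw [tendstoInMeasure_iff_norm] at *
  simpa [show |armSign a| = 1 by cases a <;> simp [armSign]] using hX

end ConvergenceInMeasure

section Feasible

variable {Ω : Type*} [MeasurableSpace Ω] {P : Measure Ω} {k S : ℕ} {Q : ProbabilityMeasure (PO k)}
  {W : ℕ → Ω → PO k} {strat : (Fin k → ℝ) → Fin S} {π : Fin S → ℝ} {A : ℕ → ℕ → Ω → Bool}
  {α : (n : ℕ) → (Fin n → Bool) → (Fin n → Fin S) → ℝ}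
  {n J : ℕ} {U : ℕ → Bool → Fin S → Ω → ℝ} {G : ℕ → Bool → Fin S → Fin J → Ω → Finset ℕ}
  {pihat : ℕ → Fin S → Ω → ℝ} {mhat : RegressionEstimator k}

lemma measurable_residualTerm (hW : ∀ i, Measurable (W i)) (hstrat : Measurable strat)
    (hA : ∀ n i, Measurable (A n i)) (hG : IsSampleSplit P W strat A U J G)
    (hp : IsProportionChoice W strat π A pihat) (a : Bool) (s : Fin S) :
    Measurable (residualTerm Q W strat π A pihat n a s) :=
  measurable_of_eqOn_fibers (measurableSet_config_fiber (n := n) hW hstrat hA hG) fun _ =>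
    ⟨_, Finset.measurable_sum _ fun i _ => (measurable_residual.comp (hW i)).const_mul _,
      fun _ h => residualTerm_eq_of_config_eq hp h a s⟩

lemma measurable_regressionTerm (hW : ∀ i, Measurable (W i)) (hstrat : Measurable strat)
    (hA : ∀ n i, Measurable (A n i)) (hG : IsSampleSplit P W strat A U J G)
    (hp : IsProportionChoice W strat π A pihat) (hm : mhat.IsMeasurable) (a : Bool) (s : Fin S)
    (j : Fin J) : Measurable (regressionTerm Q mhat W strat A G pihat n a s j) :=
  measurable_of_eqOn_fibers (measurableSet_config_fiber (n := n) hW hstrat hA hG) fun ω₀ =>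
    ⟨_, Finset.measurable_sum _ fun i _ => (measurable_fitErrorOn hm hW _ a i).const_mul _,
      fun _ h => regressionTerm_eq_of_config_eq hp h a s j
        ((hG.foldUnits_subset s j ω₀).trans (Finset.filter_subset _ _))⟩

/-- The estimated regression functions and proportions do not affect the estimator to first
order. -/
lemma tendstoInMeasure_feasible_sub (hW : IsIIDSample P Q W) (hstrat : Measurable strat)
    (hπ : ∀ s, π s ∈ Set.Ioo (0 : ℝ) 1) (hA : IsCARAssignment P Q W strat π α A)
    (hJ : 2 ≤ J) (hG : IsSampleSplit P W strat A U J G) (hbal : WeakBalance P Q W strat π A)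
    (hp : IsProportionChoice W strat π A pihat) (hm : mhat.IsMeasurable)
    (hY : ∀ a, MemLp (outcome a) 2 (Q : Measure (PO k)))
    (hcons : ∀ s (hs : (Q : Measure (PO k)) (stratum strat s) ≠ 0),
      mhat.IsConsistent (stratumLaw Q strat s hs)) :
    TendstoInMeasure P (fun (n : ℕ) ω =>
        Real.sqrt n * (feasible mhat W strat A G pihat n ω - ate Q)
          - Real.sqrt n * (infeasible Q W strat π A n ω - ate Q)) atTop (fun _ => (0 : ℝ)) := by
  simp_rw [hG.sqrt_mul_feasible_sub]
  refine tendstoInMeasure_zero_sum _ fun a _ => tendstoInMeasure_zero_armSign_mul a <|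
    tendstoInMeasure_zero_sum _ fun s _ => ?_
  by_cases hs : (Q : Measure (PO k)) (stratum strat s) = 0
  · refine tendstoInMeasure_zero_of_ae_eq_zero fun n => ?_
    filter_upwards [ae_stratumUnits_eq_empty hW hstrat hs] with ω hω
    have h1 : group strat W A n a s ω = ∅ :=
      Finset.subset_empty.1 (hω n ▸ group_subset_stratumUnits a s ω)
    have h2 (j : Fin J) : foldUnits G n s j ω = ∅ :=
      Finset.subset_empty.1 (hω n ▸ hG.foldUnits_subset s j ω)
    simp [residualTerm, regressionTerm, h1, h2]
  · exact tendstoInMeasure_zero_add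
      (tendstoInMeasure_residualTerm hW hstrat hπ hA hG hbal hp (hY a) hs)
      (tendstoInMeasure_zero_sum _ fun j _ =>
        tendstoInMeasure_regressionTerm hW hstrat hπ hA hJ hG hbal hp hm (hY a) hs (hcons s hs) j)

lemma tendstoInDistribution_feasible [IsProbabilityMeasure P] (hW : IsIIDSample P Q W)
    (hstrat : Measurable strat)
    (hπ : ∀ s, π s ∈ Set.Ioo (0 : ℝ) 1) (hA : IsCARAssignment P Q W strat π α A)
    (hJ : 2 ≤ J) (hG : IsSampleSplit P W strat A U J G) (hbal : WeakBalance P Q W strat π A)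
    (hp : IsProportionChoice W strat π A pihat) (hm : mhat.IsMeasurable)
    (hY : ∀ a, MemLp (outcome a) 2 (Q : Measure (PO k)))
    (hcons : ∀ s (hs : (Q : Measure (PO k)) (stratum strat s) ≠ 0),
      mhat.IsConsistent (stratumLaw Q strat s hs)) :
    TendstoInDistribution
      (fun (n : ℕ) ω => Real.sqrt n * (feasible mhat W strat A G pihat n ω - ate Q))
      atTop (fun x : ℝ => x) (fun _ => P)
      (gaussianReal 0 (efficiencyBound Q strat π).toNNReal) := by
  have hclt := tendstoInDistribution_infeasible hW hstrat hπ hA hY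
  refine tendstoInDistribution_of_tendstoInMeasure_sub _ _ hclt
    (tendstoInMeasure_feasible_sub hW hstrat hπ hA hJ hG hbal hp hm hY hcons) fun n => ?_
  have herr : Measurable fun ω =>
      Real.sqrt n * (feasible mhat W strat A G pihat n ω - ate Q)
        - Real.sqrt n * (infeasible Q W strat π A n ω - ate Q) := by
    simp_rw [hG.sqrt_mul_feasible_sub]
    refine Finset.measurable_sum _ fun a _ => Measurable.const_mul ?_ _
    refine Finset.measurable_sum _ fun s _ => Measurable.add ?_ ?_
    · exact measurable_residualTerm hW.measurable hstrat hA.measurable hG hp a s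
    · exact Finset.measurable_sum _ fun j _ =>
        measurable_regressionTerm hW.measurable hstrat hA.measurable hG hp hm a s j
  refine (herr.aemeasurable.add (hclt.forall_aemeasurable n)).congr (ae_of_all _ fun ω => ?_)
  simp

end Feasible

end CAR

theorem mainTheorem2 {Ω : Type*} [MeasurableSpace Ω] (P : Measure Ω) [IsProbabilityMeasure P]
    {k S : ℕ}
    -- stratification, target proportions and assignment mechanism, known to the experimenter
    (strat : (Fin k → ℝ) → Fin S) (hstrat : Measurable strat)
    (π : Fin S → ℝ) (hπ : ∀ s, π s ∈ Set.Ioo (0 : ℝ) 1)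
    (α : (n : ℕ) → (Fin n → Bool) → (Fin n → Fin S) → ℝ)
    -- the model and the true population law
    (μ₀ μ₁ : Measure ℝ) [SigmaFinite μ₀] [SigmaFinite μ₁]
    (μZ : Measure (Fin k → ℝ)) [SigmaFinite μZ]
    (Qfam : Set (ProbabilityMeasure (CAR.PO k)))
    (hQfam : CAR.IsPopulationFamily μ₀ μ₁ μZ Qfam)
    (Q₀ : ProbabilityMeasure (CAR.PO k)) (hQ₀ : Q₀ ∈ Qfam)
    -- the sample and the treatment assignments
    (W : ℕ → Ω → CAR.PO k) (hW : CAR.IsIIDSample P Q₀ W)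
    (A : ℕ → ℕ → Ω → Bool) (hA : CAR.IsCARAssignment P Q₀ W strat π α A) :
    ((∀ (n : ℕ) (ω : Ω),
        Real.sqrt n * (CAR.infeasible Q₀ W strat π A n ω - CAR.ate Q₀)
          = (1 / Real.sqrt n) * ∑ i ∈ Finset.range n,
              CAR.influence Q₀ strat π (CAR.obs W A n i ω) (A n i ω) (CAR.covariate (W i ω))) ∧
      TendstoInDistribution
        (fun (n : ℕ) ω => Real.sqrt n * (CAR.infeasible Q₀ W strat π A n ω - CAR.ate Q₀))
        atTop (fun x : ℝ => x) (fun _ => P)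
        (gaussianReal 0 (CAR.efficiencyBound Q₀ strat π).toNNReal)) ∧
    (∀ (mhat : CAR.RegressionEstimator k), mhat.IsMeasurable →
      -- the laws under which the regression estimator is consistent
      ∀ (Qm : Set (ProbabilityMeasure (CAR.PO k))), Qm ⊆ Qfam →
        (∀ Q ∈ Qm, mhat.IsConsistent Q) → Q₀ ∈ Qm →
        (∀ (s : Fin S) (hs : (Q₀ : Measure (CAR.PO k)) (CAR.stratum strat s) ≠ 0),
          CAR.stratumLaw Q₀ strat s hs ∈ Qm) →
      -- cross-fitting
      ∀ (J : ℕ), 2 ≤ J →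
      ∀ (U : ℕ → Bool → Fin S → Ω → ℝ) (G : ℕ → Bool → Fin S → Fin J → Ω → Finset ℕ),
        CAR.IsSampleSplit P W strat A U J G →
      -- the proportions used by the estimator
      ∀ (pihat : ℕ → Fin S → Ω → ℝ),
        (∀ s, (∀ n ω, pihat n s ω = π s) ∨
          (∀ n ω, pihat n s ω = CAR.treatedProportion strat W A n s ω)) →
        CAR.WeakBalance P Q₀ W strat π A →
      TendstoInMeasure P
        (fun (n : ℕ) ω =>
          Real.sqrt n * (CAR.feasible mhat W strat A G pihat n ω - CAR.ate Q₀)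
            - Real.sqrt n * (CAR.infeasible Q₀ W strat π A n ω - CAR.ate Q₀))
        atTop (fun _ => (0 : ℝ)) ∧
      TendstoInDistribution
        (fun (n : ℕ) ω => Real.sqrt n * (CAR.feasible mhat W strat A G pihat n ω - CAR.ate Q₀))
        atTop (fun x : ℝ => x) (fun _ => P)
        (gaussianReal 0 (CAR.efficiencyBound Q₀ strat π).toNNReal)) := by
  have hY := hQfam.memLp_two Q₀ hQ₀
  refine ⟨⟨CAR.sqrt_mul_infeasible_sub,
    CAR.tendstoInDistribution_infeasible hW hstrat hπ hA hY⟩, ?_⟩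
  intro mhat hm Qm _ hcons _ hQm J hJ U G hG pihat hp hbal
  have hcons' (s : Fin S) (hs : (Q₀ : Measure (CAR.PO k)) (CAR.stratum strat s) ≠ 0) :
      mhat.IsConsistent (CAR.stratumLaw Q₀ strat s hs) := hcons _ (hQm s hs)
  exact ⟨CAR.tendstoInMeasure_feasible_sub hW hstrat hπ hA hJ hG hbal hp hm hY hcons',
    CAR.tendstoInDistribution_feasible hW hstrat hπ hA hJ hG hbal hp hm hY hcons'⟩
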